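/- **Proposition 4.3 (C-statistical free double-bosonisation).** Let $n\ge 0$, let $(\beta_{ij})$ be a complex $n\times n$ matrix (a bilinear form), fix $\ell\in\mathbb C$, and write $q=e^{\ell}$ and $q^{x}=e^{\ell x}$. Let $q_1,\dots,q_n$ be nonzero complex numbers with $q_i-q_i^{-1}\neq 0$. *The quantum group.* Put $H^i=\sum_j\beta_{ij}\xi_j$ and $H_i=\sum_j\xi_j\beta_{ji}$. Let $U_q(\beta)$ be the algebra of functions of commuting complex variables $\xi_1,\dots,\xi_n$ generated by the $\xi_i$ and their exponentials $q^{\pm H^i},q^{\pm H_i}$, with the Hopf algebra structure in which $\Delta\xi_i=\xi_i\otimes1+1\otimes\xi_i$ (so that $q^{\pm H^i},q^{\pm H_i}$ are group-like), and with $\mathcal R=q^{\sum\beta_{ij}\xi_i\otimes\xi_j}$. An element $h$ of $U_q(\beta)$ acts from the right on the component of degree $d\in\mathbb Z^n$ of a $\mathbb Z^n$-graded space as the scalar $h(d)$, so $b\triangleleft\xi_i=|b|_i\,b$. When one leg of $\mathcal R$ acts on a component of given degree, the other leg is an element of $U_q(\beta)$, and $\mathcal R$ is used below only in this way. The induced braiding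 is $\Psi(b\otimes c)=c\triangleleft\mathcal R^{(1)}\otimes b\triangleleft\mathcal R^{(2)}=q^{\sum\beta_{ij}|c|_i|b|_j}\,c\otimes b$. *The braided groups.* Let $B=\mathbb C\langle e^1,\dots,e^n\rangle$ with $|e^i|_j=\delta_{ij}$ and $C=B^\star=\mathbb C\langle f_1,\dots,f_n\rangle$ with $|f_i|_j=-\delta_{ij}$ be the free algebras. Give them the braided coproducts $\underline\Delta$ that are multiplicative into the braided tensor square (product $(a\otimes b)(c\otimes d)=a\,\Psi(b\otimes c)\,d$) with all generators primitive, and the counits killing the generators. Let $\mathrm{ev}:C\otimes B\to\mathbb C$ be the pairing with $\mathrm{ev}(1,b)=\epsilon(b)$, $\mathrm{ev}(f_i,e^j)=\delta_i^j(q_i-q_i^{-1})^{-1}$, vanishing on $f_i\otimes b$ for words $b$ of length other than $1$, and $\mathrm{ev}(cd,b)=\mathrm{ev}(d,b_{(1)})\,\mathrm{ev}(c,b_{(2)})$. *Double-bosonisation.* A double-bosonisation of $(B,C)$ over $H=U_q(\beta)$ is a Hopf algebra $D$ containing $C^{\rm op}$ and $B$ as subalgebras and $H$ as a sub-Hopf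 algebra, such that $c\otimes h\otimes b\mapsto chb$ is a linear isomorphism $C\otimes H\otimes B\to D$, and such that for all $b\in B$, $c\in C$, $h\in H$ $$bh=h_{(1)}(b\triangleleft h_{(2)}),\qquad ch=h_{(2)}(c\triangleleft h_{(1)}),$$ $$b_{(1)}\mathcal R^{(1)}c_{(1)}\,\mathrm{ev}(c_{(2)}\triangleleft\mathcal R^{(2)},b_{(2)})=\mathrm{ev}(c_{(1)},b_{(1)}\triangleleft\mathcal R^{(1)})\,c_{(2)}\mathcal R^{(2)}b_{(2)},$$ $$\Delta b=b_{(1)}\triangleleft\mathcal R^{(1)}\otimes\mathcal R^{(2)}b_{(2)},\qquad \Delta c=\mathcal R^{(1)}c_{(1)}\otimes c_{(2)}\triangleleft\mathcal R^{(2)},$$ where $b_{(1)}\otimes b_{(2)}$ and $c_{(1)}\otimes c_{(2)}$ denote the braided coproducts. Then $B$ and $C$ are braided groups (Hopf algebras in the category of $\mathbb Z^n$-graded spaces with braiding $\Psi$). The map $\mathrm{ev}$ is a duality pairing: it satisfies the above, it satisfies $\mathrm{ev}(c,1)=\epsilon(c)$ and $\mathrm{ev}(c,ab)=\mathrm{ev}(c_{(2)},a)\,\mathrm{ev}(c_{(1)},b)$,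 and $\mathrm{ev}(c,b)=0$ for homogeneous $c,b$ with $|c|+|b|\ne0$. A double-bosonisation exists, and every double-bosonisation $D$ has the following properties. 1. The $e^i$ generate a free algebra, the $f_i$ generate a free algebra, $U_q(\beta)$ embeds in $D$, and the $\xi_i$ commute. 2. The following relations hold: $$e^iq^{H^j}=q^{H^j}e^i\,q^{\beta_{ji}},\qquad f_iq^{H_j}=q^{H_j}f_i\,q^{-\beta_{ij}},\qquad [e^i,f_j]=\delta^i_j\,\frac{q^{H^i}-q^{-H_i}}{q_i-q_i^{-1}},$$ $$e^iq^{H_j}=q^{H_j}e^i\,q^{\beta_{ij}},\qquad f_iq^{H^j}=q^{H^j}f_i\,q^{-\beta_{ji}},\qquad [e^i,\xi_j]=\delta_{ij}e^i,\qquad [f_i,\xi_j]=-\delta_{ij}f_i.$$ 3. The coproduct is given by $$\Delta e^i=e^i\otimes q^{H^i}+1\otimes e^i,\qquad \Delta f_i=f_i\otimes1+q^{-H_i}\otimes f_i,\qquad \Delta\xi_i=\xi_i\otimes1+1\otimes\xi_i.$$ 4. These are defining relations: $D$ is the algebra generated over $U_q(\beta)$ by the $e^i$ and $f_i$ subject to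 the relations in 2. Moreover the subalgebra of $D$ generated by the $e^i$, the $f_i$ and $q^{\pm H^i},q^{\pm H_i}$ is the algebra generated, over the subalgebra of $U_q(\beta)$ generated by these exponentials, by the $e^i,f_i$ subject to those relations in 2 in which no $\xi_j$ appears on its own. -/

import Mathlib

open scoped TensorProduct DirectSum

universe u v w

/-!
Conventions.  `n` is a finite index type, `β : Matrix n n ℂ` a bilinear form on `ℂⁿ`, and `ℓ : ℂ`
a logarithm of the deformation parameter, so that `q = exp ℓ` and `q ^ x = exp (ℓ * x)` for `x : ℂ`.
All actions are from the right.
-/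

namespace CStat

section GradedSpaces

variable {n : Type*} [Fintype n]

/-- `q ^ x`, where `q = exp ℓ`. -/
noncomputable def qpow (ℓ x : ℂ) : ℂ := Complex.exp (ℓ * x)

/-- A degree in `ℤⁿ`, seen as a point of `ℂⁿ`. -/
def toPt (d : n → ℤ) : n → ℂ := fun i => (d i : ℂ)

/-- The linear map on a `ℤⁿ`-graded space which is `T d` on the component of degree `d`. -/
noncomputable def byDegree {V W : Type*} [AddCommMonoid V] [Module ℂ V]
    [AddCommMonoid W] [Module ℂ W] (𝓥 : (n → ℤ) → Submodule ℂ V) [DirectSum.Decomposition 𝓥]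
    (T : (n → ℤ) → V →ₗ[ℂ] W) : V →ₗ[ℂ] W :=
  (DirectSum.toModule ℂ (n → ℤ) W fun d => T d ∘ₗ (𝓥 d).subtype) ∘ₗ
    (DirectSum.decomposeLinearEquiv 𝓥).toLinearMap

theorem byDegree_of_mem {V W : Type*} [AddCommMonoid V] [Module ℂ V]
    [AddCommMonoid W] [Module ℂ W] (𝓥 : (n → ℤ) → Submodule ℂ V) [DirectSum.Decomposition 𝓥]
    (T : (n → ℤ) → V →ₗ[ℂ] W) {d : n → ℤ} {x : V} (hx : x ∈ 𝓥 d) :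
    byDegree 𝓥 T x = T d x := by
  lift x to 𝓥 d using hx
  simp [byDegree, DirectSum.toModule_lof]

end GradedSpaces

/-! ### The quantum group `U_q(β)` -/

section Cartan

variable {n : Type u} [Fintype n] (ℓ : ℂ) (β : Matrix n n ℂ)

/-- The commuting variable `ξ_i`, as a function on `ℂⁿ`. -/
def xiFun (i : n) : (n → ℂ) → ℂ := fun z => z i

/-- `q ^ (t H^i)` with `H^i = ∑ⱼ β_ij ξ_j`, as a function on `ℂⁿ`. -/
noncomputable def expUpFun (i : n) (t : ℤ) : (n → ℂ) → ℂ :=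
  fun z => qpow ℓ (t * ∑ j, β i j * z j)

/-- `q ^ (t H_i)` with `H_i = ∑ⱼ ξ_j β_ji`, as a function on `ℂⁿ`. -/
noncomputable def expDownFun (i : n) (t : ℤ) : (n → ℂ) → ℂ :=
  fun z => qpow ℓ (t * ∑ j, z j * β j i)

/-- The algebra `U_q(β)`: it is generated by the commuting variables `ξ_i` together with their
exponentials `q ^ (± H^i)` and `q ^ (± H_i)`, as an algebra of functions of the variables. -/
noncomputable def Uq : Subalgebra ℂ ((n → ℂ) → ℂ) :=
  Algebra.adjoin ℂ (Set.range xiFun ∪ {h | ∃ i t, h = expUpFun ℓ β i t} ∪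
    {h | ∃ i t, h = expDownFun ℓ β i t})

/-- The generator `ξ_i` of `U_q(β)`. -/
noncomputable def xi (i : n) : Uq ℓ β :=
  ⟨xiFun i, Algebra.subset_adjoin (Or.inl (Or.inl ⟨i, rfl⟩))⟩

/-- The element `q ^ (t H^i)` of `U_q(β)`. -/
noncomputable def expUp (i : n) (t : ℤ) : Uq ℓ β :=
  ⟨expUpFun ℓ β i t, Algebra.subset_adjoin (Or.inl (Or.inr ⟨i, t, rfl⟩))⟩

/-- The element `q ^ (t H_i)` of `U_q(β)`. -/
noncomputable def expDown (i : n) (t : ℤ) : Uq ℓ β :=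
  ⟨expDownFun ℓ β i t, Algebra.subset_adjoin (Or.inr ⟨i, t, rfl⟩)⟩

/-- The value of an element of `U_q(β)` when the variables `ξ` take the value `z`. -/
noncomputable def evalAt (z : n → ℂ) : Uq ℓ β →ₐ[ℂ] ℂ :=
  (Pi.evalAlgHom ℂ (fun _ : n → ℂ => ℂ) z).comp (Uq ℓ β).val

variable {ℓ β}

theorem evalAt_ext {a b : Uq ℓ β} (h : ∀ z, evalAt ℓ β z a = evalAt ℓ β z b) : a = b :=
  Subtype.ext (funext h)

@[simp] theorem evalAt_xi (z : n → ℂ) (i : n) : evalAt ℓ β z (xi ℓ β i) = z i := rfl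

@[simp] theorem evalAt_expUp (z : n → ℂ) (i : n) (t : ℤ) :
    evalAt ℓ β z (expUp ℓ β i t) = qpow ℓ (t * ∑ j, β i j * z j) := rfl

@[simp] theorem evalAt_expDown (z : n → ℂ) (i : n) (t : ℤ) :
    evalAt ℓ β z (expDown ℓ β i t) = qpow ℓ (t * ∑ j, z j * β j i) := rfl

/-- Induction over the elements of `U_q(β)`. -/
theorem Uq.induction {P : Uq ℓ β → Prop} (hxi : ∀ i, P (xi ℓ β i))
    (hup : ∀ i t, P (expUp ℓ β i t)) (hdown : ∀ i t, P (expDown ℓ β i t))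
    (hc : ∀ c : ℂ, P (algebraMap ℂ _ c)) (hadd : ∀ a b, P a → P b → P (a + b))
    (hmul : ∀ a b, P a → P b → P (a * b)) (a : Uq ℓ β) : P a := by
  obtain ⟨a, ha⟩ := a
  induction ha using Algebra.adjoin_induction with
  | mem x hx =>
    rcases hx with (⟨i, rfl⟩ | ⟨i, t, rfl⟩) | ⟨i, t, rfl⟩
    · exact hxi i
    · exact hup i t
    · exact hdown i t
  | algebraMap c => exact hc c
  | add x y hx hy h1 h2 => exact hadd _ _ h1 h2
  | mul x y hx hy h1 h2 => exact hmul _ _ h1 h2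

theorem tensor_sep {A B : Type*} [AddCommGroup A] [Module ℂ A] [AddCommGroup B] [Module ℂ B]
    {X Y : Type*} (φ : X → A →ₗ[ℂ] ℂ) (ψ : Y → B →ₗ[ℂ] ℂ)
    (hφ : ∀ a a', (∀ x, φ x a = φ x a') → a = a') (hψ : ∀ b b', (∀ y, ψ y b = ψ y b') → b = b')
    {s t : A ⊗[ℂ] B}
    (h : ∀ x y, LinearMap.mul' ℂ ℂ (TensorProduct.map (φ x) (ψ y) s) =
      LinearMap.mul' ℂ ℂ (TensorProduct.map (φ x) (ψ y) t)) : s = t := by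
  classical
  have h0 : ∀ x y (r : A ⊗[ℂ] B), ψ y (TensorProduct.lid ℂ B ((φ x).rTensor B r)) =
      LinearMap.mul' ℂ ℂ (TensorProduct.map (φ x) (ψ y) r) := by
    intro x y r
    induction r using TensorProduct.induction_on with
    | zero => simp
    | tmul a b => simp
    | add a b ha hb => simp_all
  have h1 : ∀ x, TensorProduct.lid ℂ B ((φ x).rTensor B s) =
      TensorProduct.lid ℂ B ((φ x).rTensor B t) := fun x =>
    hψ _ _ fun y => by rw [h0, h0, h]
  let b := Module.Basis.ofVectorSpace ℂ B
  have h2 : ∀ x k (r : A ⊗[ℂ] B), φ x (TensorProduct.equivFinsuppOfBasisRight b r k) =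
      b.repr (TensorProduct.lid ℂ B ((φ x).rTensor B r)) k := by
    intro x k r
    induction r using TensorProduct.induction_on with
    | zero => simp
    | tmul a c => simp [mul_comm]
    | add a c ha hc => simp_all
  apply (TensorProduct.equivFinsuppOfBasisRight b).injective
  ext k
  exact hφ _ _ fun x => by rw [h2, h2, h1]

/-- The value of an element of `U_q(β) ⊗ U_q(β)` at a pair of points. -/
noncomputable def evalAt₂ (z y : n → ℂ) : Uq ℓ β ⊗[ℂ] Uq ℓ β →ₐ[ℂ] ℂ :=
  Algebra.TensorProduct.lift (evalAt ℓ β z) (evalAt ℓ β y) fun _ _ => Commute.all _ _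

@[simp] theorem evalAt₂_tmul (z y : n → ℂ) (a b : Uq ℓ β) :
    evalAt₂ z y (a ⊗ₜ[ℂ] b) = evalAt ℓ β z a * evalAt ℓ β y b := by
  simp [evalAt₂]

theorem evalAt₂_ext {s t : Uq ℓ β ⊗[ℂ] Uq ℓ β} (h : ∀ z y, evalAt₂ z y s = evalAt₂ z y t) :
    s = t := by
  refine tensor_sep (fun z => (evalAt ℓ β z).toLinearMap) (fun z => (evalAt ℓ β z).toLinearMap)
    (fun a b hab => evalAt_ext hab) (fun a b hab => evalAt_ext hab) fun z y => ?_
  have key : ∀ r : Uq ℓ β ⊗[ℂ] Uq ℓ β, LinearMap.mul' ℂ ℂ (TensorProduct.map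
      (evalAt ℓ β z).toLinearMap (evalAt ℓ β y).toLinearMap r) = evalAt₂ z y r := by
    intro r
    induction r using TensorProduct.induction_on with
    | zero => simp
    | tmul a b => simp
    | add a b ha hb => rw [map_add, map_add, map_add, ha, hb]
  rw [key, key, h]

theorem exists_comul (a : Uq ℓ β) :
    ∃ t : Uq ℓ β ⊗[ℂ] Uq ℓ β, ∀ z y, evalAt₂ z y t = evalAt ℓ β (z + y) a := by
  induction a using Uq.induction with
  | hxi i => exact ⟨xi ℓ β i ⊗ₜ 1 + 1 ⊗ₜ xi ℓ β i, fun z y => by simp⟩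
  | hup i t =>
    refine ⟨expUp ℓ β i t ⊗ₜ expUp ℓ β i t, fun z y => ?_⟩
    simp only [evalAt₂_tmul, evalAt_expUp, qpow, ← Complex.exp_add, Pi.add_apply, mul_add,
      Finset.sum_add_distrib]
  | hdown i t =>
    refine ⟨expDown ℓ β i t ⊗ₜ expDown ℓ β i t, fun z y => ?_⟩
    simp only [evalAt₂_tmul, evalAt_expDown, qpow, ← Complex.exp_add, Pi.add_apply, mul_add, add_mul,
      Finset.sum_add_distrib]
  | hc c => exact ⟨algebraMap ℂ _ c, fun z y => by simp⟩
  | hadd a b ha hb =>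
    obtain ⟨s, hs⟩ := ha
    obtain ⟨t, ht⟩ := hb
    exact ⟨s + t, fun z y => by simp [hs, ht]⟩
  | hmul a b ha hb =>
    obtain ⟨s, hs⟩ := ha
    obtain ⟨t, ht⟩ := hb
    exact ⟨s * t, fun z y => by simp [hs, ht]⟩

theorem exists_antipode (a : Uq ℓ β) :
    ∃ t : Uq ℓ β, ∀ z, evalAt ℓ β z t = evalAt ℓ β (-z) a := by
  induction a using Uq.induction with
  | hxi i => exact ⟨-xi ℓ β i, fun z => by simp⟩
  | hup i t => exact ⟨expUp ℓ β i (-t), fun z => by simp⟩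
  | hdown i t => exact ⟨expDown ℓ β i (-t), fun z => by simp⟩
  | hc c => exact ⟨algebraMap ℂ _ c, fun z => by simp⟩
  | hadd a b ha hb =>
    obtain ⟨s, hs⟩ := ha
    obtain ⟨t, ht⟩ := hb
    exact ⟨s + t, fun z => by simp [hs, ht]⟩
  | hmul a b ha hb =>
    obtain ⟨s, hs⟩ := ha
    obtain ⟨t, ht⟩ := hb
    exact ⟨s * t, fun z => by simp [hs, ht]⟩

theorem evalAt₂_choose (a : Uq ℓ β) (z y : n → ℂ) :
    evalAt₂ z y (exists_comul a).choose = evalAt ℓ β (z + y) a := (exists_comul a).choose_spec z y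

theorem evalAt_choose (a : Uq ℓ β) (z : n → ℂ) :
    evalAt ℓ β z (exists_antipode a).choose = evalAt ℓ β (-z) a := (exists_antipode a).choose_spec z

/-- The coproduct of `U_q(β)`, for which the variables are additive: `(Δ h)(z, y) = h (z + y)`. -/
noncomputable def comulUq : Uq ℓ β →ₐ[ℂ] Uq ℓ β ⊗[ℂ] Uq ℓ β where
  toFun a := (exists_comul a).choose
  map_one' := evalAt₂_ext fun z y => by rw [evalAt₂_choose]; simp
  map_mul' a b := evalAt₂_ext fun z y => by rw [map_mul]; simp_rw [evalAt₂_choose]; simp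
  map_zero' := evalAt₂_ext fun z y => by rw [evalAt₂_choose]; simp
  map_add' a b := evalAt₂_ext fun z y => by rw [map_add]; simp_rw [evalAt₂_choose]; simp
  commutes' c := evalAt₂_ext fun z y => by rw [evalAt₂_choose]; simp

/-- The antipode of `U_q(β)`: `(S h)(z) = h (- z)`. -/
noncomputable def antipodeUq : Uq ℓ β →ₐ[ℂ] Uq ℓ β where
  toFun a := (exists_antipode a).choose
  map_one' := evalAt_ext fun z => by rw [evalAt_choose]; simp
  map_mul' a b := evalAt_ext fun z => by rw [map_mul]; simp_rw [evalAt_choose]; simp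
  map_zero' := evalAt_ext fun z => by rw [evalAt_choose]; simp
  map_add' a b := evalAt_ext fun z => by rw [map_add]; simp_rw [evalAt_choose]; simp
  commutes' c := evalAt_ext fun z => by rw [evalAt_choose]; simp

@[simp] theorem evalAt₂_comulUq (z y : n → ℂ) (a : Uq ℓ β) :
    evalAt₂ z y (comulUq a) = evalAt ℓ β (z + y) a := evalAt₂_choose a z y

@[simp] theorem evalAt_antipodeUq (z : n → ℂ) (a : Uq ℓ β) :
    evalAt ℓ β z (antipodeUq a) = evalAt ℓ β (-z) a := evalAt_choose a z

theorem comulUq_xi (i : n) : comulUq (xi ℓ β i) = xi ℓ β i ⊗ₜ[ℂ] 1 + 1 ⊗ₜ[ℂ] xi ℓ β i :=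
  evalAt₂_ext fun z y => by simp

theorem comulUq_expUp (i : n) (t : ℤ) :
    comulUq (expUp ℓ β i t) = expUp ℓ β i t ⊗ₜ[ℂ] expUp ℓ β i t :=
  evalAt₂_ext fun z y => by
    simp only [evalAt₂_comulUq, evalAt₂_tmul, evalAt_expUp, qpow, ← Complex.exp_add, Pi.add_apply,
      mul_add, Finset.sum_add_distrib]

theorem comulUq_expDown (i : n) (t : ℤ) :
    comulUq (expDown ℓ β i t) = expDown ℓ β i t ⊗ₜ[ℂ] expDown ℓ β i t :=
  evalAt₂_ext fun z y => by
    simp only [evalAt₂_comulUq, evalAt₂_tmul, evalAt_expDown, qpow, ← Complex.exp_add, Pi.add_apply,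
      mul_add, add_mul, Finset.sum_add_distrib]

theorem Uq.algHom_ext {A : Type*} [Semiring A] [Algebra ℂ A] {f g : Uq ℓ β →ₐ[ℂ] A}
    (h1 : ∀ i, f (xi ℓ β i) = g (xi ℓ β i)) (h2 : ∀ i t, f (expUp ℓ β i t) = g (expUp ℓ β i t))
    (h3 : ∀ i t, f (expDown ℓ β i t) = g (expDown ℓ β i t)) : f = g := by
  ext a
  induction a using Uq.induction with
  | hxi i => exact h1 i
  | hup i t => exact h2 i t
  | hdown i t => exact h3 i t
  | hc c => simp
  | hadd a b ha hb => simp [ha, hb]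
  | hmul a b ha hb => simp [ha, hb]

noncomputable instance : Bialgebra ℂ (Uq ℓ β) :=
  Bialgebra.ofAlgHom comulUq (evalAt ℓ β 0)
    (by
      apply Uq.algHom_ext
      · intro i
        simp [comulUq_xi, TensorProduct.add_tmul, TensorProduct.tmul_add,
          Algebra.TensorProduct.one_def, add_assoc]
      · intro i t; simp [comulUq_expUp]
      · intro i t; simp [comulUq_expDown])
    (by
      apply Uq.algHom_ext
      · intro i; simp [comulUq_xi]
      · intro i t; simp [comulUq_expUp, qpow]
      · intro i t; simp [comulUq_expDown, qpow])
    (by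
      apply Uq.algHom_ext
      · intro i; simp [comulUq_xi]
      · intro i t; simp [comulUq_expUp, qpow]
      · intro i t; simp [comulUq_expDown, qpow])

/-- The Hopf algebra structure of `U_q(β)`, in which the `ξ_i` are primitive. -/
noncomputable instance : HopfAlgebra ℂ (Uq ℓ β) :=
  HopfAlgebra.ofAlgHom antipodeUq
    (AlgHom.ext fun a => evalAt_ext fun z => by
      have : (evalAt ℓ β z).comp (Algebra.TensorProduct.lift antipodeUq (.id ℂ (Uq ℓ β))
          fun _ _ => Commute.all _ _) = evalAt₂ (-z) z := by
        ext <;> simp [evalAt₂]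
      have h := congr($this (comulUq a))
      rw [evalAt₂_comulUq, neg_add_cancel] at h
      exact h)
    (AlgHom.ext fun a => evalAt_ext fun z => by
      have : (evalAt ℓ β z).comp (Algebra.TensorProduct.lift (.id ℂ (Uq ℓ β)) antipodeUq
          fun _ _ => Commute.all _ _) = evalAt₂ z (-z) := by
        ext <;> simp [evalAt₂]
      have h := congr($this (comulUq a))
      rw [evalAt₂_comulUq, add_neg_cancel] at h
      exact h)

/-- The quasitriangular structure `R = q ^ (∑ β_ij ξ_i ⊗ ξ_j)` of `U_q(β)`, as a function of the
two sets of variables.  It is not an element of the algebraic tensor square of `U_q(β)`, but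
it becomes an element of `U_q(β)` when one leg is evaluated on an integer degree, that is when one
leg acts on a `ℤⁿ`-graded space; see `RFst` and `RSnd`. -/
noncomputable def universalR (ℓ : ℂ) (β : Matrix n n ℂ) (z y : n → ℂ) : ℂ :=
  qpow ℓ (∑ i, ∑ j, β i j * z i * y j)

variable (ℓ β)

/-- `R⁽¹⁾(d) R⁽²⁾`: the element of `U_q(β)` left when the first leg of `R` acts in degree `d`. -/
noncomputable def RFst (d : n → ℤ) : Uq ℓ β := ∏ i, expUp ℓ β i (d i)

/-- `R⁽¹⁾ R⁽²⁾(d)`: the element of `U_q(β)` left when the second leg of `R` acts in degree `d`. -/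
noncomputable def RSnd (d : n → ℤ) : Uq ℓ β := ∏ j, expDown ℓ β j (d j)

theorem evalAt_RFst (d : n → ℤ) (y : n → ℂ) :
    evalAt ℓ β y (RFst ℓ β d) = universalR ℓ β (toPt d) y := by
  simp only [RFst, map_prod, evalAt_expUp, qpow, ← Complex.exp_sum, universalR, toPt,
    Finset.mul_sum]
  congr 1
  refine Finset.sum_congr rfl fun i _ => Finset.sum_congr rfl fun j _ => ?_
  ring

theorem evalAt_RSnd (d : n → ℤ) (z : n → ℂ) :
    evalAt ℓ β z (RSnd ℓ β d) = universalR ℓ β z (toPt d) := by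
  simp only [RSnd, map_prod, evalAt_expDown, qpow, ← Complex.exp_sum, universalR, toPt,
    Finset.mul_sum]
  rw [Finset.sum_comm]
  congr 1
  refine Finset.sum_congr rfl fun i _ => Finset.sum_congr rfl fun j _ => ?_
  ring

end Cartan

/-! ### Braided groups in the category of `ℤⁿ`-graded spaces -/

section Braided

variable {n : Type u} [Fintype n] (ℓ : ℂ) (β : Matrix n n ℂ)
variable {B : Type v} [Ring B] [Algebra ℂ B] (𝓑 : (n → ℤ) → Submodule ℂ B) [GradedAlgebra 𝓑]

/-- The right action `b ◁ h` of `U_q(β)` on a `ℤⁿ`-graded space: `b ◁ ξ_i = |b|_i b`, and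
generally `b ◁ h = h(|b|) b`, for `b` homogeneous of degree `|b|`. -/
noncomputable def act : Uq ℓ β →ₗ[ℂ] B →ₗ[ℂ] B where
  toFun h := byDegree 𝓑 fun d => evalAt ℓ β (toPt d) h • LinearMap.id
  map_add' h k := by
    refine LinearMap.ext fun b => ?_
    induction b using DirectSum.Decomposition.inductionOn 𝓑 with
    | zero => simp
    | homogeneous b => simp [byDegree_of_mem 𝓑 _ b.2, add_smul]
    | add a b ha hb => rw [map_add, ha, hb, map_add]
  map_smul' c h := by
    refine LinearMap.ext fun b => ?_
    induction b using DirectSum.Decomposition.inductionOn 𝓑 with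
    | zero => simp
    | homogeneous b => simp [byDegree_of_mem 𝓑 _ b.2, mul_smul]
    | add a b ha hb => rw [map_add, ha, hb, map_add]

theorem act_of_mem (h : Uq ℓ β) {d : n → ℤ} {b : B} (hb : b ∈ 𝓑 d) :
    act ℓ β 𝓑 h b = evalAt ℓ β (toPt d) h • b := by
  simp [act, byDegree_of_mem 𝓑 _ hb]

/-- The braiding `Ψ (b ⊗ c) = c ◁ R⁽¹⁾ ⊗ b ◁ R⁽²⁾`. -/
noncomputable def braiding : B ⊗[ℂ] B →ₗ[ℂ] B ⊗[ℂ] B :=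
  TensorProduct.lift
    (byDegree 𝓑 fun d => (TensorProduct.mk ℂ B B).compl₂ (act ℓ β 𝓑 (RFst ℓ β d))).flip

/-- On homogeneous elements, `Ψ (b ⊗ c) = q ^ (∑ β_ij |c|_i |b|_j) c ⊗ b`. -/
theorem braiding_of_mem {d d' : n → ℤ} {b c : B} (hb : b ∈ 𝓑 d) (hc : c ∈ 𝓑 d') :
    braiding ℓ β 𝓑 (b ⊗ₜ c) = qpow ℓ (∑ i, ∑ j, β i j * d' i * d j) • (c ⊗ₜ[ℂ] b) := by
  simp [braiding, byDegree_of_mem 𝓑 _ hc, act_of_mem ℓ β 𝓑 _ hb, evalAt_RFst, universalR, toPt]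

/-- The product of the braided tensor product algebra: `(b ⊗ d)(c ⊗ e) = b Ψ(d ⊗ c) e`. -/
noncomputable def braidedMul : B ⊗[ℂ] B →ₗ[ℂ] B ⊗[ℂ] B →ₗ[ℂ] B ⊗[ℂ] B :=
  TensorProduct.curry <|
    TensorProduct.map (LinearMap.mul' ℂ B) (LinearMap.mul' ℂ B) ∘ₗ
    (TensorProduct.assoc ℂ B B (B ⊗[ℂ] B)).symm.toLinearMap ∘ₗ
    LinearMap.lTensor B ((TensorProduct.assoc ℂ B B B).toLinearMap ∘ₗ
      LinearMap.rTensor B (braiding ℓ β 𝓑) ∘ₗ (TensorProduct.assoc ℂ B B B).symm.toLinearMap) ∘ₗ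
    (TensorProduct.assoc ℂ B B (B ⊗[ℂ] B)).toLinearMap

theorem braidedMul_of_mem {d d' : n → ℤ} (a : B) {b c : B} (e : B) (hb : b ∈ 𝓑 d)
    (hc : c ∈ 𝓑 d') :
    braidedMul ℓ β 𝓑 (a ⊗ₜ b) (c ⊗ₜ e) =
      qpow ℓ (∑ i, ∑ j, β i j * d' i * d j) • ((a * c) ⊗ₜ[ℂ] (b * e)) := by
  simp [braidedMul, braiding_of_mem ℓ β 𝓑 hb hc, TensorProduct.smul_tmul']

/-- The component of degree `d` of `B ⊗ B`. -/
def tensorDegree (d : n → ℤ) : Submodule ℂ (B ⊗[ℂ] B) :=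
  Submodule.span ℂ {t | ∃ d₁ d₂, d₁ + d₂ = d ∧ ∃ x ∈ 𝓑 d₁, ∃ y ∈ 𝓑 d₂, t = x ⊗ₜ[ℂ] y}

/-- `(B, Δ, ε)` is a `ℂ`-statistical braided group: a Hopf algebra in the category of
`ℤⁿ`-graded spaces with the braiding defined by `β`. -/
structure IsBraidedGroup (Δ : B →ₗ[ℂ] B ⊗[ℂ] B) (ε : B →ₗ[ℂ] ℂ) : Prop where
  coassoc : (TensorProduct.assoc ℂ B B B).toLinearMap ∘ₗ Δ.rTensor B ∘ₗ Δ = Δ.lTensor B ∘ₗ Δ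
  counit_left : ∀ b, TensorProduct.lid ℂ B (ε.rTensor B (Δ b)) = b
  counit_right : ∀ b, TensorProduct.rid ℂ B (ε.lTensor B (Δ b)) = b
  comul_one : Δ 1 = 1 ⊗ₜ 1
  comul_mul : ∀ a b, Δ (a * b) = braidedMul ℓ β 𝓑 (Δ a) (Δ b)
  counit_one : ε 1 = 1
  counit_mul : ∀ a b, ε (a * b) = ε a * ε b
  comul_degree : ∀ d, ∀ b ∈ 𝓑 d, Δ b ∈ tensorDegree 𝓑 d
  counit_degree : ∀ d, ∀ b ∈ 𝓑 d, d ≠ 0 → ε b = 0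
  antipode : ∃ S : B →ₗ[ℂ] B, (∀ d, ∀ b ∈ 𝓑 d, S b ∈ 𝓑 d) ∧
    (∀ b, LinearMap.mul' ℂ B (S.rTensor B (Δ b)) = algebraMap ℂ B (ε b)) ∧
    (∀ b, LinearMap.mul' ℂ B (S.lTensor B (Δ b)) = algebraMap ℂ B (ε b))

variable {C : Type w} [Ring C] [Algebra ℂ C] (𝓒 : (n → ℤ) → Submodule ℂ C) [GradedAlgebra 𝓒]

/-- `ev : B⋆ ⊗ B → ℂ` exhibits the braided group `C = B⋆` as a dual of the braided group `B` in the
braided sense: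
`ev(c d, b) = ev(d, b₁) ev(c, b₂)`, `ev(c, a b) = ev(c₂, a) ev(c₁, b)`, and `ev` is covariant. -/
structure IsDualPairing (ΔC : C →ₗ[ℂ] C ⊗[ℂ] C) (εC : C →ₗ[ℂ] ℂ) (ΔB : B →ₗ[ℂ] B ⊗[ℂ] B)
    (εB : B →ₗ[ℂ] ℂ) (ev : C →ₗ[ℂ] B →ₗ[ℂ] ℂ) : Prop where
  one_left : ∀ b, ev 1 b = εB b
  one_right : ∀ c, ev c 1 = εC c
  mul_left : ∀ c d b, ev (c * d) b =
    LinearMap.mul' ℂ ℂ (TensorProduct.map (ev d) (ev c) (ΔB b))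
  mul_right : ∀ c a b, ev c (a * b) =
    LinearMap.mul' ℂ ℂ (TensorProduct.map (ev.flip b) (ev.flip a) (ΔC c))
  degree : ∀ d d', ∀ c ∈ 𝓒 d, ∀ b ∈ 𝓑 d', d + d' ≠ 0 → ev c b = 0

/-- `b ↦ b ◁ R⁽¹⁾ ⊗ R⁽²⁾`. -/
noncomputable def actRFst : B →ₗ[ℂ] B ⊗[ℂ] Uq ℓ β :=
  byDegree 𝓑 fun d => (TensorProduct.mk ℂ B (Uq ℓ β)).flip (RFst ℓ β d)

/-- `c ↦ R⁽¹⁾ ⊗ c ◁ R⁽²⁾`. -/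
noncomputable def actRSnd : C →ₗ[ℂ] Uq ℓ β ⊗[ℂ] C :=
  byDegree 𝓒 fun d => TensorProduct.mk ℂ (Uq ℓ β) C (RSnd ℓ β d)

/-- `(c, b) ↦ ev(c, b ◁ R⁽¹⁾) R⁽²⁾`. -/
noncomputable def evRFst (ev : C →ₗ[ℂ] B →ₗ[ℂ] ℂ) : C →ₗ[ℂ] B →ₗ[ℂ] Uq ℓ β :=
  (byDegree 𝓑 fun d => ev.flip.compr₂ (LinearMap.toSpanSingleton ℂ (Uq ℓ β) (RFst ℓ β d))).flip

/-- `(c, b) ↦ R⁽¹⁾ ev(c ◁ R⁽²⁾, b)`. -/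
noncomputable def evRSnd (ev : C →ₗ[ℂ] B →ₗ[ℂ] ℂ) : C →ₗ[ℂ] B →ₗ[ℂ] Uq ℓ β :=
  byDegree 𝓒 fun d => ev.compr₂ (LinearMap.toSpanSingleton ℂ (Uq ℓ β) (RSnd ℓ β d))

variable {ℓ β}
variable {D : Type*} [Ring D] [HopfAlgebra ℂ D]

/-- `(b₁ ⊗ b₂, c₁ ⊗ c₂) ↦ b₁ R⁽¹⁾ c₁ ev(c₂ ◁ R⁽²⁾, b₂)`, computed in an algebra `D` that receives
linear maps from `C`, `U_q(β)` and `B`. -/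
noncomputable def crossLeft (ev : C →ₗ[ℂ] B →ₗ[ℂ] ℂ) (iC : C →ₗ[ℂ] D) (iH : Uq ℓ β →ₗ[ℂ] D)
    (iB : B →ₗ[ℂ] D) : B ⊗[ℂ] B →ₗ[ℂ] C ⊗[ℂ] C →ₗ[ℂ] D :=
  TensorProduct.lift <| LinearMap.mk₂ ℂ
    (fun b₁ b₂ => TensorProduct.lift <| LinearMap.mk₂ ℂ
      (fun c₁ c₂ => iB b₁ * iH (evRSnd ℓ β 𝓒 ev c₂ b₂) * iC c₁)
      (by intros; simp [mul_add]) (by intros; simp)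
      (by intros; simp [mul_add, add_mul]) (by intros; simp))
    (by intros; ext; simp [add_mul]) (by intros; ext; simp)
    (by intros; ext; simp [mul_add, add_mul]) (by intros; ext; simp)

/-- `(b₁ ⊗ b₂, c₁ ⊗ c₂) ↦ ev(c₁, b₁ ◁ R⁽¹⁾) c₂ R⁽²⁾ b₂`, computed in an algebra `D` that receives
linear maps from `C`, `U_q(β)` and `B`. -/
noncomputable def crossRight (ev : C →ₗ[ℂ] B →ₗ[ℂ] ℂ) (iC : C →ₗ[ℂ] D) (iH : Uq ℓ β →ₗ[ℂ] D)
    (iB : B →ₗ[ℂ] D) : B ⊗[ℂ] B →ₗ[ℂ] C ⊗[ℂ] C →ₗ[ℂ] D :=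
  TensorProduct.lift <| LinearMap.mk₂ ℂ
    (fun b₁ b₂ => TensorProduct.lift <| LinearMap.mk₂ ℂ
      (fun c₁ c₂ => iC c₂ * iH (evRFst ℓ β 𝓑 ev c₁ b₁) * iB b₂)
      (by intros; simp [mul_add, add_mul]) (by intros; simp)
      (by intros; simp [add_mul]) (by intros; simp))
    (by intros; ext; simp [mul_add, add_mul]) (by intros; ext; simp)
    (by intros; ext; simp [mul_add]) (by intros; ext; simp)

variable (ℓ β)

/-- A Hopf algebra `D` together with the structure of a double-bosonisation of `B` and `C = B⋆`
over `U_q(β)`: it is `B⋆ ⊗ U_q(β) ⊗ B` as a vector space, contains `B⋆ᵒᵖ`, `U_q(β)` and `B` as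
subalgebras (the second one as a sub-Hopf algebra), and has the cross relations
`b h = h₁ (b ◁ h₂)`, `c h = h₂ (c ◁ h₁)`,
`b₁ R⁽¹⁾ c₁ ev(c₂ ◁ R⁽²⁾, b₂) = ev(c₁, b₁ ◁ R⁽¹⁾) c₂ R⁽²⁾ b₂` and the coproduct
`Δ b = b₁ ◁ R⁽¹⁾ ⊗ R⁽²⁾ b₂`, `Δ c = R⁽¹⁾ c₁ ⊗ c₂ ◁ R⁽²⁾`. -/
structure DoubleBosonisation (ΔC : C →ₗ[ℂ] C ⊗[ℂ] C) (ΔB : B →ₗ[ℂ] B ⊗[ℂ] B)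
    (ev : C →ₗ[ℂ] B →ₗ[ℂ] ℂ) (D : Type*) [Ring D] [HopfAlgebra ℂ D] where
  /-- The inclusion of `B⋆ᵒᵖ`. -/
  inclOp : Cᵐᵒᵖ →ₐ[ℂ] D
  /-- The inclusion of `U_q(β)`. -/
  inclH : Uq ℓ β →ₐc[ℂ] D
  /-- The inclusion of `B`. -/
  inclB : B →ₐ[ℂ] D
  /-- The inclusion of `B⋆` as a vector space. -/
  inclC : C →ₗ[ℂ] D
  inclC_eq : ∀ c, inclC c = inclOp (MulOpposite.op c)
  triangular : Function.Bijective
    (TensorProduct.lift (((LinearMap.mul ℂ D).compl₁₂ inclC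
      (LinearMap.mul' ℂ D ∘ₗ TensorProduct.map (inclH : Uq ℓ β →ₗ[ℂ] D) inclB.toLinearMap))))
  cross_BH : ∀ b h, inclB b * inclH h = LinearMap.mul' ℂ D
    (TensorProduct.map (inclH : Uq ℓ β →ₗ[ℂ] D) (inclB.toLinearMap ∘ₗ (act ℓ β 𝓑).flip b)
      (Coalgebra.comul h))
  cross_CH : ∀ c h, inclC c * inclH h = LinearMap.mul' ℂ D
    (TensorProduct.map (inclH : Uq ℓ β →ₗ[ℂ] D) (inclC ∘ₗ (act ℓ β 𝓒).flip c)
      (TensorProduct.comm ℂ _ _ (Coalgebra.comul h)))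
  cross_BC : ∀ b c,
    crossLeft 𝓒 ev inclC (inclH : Uq ℓ β →ₗ[ℂ] D) inclB.toLinearMap (ΔB b) (ΔC c) =
      crossRight 𝓑 ev inclC (inclH : Uq ℓ β →ₗ[ℂ] D) inclB.toLinearMap (ΔB b) (ΔC c)
  comul_B : ∀ b, Coalgebra.comul (R := ℂ) (inclB b) =
    TensorProduct.map inclB.toLinearMap
      (LinearMap.mul' ℂ D ∘ₗ TensorProduct.map (inclH : Uq ℓ β →ₗ[ℂ] D) inclB.toLinearMap)
      (TensorProduct.assoc ℂ _ _ _ ((actRFst ℓ β 𝓑).rTensor B (ΔB b)))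
  comul_C : ∀ c, Coalgebra.comul (R := ℂ) (inclC c) =
    TensorProduct.map
      (LinearMap.mul' ℂ D ∘ₗ TensorProduct.map (inclH : Uq ℓ β →ₗ[ℂ] D) inclC) inclC
      ((TensorProduct.assoc ℂ _ _ _).symm
        (TensorProduct.leftComm ℂ _ _ _ ((actRSnd ℓ β 𝓒).lTensor C (ΔC c))))

end Braided

/-! ### The free braided groups -/

section Free

variable {n : Type u}

/-- The grading of the free algebra in which the `i`-th generator has degree `deg i`: the component
of degree `d` is spanned by the words of degree `d`. -/
noncomputable def freeGrading (deg : n → n → ℤ) (d : n → ℤ) : Submodule ℂ (FreeAlgebra ℂ n) :=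
  Submodule.span ℂ {a | ∃ l : List n, (l.map deg).sum = d ∧ (l.map (FreeAlgebra.ι ℂ)).prod = a}

theorem word_mem_freeGrading (deg : n → n → ℤ) (l : List n) :
    (l.map (FreeAlgebra.ι ℂ)).prod ∈ freeGrading deg (l.map deg).sum :=
  Submodule.subset_span ⟨l, rfl, rfl⟩

theorem ι_mem_freeGrading (deg : n → n → ℤ) (i : n) :
    FreeAlgebra.ι ℂ i ∈ freeGrading deg (deg i) := by
  simpa using word_mem_freeGrading deg [i]

instance (deg : n → n → ℤ) : SetLike.GradedMonoid (freeGrading deg) where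
  one_mem := by simpa using word_mem_freeGrading deg []
  mul_mem := by
    intro d d' a b ha hb
    have h : freeGrading deg d * freeGrading deg d' ≤ freeGrading deg (d + d') := by
      rw [freeGrading, freeGrading, Submodule.span_mul_span, Submodule.span_le]
      rintro _ ⟨_, ⟨l, hl, rfl⟩, _, ⟨l', hl', rfl⟩, rfl⟩
      exact Submodule.subset_span ⟨l ++ l', by simp [hl, hl'], by simp⟩
    exact h (Submodule.mul_mem_mul ha hb)

variable [Fintype n]

/-- The free algebra as a direct sum of its components. -/
noncomputable def freeDecompose (deg : n → n → ℤ) :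
    FreeAlgebra ℂ n →ₐ[ℂ] ⨁ d, freeGrading deg d :=
  FreeAlgebra.lift ℂ fun i =>
    DirectSum.of (fun d => freeGrading deg d) (deg i) ⟨_, ι_mem_freeGrading deg i⟩

theorem freeDecompose_word (deg : n → n → ℤ) (l : List n) :
    freeDecompose deg (l.map (FreeAlgebra.ι ℂ)).prod =
      DirectSum.of (fun d => freeGrading deg d) (l.map deg).sum ⟨_, word_mem_freeGrading deg l⟩ := by
  induction l with
  | nil => simp; rfl
  | cons i l ih =>
    simp only [List.map_cons, List.prod_cons, map_mul, ih]
    simp only [freeDecompose, FreeAlgebra.lift_ι_apply, DirectSum.of_mul_of]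
    exact DirectSum.of_eq_of_gradedMonoid_eq (Sigma.subtype_ext (add_comm _ _ |>.trans (add_comm _ _)) rfl)

noncomputable instance (deg : n → n → ℤ) : GradedAlgebra (freeGrading deg) :=
  GradedAlgebra.ofAlgHom _ (freeDecompose deg)
    (by ext i; simp [freeDecompose])
    (by
      rintro d ⟨x, hx⟩
      induction hx using Submodule.span_induction with
      | mem x h =>
        obtain ⟨l, rfl, rfl⟩ := h
        exact freeDecompose_word deg l
      | zero =>
        exact (map_zero (freeDecompose deg)).trans
          (map_zero (DirectSum.of (fun d => freeGrading deg d) d)).symm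
      | add x y hx hy h1 h2 =>
        simp only [map_add] at *
        rw [h1, h2, ← map_add]; rfl
      | smul c x hx h =>
        simp only [map_smul] at *
        rw [h, ← DirectSum.lof_eq_of ℂ, ← map_smul]; rfl)

variable (ℓ : ℂ) (β : Matrix n n ℂ) (deg : n → n → ℤ)

/-- The braided coproduct of the free algebra: it is multiplicative with values in the braided tensor
product algebra and each generator `x` is primitive, `Δ x = x ⊗ 1 + 1 ⊗ x`.  Thus
`Δ (x y ⋯) = (Δ x) (Δ y) ⋯ (1 ⊗ 1)`. -/
noncomputable def freeComul :
    FreeAlgebra ℂ n →ₗ[ℂ] FreeAlgebra ℂ n ⊗[ℂ] FreeAlgebra ℂ n :=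
  LinearMap.applyₗ (1 ⊗ₜ 1) ∘ₗ (FreeAlgebra.lift ℂ fun i =>
    (braidedMul ℓ β (freeGrading deg) (FreeAlgebra.ι ℂ i ⊗ₜ 1 + 1 ⊗ₜ FreeAlgebra.ι ℂ i) :
      Module.End ℂ (FreeAlgebra ℂ n ⊗[ℂ] FreeAlgebra ℂ n))).toLinearMap

/-- The counit of the free algebra, which kills the generators. -/
noncomputable def freeCounit : FreeAlgebra ℂ n →ₗ[ℂ] ℂ :=
  (FreeAlgebra.lift ℂ fun _ : n => (0 : ℂ)).toLinearMap

variable [DecidableEq n]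

/-- The coefficient of the generator `x_i` in an element of the free algebra. -/
noncomputable def freeCoeff (i : n) : FreeAlgebra ℂ n →ₗ[ℂ] ℂ :=
  TrivSqZeroExt.sndHom ℂ ℂ ∘ₗ (FreeAlgebra.lift ℂ fun j : n =>
    (if j = i then DualNumber.eps else 0 : DualNumber ℂ)).toLinearMap

/-- The degrees `|e^i|_j = δ_ij`. -/
def degE (i : n) : n → ℤ := Pi.single i 1

/-- The degrees `|f_i|_j = - δ_ij`. -/
def degF (i : n) : n → ℤ := -Pi.single i 1

/-- The braided differentiation `b ↦ ev(f_i, b₁) b₂` on `ℂ⟨e⟩`, where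
`ev(f_i, e^j) = δ_ij / (q_i - q_i⁻¹)` and `ev(f_i, ·)` vanishes on words of length other than one.
The numbers `q_i` are the values of `r`. -/
noncomputable def freeDiff (r : n → ℂ) (i : n) : Module.End ℂ (FreeAlgebra ℂ n) :=
  (TensorProduct.lid ℂ (FreeAlgebra ℂ n)).toLinearMap ∘ₗ
    ((r i - (r i)⁻¹)⁻¹ • freeCoeff i).rTensor (FreeAlgebra ℂ n) ∘ₗ freeComul ℓ β degE

/-- The pairing `ev : ℂ⟨f⟩ ⊗ ℂ⟨e⟩ → ℂ` extending `ev(f_i, e^j) = δ_ij / (q_i - q_i⁻¹)` by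
`ev(c d, b) = ev(d, b₁) ev(c, b₂)`; explicitly `ev(f_i ⋯ f_k, b) = ε(∂_i ⋯ ∂_k b)`. -/
noncomputable def freeEv (r : n → ℂ) : FreeAlgebra ℂ n →ₗ[ℂ] FreeAlgebra ℂ n →ₗ[ℂ] ℂ :=
  LinearMap.llcomp ℂ _ _ _ freeCounit ∘ₗ (FreeAlgebra.lift ℂ (freeDiff ℓ β r)).toLinearMap

end Free

/-! ### The relations -/

section Relations

variable {n : Type u} [Fintype n] [DecidableEq n] (ℓ : ℂ) (β : Matrix n n ℂ)

/-- The subalgebra of `U_q(β)` generated by the exponentials `q ^ (± H^i)` and `q ^ (± H_i)`. -/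
noncomputable def UqExp : Subalgebra ℂ (Uq ℓ β) :=
  Algebra.adjoin ℂ ({h | ∃ i t, h = expUp ℓ β i t} ∪ {h | ∃ i t, h = expDown ℓ β i t})

/-- The element `q ^ (t H^i)` of `UqExp`. -/
noncomputable def UqExp.up (i : n) (t : ℤ) : UqExp ℓ β :=
  ⟨expUp ℓ β i t, Algebra.subset_adjoin (Or.inl ⟨i, t, rfl⟩)⟩

/-- The element `q ^ (t H_i)` of `UqExp`. -/
noncomputable def UqExp.down (i : n) (t : ℤ) : UqExp ℓ β :=
  ⟨expDown ℓ β i t, Algebra.subset_adjoin (Or.inr ⟨i, t, rfl⟩)⟩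

variable {A : Type*} [Ring A] [Algebra ℂ A]

/-- The cross relations between elements `e i`, `f i` of an algebra and the exponentials
`up i t = q ^ (t H^i)` and `down i t = q ^ (t H_i)`; the numbers `q_i` are the values of `r`. -/
structure ExpRelations (r : n → ℂ) (up down : n → ℤ → A) (e f : n → A) : Prop where
  /-- `e^i q^{H^j} = q^{H^j} e^i q^{β_ji}` -/
  e_up : ∀ i j, e i * up j 1 = qpow ℓ (β j i) • (up j 1 * e i)
  /-- `f_i q^{H_j} = q^{H_j} f_i q^{-β_ij}` -/
  f_down : ∀ i j, f i * down j 1 = qpow ℓ (-β i j) • (down j 1 * f i)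
  /-- `e^i q^{H_j} = q^{H_j} e^i q^{β_ij}` -/
  e_down : ∀ i j, e i * down j 1 = qpow ℓ (β i j) • (down j 1 * e i)
  /-- `f_i q^{H^j} = q^{H^j} f_i q^{-β_ji}` -/
  f_up : ∀ i j, f i * up j 1 = qpow ℓ (-β j i) • (up j 1 * f i)
  /-- `[e^i, f_j] = δ_ij (q^{H^i} - q^{-H_i}) / (q_i - q_i⁻¹)` -/
  e_f : ∀ i j, e i * f j - f j * e i =
    if i = j then (r i - (r i)⁻¹)⁻¹ • (up i 1 - down i (-1)) else 0

/-- The cross relations, including those with the commuting variables `x j = ξ_j`. -/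
structure CrossRelations (r : n → ℂ) (x : n → A) (up down : n → ℤ → A) (e f : n → A) : Prop
    extends ExpRelations ℓ β r up down e f where
  /-- `[e^i, ξ_j] = δ_ij e^i` -/
  e_xi : ∀ i j, e i * x j - x j * e i = if i = j then e i else 0
  /-- `[f_i, ξ_j] = - δ_ij f_i` -/
  f_xi : ∀ i j, f i * x j - x j * f i = if i = j then -f i else 0

end Relations

end CStat

namespace CStat

/-! ### Induction on the free algebra -/

section FreeInduction

variable {n : Type*}

/-! On a homogeneous element of degree `d` the quantum group acts by evaluation at `d`. Hence the
cross relation with `h` says that moving `h` past such an element translates the variables of `h` by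
`d`. So `U_q(β)` enters only as a commutative algebra `K` with commuting automorphisms `σ_i`, the
translations by the degree of `e_i`, and with elements `κ_i`, the commutators of `e_i` and `f_i`.
These data are collected in `TriangularRelations`.

The algebra `Presented σ κ` defined by these relations is `ℂ⟨f⟩ ⊗ K ⊗ ℂ⟨e⟩` as a vector space
(`Presented.triangularMap_bijective`): it acts on the space of triangular words, and the action is
consistent because the `σ_i` commute with each other and `K` is commutative. Every
double-bosonisation satisfies the relations (`DoubleBosonisation.relations`) and has a triangular
decomposition by definition, so it is isomorphic to the presented algebra. Freeness, the embedding
of `U_q(β)` and the universal property follow. For the subalgebra without `ξ` the same argument is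
run with `K = UqExp`, which is stable under translation; injectivity survives because vector spaces
are flat.

For existence, the presented algebra receives its Hopf structure from its universal property. The
axioms, which concern all elements, are then derived from the generators by induction on words. The
substantial one is the relation between `ℂ⟨e⟩` and `ℂ⟨f⟩`: `e_mul_inclC` treats one `e_i` against an
arbitrary element of `ℂ⟨f⟩`, and `cross_BC` extends it to all of `ℂ⟨e⟩` by coassociativity.

On the braided side the braiding of homogeneous elements is a scalar, the value of a bicharacter.
Multiplication by a primitive generator in the braided tensor square is therefore the explicit
operator `comulStep`, and each braided group axiom is an induction with this operator. The pairing
is the counit applied after braided differentiation: coassociativity gives its compatibility with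
products on the left (`freeEv_mul_left`), and the braided Leibniz rule gives the one on the right
(`freeEv_mul_right`). -/

theorem free_left_induction {P : FreeAlgebra ℂ n → Prop} (one : P 1)
    (add : ∀ x y, P x → P y → P (x + y)) (smul : ∀ (c : ℂ) x, P x → P (c • x))
    (ι_mul : ∀ i x, P x → P (FreeAlgebra.ι ℂ i * x)) (x : FreeAlgebra ℂ n) : P x := by
  -- The property that left multiplication by `x` preserves `P` passes through sums and products of
  -- `x`, whereas `P` itself need not be multiplicative.
  suffices h : ∀ y, P y → P (x * y) by simpa using h 1 one
  induction x with
  | grade0 c => intro y hy; rw [← Algebra.smul_def]; exact smul c y hy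
  | grade1 i => intro y hy; exact ι_mul i y hy
  | mul a b ha hb => intro y hy; rw [mul_assoc]; exact ha _ (hb _ hy)
  | add a b ha hb => intro y hy; rw [add_mul]; exact add _ _ (ha _ hy) (hb _ hy)

/-- Appending letters on the right suits `freeEv`, where the last letter of a word differentiates
first, and `antiLift`, which turns that letter into the leftmost factor. -/
theorem free_right_induction {P : FreeAlgebra ℂ n → Prop} (one : P 1)
    (add : ∀ x y, P x → P y → P (x + y)) (smul : ∀ (c : ℂ) x, P x → P (c • x))
    (mul_ι : ∀ i x, P x → P (x * FreeAlgebra.ι ℂ i)) (x : FreeAlgebra ℂ n) : P x := by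
  suffices h : ∀ y, P y → P (y * x) by simpa using h 1 one
  induction x with
  | grade0 c => intro y hy; rw [← Algebra.commutes, ← Algebra.smul_def]; exact smul c y hy
  | grade1 i => intro y hy; exact mul_ι i y hy
  | mul a b ha hb => intro y hy; rw [← mul_assoc]; exact hb _ (ha _ hy)
  | add a b ha hb => intro y hy; rw [mul_add]; exact add _ _ (ha _ hy) (hb _ hy)

theorem free_linearMap_ext_left {V : Type*} [AddCommMonoid V] [Module ℂ V]
    {f g : FreeAlgebra ℂ n →ₗ[ℂ] V} (one : f 1 = g 1)
    (ι_mul : ∀ i x, f x = g x → f (FreeAlgebra.ι ℂ i * x) = g (FreeAlgebra.ι ℂ i * x)) :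
    f = g := by
  refine LinearMap.ext fun x => ?_
  induction x using free_left_induction with
  | one => exact one
  | add x y hx hy => rw [map_add, map_add, hx, hy]
  | smul c x hx => rw [map_smul, map_smul, hx]
  | ι_mul i x hx => exact ι_mul i x hx

end FreeInduction

/-! ### Reduction to homogeneous elements -/

section Homogeneous

variable {n : Type*} {V W X : Type*} [AddCommGroup V] [Module ℂ V] [AddCommGroup W] [Module ℂ W]
  [AddCommMonoid X] [Module ℂ X]

theorem linearMap_ext_homogeneous [DecidableEq (n → ℤ)] (𝓥 : (n → ℤ) → Submodule ℂ V)
    [DirectSum.Decomposition 𝓥] {f g : V →ₗ[ℂ] X} (h : ∀ d, ∀ x ∈ 𝓥 d, f x = g x) : f = g := by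
  refine LinearMap.ext fun x => ?_
  induction x using DirectSum.Decomposition.inductionOn 𝓥 with
  | zero => simp
  | homogeneous b => exact h _ _ b.2
  | add a b ha hb => rw [map_add, ha, hb, map_add]

/-- On homogeneous tensors the braiding and the scaling automorphisms act through scalars, and each
leg of `R` is determined by a degree. Identities involving them thus reduce to identities between
values of the bicharacter. -/
theorem tensor_ext_homogeneous [DecidableEq (n → ℤ)] (𝓥 : (n → ℤ) → Submodule ℂ V)
    [DirectSum.Decomposition 𝓥] (𝓦 : (n → ℤ) → Submodule ℂ W) [DirectSum.Decomposition 𝓦]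
    {f g : V ⊗[ℂ] W →ₗ[ℂ] X}
    (h : ∀ d d', ∀ x ∈ 𝓥 d, ∀ y ∈ 𝓦 d', f (x ⊗ₜ y) = g (x ⊗ₜ y)) : f = g := by
  apply TensorProduct.ext
  refine linearMap_ext_homogeneous 𝓥 fun d x hx => linearMap_ext_homogeneous 𝓦 fun d' y hy => ?_
  exact h d d' x hx y hy

end Homogeneous

/-! ### The bicharacter -/

section Bicharacter

variable {n : Type*} [Fintype n] (ℓ : ℂ) (β : Matrix n n ℂ)

theorem qpow_zero : qpow ℓ 0 = 1 := by simp [qpow]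

theorem qpow_add (x y : ℂ) : qpow ℓ (x + y) = qpow ℓ x * qpow ℓ y := by
  simp [qpow, mul_add, Complex.exp_add]

theorem qpow_neg (x : ℂ) : qpow ℓ (-x) = (qpow ℓ x)⁻¹ := by
  simp [qpow, Complex.exp_neg]

theorem qpow_ne_zero (x : ℂ) : qpow ℓ x ≠ 0 := Complex.exp_ne_zero _

/-- The character `d ↦ q ^ (∑ β_ij d_i d'_j)`. -/
noncomputable def charL (d' : n → ℤ) : AddChar (n → ℤ) ℂ where
  toFun d := qpow ℓ (∑ i, ∑ j, β i j * d i * d' j)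
  map_zero_eq_one' := by simp [qpow]
  map_add_eq_mul' a b := by
    rw [← qpow_add, ← Finset.sum_add_distrib]
    simp only [← Finset.sum_add_distrib, Pi.add_apply, Int.cast_add, mul_add, add_mul]

/-- The character `d' ↦ q ^ (∑ β_ij d_i d'_j)`. -/
noncomputable def charR (d : n → ℤ) : AddChar (n → ℤ) ℂ where
  toFun d' := charL ℓ β d' d
  map_zero_eq_one' := by simp [qpow, charL]
  map_add_eq_mul' a b := by
    simp only [charL, AddChar.coe_mk]
    rw [← qpow_add, ← Finset.sum_add_distrib]
    simp only [← Finset.sum_add_distrib, Pi.add_apply, Int.cast_add, mul_add, add_mul]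

theorem charL_apply (d d' : n → ℤ) :
    charL ℓ β d' d = qpow ℓ (∑ i, ∑ j, β i j * d i * d' j) := rfl

theorem charR_apply (d d' : n → ℤ) : charR ℓ β d d' = charL ℓ β d' d := rfl

theorem charL_add_left (a b d : n → ℤ) :
    charL ℓ β (a + b) d = charL ℓ β a d * charL ℓ β b d := (charR ℓ β d).map_add_eq_mul a b

variable [DecidableEq n]

theorem charL_degE_degE (i j : n) : charL ℓ β (degE i) (degE j) = qpow ℓ (β j i) := by
  rw [charL_apply]
  congr 1
  rw [Finset.sum_eq_single j, Finset.sum_eq_single i] <;> simp +contextual [degE]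

end Bicharacter

/-! ### Automorphisms of the free algebra given by characters of the degree lattice -/

section FreeScale

variable {n : Type*} (deg : n → n → ℤ)

theorem ι_mul_mem_freeGrading (i : n) {d : n → ℤ} {x : FreeAlgebra ℂ n}
    (hx : x ∈ freeGrading deg d) : FreeAlgebra.ι ℂ i * x ∈ freeGrading deg (deg i + d) :=
  SetLike.mul_mem_graded (ι_mem_freeGrading deg i) hx

/-- Words arise from `1` by prefixing letters, each of which shifts the degree. The degree therefore
has to vary together with the element during the induction. -/
theorem mem_freeGrading_induction {P : ∀ d x, x ∈ freeGrading deg d → Prop}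
    (one : P 0 1 SetLike.GradedOne.one_mem) (zero : ∀ d, P d 0 (Submodule.zero_mem _))
    (add : ∀ d x y hx hy, P d x hx → P d y hy → P d (x + y) (Submodule.add_mem _ hx hy))
    (smul : ∀ d (c : ℂ) x hx, P d x hx → P d (c • x) (Submodule.smul_mem _ c hx))
    (ι_mul : ∀ d i x hx, P d x hx →
      P (deg i + d) (FreeAlgebra.ι ℂ i * x) (ι_mul_mem_freeGrading deg i hx))
    {d : n → ℤ} {x : FreeAlgebra ℂ n} (hx : x ∈ freeGrading deg d) : P d x hx := by
  induction hx using Submodule.span_induction with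
  | mem x hx =>
    obtain ⟨l, rfl, rfl⟩ := hx
    suffices h : P _ _ (word_mem_freeGrading deg l) from h
    induction l with
    | nil => exact one
    | cons i l ih => simpa only [List.map_cons, List.prod_cons, List.sum_cons] using ι_mul _ i _ _ ih
  | zero => exact zero d
  | add x y hx hy h1 h2 => exact add d x y _ _ h1 h2
  | smul c x hx h => exact smul d c x _ h

/-- The automorphism of the free algebra which is the scalar `X d` in degree `d`. -/
noncomputable def freeScale (X : AddChar (n → ℤ) ℂ) : FreeAlgebra ℂ n →ₐ[ℂ] FreeAlgebra ℂ n :=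
  FreeAlgebra.lift ℂ fun i => X (deg i) • FreeAlgebra.ι ℂ i

theorem freeScale_of_mem (X : AddChar (n → ℤ) ℂ) {d : n → ℤ} {x : FreeAlgebra ℂ n}
    (hx : x ∈ freeGrading deg d) : freeScale deg X x = X d • x := by
  induction hx using mem_freeGrading_induction with
  | one => simp
  | zero d => simp
  | add d x y _ _ hx hy => simp [hx, hy]
  | smul d c x _ hx => rw [map_smul, hx, smul_comm]
  | ι_mul d i x _ hx =>
    rw [map_mul, hx, AddChar.map_add_eq_mul, freeScale, FreeAlgebra.lift_ι_apply,
      smul_mul_smul_comm]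

theorem freeScale_mem (X : AddChar (n → ℤ) ℂ) {d : n → ℤ} {x : FreeAlgebra ℂ n}
    (hx : x ∈ freeGrading deg d) : freeScale deg X x ∈ freeGrading deg d := by
  rw [freeScale_of_mem deg X hx]
  exact Submodule.smul_mem _ _ hx

@[simp] theorem freeScale_ι (X : AddChar (n → ℤ) ℂ) (i : n) :
    freeScale deg X (FreeAlgebra.ι ℂ i) = X (deg i) • FreeAlgebra.ι ℂ i := by
  simp [freeScale]

end FreeScale

/-! ### The free algebra as a braided group -/

section FreeCoproduct

variable {n : Type u} [Fintype n] (ℓ : ℂ) (β : Matrix n n ℂ) (deg : n → n → ℤ)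

open FreeAlgebra TensorProduct

theorem freeComul_one : freeComul ℓ β deg 1 = 1 ⊗ₜ 1 := by
  simp [freeComul]

theorem freeComul_ι_mul' (i : n) (b : FreeAlgebra ℂ n) : freeComul ℓ β deg (ι ℂ i * b) =
    braidedMul ℓ β (freeGrading deg) (ι ℂ i ⊗ₜ 1 + 1 ⊗ₜ ι ℂ i) (freeComul ℓ β deg b) := by
  simp [freeComul]

/-- The scaling automorphism `a ↦ q ^ (∑ β_kl |a|_k |x_i|_l) a`. -/
noncomputable def scaleL (i : n) : FreeAlgebra ℂ n →ₐ[ℂ] FreeAlgebra ℂ n :=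
  freeScale deg (charL ℓ β (deg i))

theorem scaleL_of_mem (i : n) {d : n → ℤ} {x : FreeAlgebra ℂ n}
    (hx : x ∈ freeGrading deg d) : scaleL ℓ β deg i x = charL ℓ β (deg i) d • x :=
  freeScale_of_mem deg _ hx

/-- Braided left multiplication by `x_i ⊗ 1 + 1 ⊗ x_i`. -/
noncomputable def comulStep (i : n) :
    FreeAlgebra ℂ n ⊗[ℂ] FreeAlgebra ℂ n →ₗ[ℂ] FreeAlgebra ℂ n ⊗[ℂ] FreeAlgebra ℂ n :=
  map (LinearMap.mulLeft ℂ (ι ℂ i)) .id +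
    map (scaleL ℓ β deg i).toLinearMap (LinearMap.mulLeft ℂ (ι ℂ i))

@[simp] theorem comulStep_tmul (i : n) (a b : FreeAlgebra ℂ n) :
    comulStep ℓ β deg i (a ⊗ₜ b) =
      (ι ℂ i * a) ⊗ₜ b + scaleL ℓ β deg i a ⊗ₜ (ι ℂ i * b) := by
  simp [comulStep]

theorem braidedMul_eq_charL {d d' : n → ℤ} (a : FreeAlgebra ℂ n) {b c : FreeAlgebra ℂ n}
    (e : FreeAlgebra ℂ n) (hb : b ∈ freeGrading deg d) (hc : c ∈ freeGrading deg d') :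
    braidedMul ℓ β (freeGrading deg) (a ⊗ₜ b) (c ⊗ₜ e) =
      charL ℓ β d d' • ((a * c) ⊗ₜ[ℂ] (b * e)) := braidedMul_of_mem ℓ β _ a e hb hc

theorem charL_zero (d : n → ℤ) : charL ℓ β 0 d = 1 := (charR ℓ β d).map_zero_eq_one

/-- Moving `x_i` past the first leg costs only the scalar recorded by `scaleL`, so braided
multiplication by a primitive generator is an explicit operator. The later inductions on the
coproduct of a word rest on this recursion. -/
theorem braidedMul_generator (i : n) :
    braidedMul ℓ β (freeGrading deg) (ι ℂ i ⊗ₜ 1 + 1 ⊗ₜ ι ℂ i) = comulStep ℓ β deg i := by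
  classical
  refine tensor_ext_homogeneous (freeGrading deg) (freeGrading deg) fun d d' x hx y hy => ?_
  have h0 : (1 : FreeAlgebra ℂ n) ∈ freeGrading deg 0 := SetLike.GradedOne.one_mem
  rw [map_add, LinearMap.add_apply, braidedMul_eq_charL ℓ β _ _ _ h0 hx,
    braidedMul_eq_charL ℓ β _ _ _ (ι_mem_freeGrading deg i) hx, comulStep_tmul,
    scaleL_of_mem ℓ β deg i hx, ← TensorProduct.smul_tmul', charL_zero]
  simp

theorem freeComul_ι_mul (i : n) (b : FreeAlgebra ℂ n) :
    freeComul ℓ β deg (ι ℂ i * b) = comulStep ℓ β deg i (freeComul ℓ β deg b) := by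
  rw [freeComul_ι_mul', braidedMul_generator]

theorem freeComul_ι (i : n) :
    freeComul ℓ β deg (ι ℂ i) = ι ℂ i ⊗ₜ 1 + 1 ⊗ₜ ι ℂ i := by
  have := freeComul_ι_mul ℓ β deg i 1
  simpa [freeComul_one] using this

@[simp] theorem freeCounit_one : freeCounit (1 : FreeAlgebra ℂ n) = 1 := by simp [freeCounit]

@[simp] theorem freeCounit_mul (a b : FreeAlgebra ℂ n) :
    freeCounit (a * b) = freeCounit a * freeCounit b := by simp [freeCounit]

@[simp] theorem freeCounit_ι (i : n) : freeCounit (ι ℂ i) = 0 := by simp [freeCounit]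

/-- Additivity of the bicharacter in both degrees makes the scalars agree. Associativity with a
primitive generator as first factor is all that multiplicativity of the coproduct requires. -/
theorem braidedMul_assoc_generator (i : n) (s t : FreeAlgebra ℂ n ⊗[ℂ] FreeAlgebra ℂ n) :
    braidedMul ℓ β (freeGrading deg) (comulStep ℓ β deg i s) t =
      comulStep ℓ β deg i (braidedMul ℓ β (freeGrading deg) s t) := by
  classical
  suffices h : braidedMul ℓ β (freeGrading deg) ∘ₗ comulStep ℓ β deg i =
      (braidedMul ℓ β (freeGrading deg)).compr₂ (comulStep ℓ β deg i) from
    congr($h s t)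
  refine tensor_ext_homogeneous (freeGrading deg) (freeGrading deg) fun d₁ d₂ a ha b hb =>
    tensor_ext_homogeneous (freeGrading deg) (freeGrading deg) fun d₃ d₄ c hc e he => ?_
  have hb' := ι_mul_mem_freeGrading deg i hb
  have hac : a * c ∈ freeGrading deg (d₁ + d₃) := SetLike.mul_mem_graded ha hc
  simp only [LinearMap.comp_apply, LinearMap.compr₂_apply, comulStep_tmul, map_add,
    LinearMap.add_apply, scaleL_of_mem ℓ β deg i ha, braidedMul_eq_charL ℓ β _ _ _ hb hc, map_smul,
    braidedMul_eq_charL ℓ β _ _ _ hb' hc, scaleL_of_mem ℓ β deg i hac, charL_add_left,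
    ← TensorProduct.smul_tmul', LinearMap.smul_apply, mul_assoc, AddChar.map_add_eq_mul,
    smul_add, smul_smul]
  congr 2
  ring

theorem braidedMul_one_left (t : FreeAlgebra ℂ n ⊗[ℂ] FreeAlgebra ℂ n) :
    braidedMul ℓ β (freeGrading deg) (1 ⊗ₜ 1) t = t := by
  classical
  suffices h : braidedMul ℓ β (freeGrading deg) (1 ⊗ₜ 1) = LinearMap.id from congr($h t)
  refine tensor_ext_homogeneous (freeGrading deg) (freeGrading deg) fun d d' x hx y hy => ?_
  rw [braidedMul_eq_charL ℓ β _ _ _ (SetLike.GradedOne.one_mem : 1 ∈ freeGrading deg 0) hx,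
    charL_zero]
  simp

theorem freeComul_mul (a b : FreeAlgebra ℂ n) : freeComul ℓ β deg (a * b) =
    braidedMul ℓ β (freeGrading deg) (freeComul ℓ β deg a) (freeComul ℓ β deg b) := by
  induction a using free_left_induction with
  | one => rw [one_mul, freeComul_one, braidedMul_one_left]
  | add x y hx hy => simp only [add_mul, map_add, hx, hy, LinearMap.add_apply]
  | smul c x hx => simp only [smul_mul_assoc, map_smul, hx, LinearMap.smul_apply]
  | ι_mul i x hx =>
    rw [mul_assoc, freeComul_ι_mul, hx, freeComul_ι_mul, braidedMul_assoc_generator]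

theorem tmul_mem_tensorDegree {d d' : n → ℤ} {x y : FreeAlgebra ℂ n}
    (hx : x ∈ freeGrading deg d) (hy : y ∈ freeGrading deg d') :
    x ⊗ₜ y ∈ tensorDegree (freeGrading deg) (d + d') :=
  Submodule.subset_span ⟨d, d', rfl, x, hx, y, hy, rfl⟩

theorem comulStep_mem (i : n) {d : n → ℤ} {t : FreeAlgebra ℂ n ⊗[ℂ] FreeAlgebra ℂ n}
    (ht : t ∈ tensorDegree (freeGrading deg) d) :
    comulStep ℓ β deg i t ∈ tensorDegree (freeGrading deg) (deg i + d) := by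
  induction ht using Submodule.span_induction with
  | mem t ht =>
    obtain ⟨d₁, d₂, rfl, x, hx, y, hy, rfl⟩ := ht
    rw [comulStep_tmul]
    refine Submodule.add_mem _ ?_ ?_
    · rw [← add_assoc]
      exact tmul_mem_tensorDegree deg (ι_mul_mem_freeGrading deg i hx) hy
    · rw [add_left_comm]
      exact tmul_mem_tensorDegree deg (freeScale_mem deg _ hx) (ι_mul_mem_freeGrading deg i hy)
  | zero => simp
  | add x y hx hy h1 h2 => rw [map_add]; exact Submodule.add_mem _ h1 h2
  | smul c x hx h => rw [map_smul]; exact Submodule.smul_mem _ _ h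

theorem freeComul_mem {d : n → ℤ} {b : FreeAlgebra ℂ n} (hb : b ∈ freeGrading deg d) :
    freeComul ℓ β deg b ∈ tensorDegree (freeGrading deg) d := by
  induction hb using mem_freeGrading_induction with
  | one =>
    rw [freeComul_one]
    simpa using tmul_mem_tensorDegree deg (d := 0) (d' := 0) (x := 1) (y := 1)
      SetLike.GradedOne.one_mem SetLike.GradedOne.one_mem
  | zero d => simp
  | add d x y _ _ hx hy => rw [map_add]; exact Submodule.add_mem _ hx hy
  | smul d c x _ hx => rw [map_smul]; exact Submodule.smul_mem _ _ hx
  | ι_mul d i x _ hx => rw [freeComul_ι_mul]; exact comulStep_mem ℓ β deg i hx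

/-- The coproduct commutes with the scaling automorphisms. -/
theorem freeComul_freeScale (X : AddChar (n → ℤ) ℂ) (b : FreeAlgebra ℂ n) :
    freeComul ℓ β deg (freeScale deg X b) =
      map (freeScale deg X).toLinearMap (freeScale deg X).toLinearMap (freeComul ℓ β deg b) := by
  classical
  suffices h : freeComul ℓ β deg ∘ₗ (freeScale deg X).toLinearMap =
      map (freeScale deg X).toLinearMap (freeScale deg X).toLinearMap ∘ₗ freeComul ℓ β deg from
    congr($h b)
  refine linearMap_ext_homogeneous (freeGrading deg) fun d x hx => ?_
  -- A character turns the sum of the degrees of the two legs into a product, so scaling both legs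
  -- is the scalar `X d` on total degree `d`; the coproduct preserves the degree.
  have key : ∀ t ∈ tensorDegree (freeGrading deg) d,
      map (freeScale deg X).toLinearMap (freeScale deg X).toLinearMap t = X d • t := by
    intro t ht
    induction ht using Submodule.span_induction with
    | mem t ht =>
      obtain ⟨d₁, d₂, rfl, x, hx, y, hy, rfl⟩ := ht
      simp [freeScale_of_mem deg X hx, freeScale_of_mem deg X hy, AddChar.map_add_eq_mul,
        TensorProduct.smul_tmul', smul_smul, mul_comm]
    | zero => simp
    | add x y hx hy h1 h2 => rw [map_add, h1, h2, smul_add]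
    | smul c x hx h => rw [map_smul, h, smul_comm]
  simp [freeScale_of_mem deg X hx, key _ (freeComul_mem ℓ β deg hx)]

theorem freeComul_coassoc :
    (TensorProduct.assoc ℂ _ _ _).toLinearMap ∘ₗ
      (freeComul ℓ β deg).rTensor (FreeAlgebra ℂ n) ∘ₗ freeComul ℓ β deg =
    (freeComul ℓ β deg).lTensor (FreeAlgebra ℂ n) ∘ₗ freeComul ℓ β deg := by
  refine free_linearMap_ext_left ?_ fun i x hx => ?_
  · simp [freeComul_one]
  -- Both iterated coproducts of `x_i * x` arise from those of `x` by this one operator.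
  · let P := map (LinearMap.mulLeft ℂ (ι ℂ i)) LinearMap.id +
      map (scaleL ℓ β deg i).toLinearMap (comulStep ℓ β deg i)
    have h1 : ∀ t, TensorProduct.assoc ℂ _ _ _ ((freeComul ℓ β deg).rTensor (FreeAlgebra ℂ n)
        (comulStep ℓ β deg i t)) =
        P (TensorProduct.assoc ℂ _ _ _ ((freeComul ℓ β deg).rTensor (FreeAlgebra ℂ n) t)) := by
      intro t
      induction t using TensorProduct.induction_on with
      | zero => simp
      | add x y hx hy => simp only [map_add, hx, hy]
      | tmul a b =>
        simp only [comulStep_tmul, map_add, LinearMap.rTensor_tmul, freeComul_ι_mul]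
        rw [show freeComul ℓ β deg (scaleL ℓ β deg i a) = _ from freeComul_freeScale ℓ β deg _ a]
        induction freeComul ℓ β deg a using TensorProduct.induction_on with
        | zero => simp
        | add x y hx hy =>
          simp only [map_add, TensorProduct.add_tmul] at hx hy ⊢
          rw [← hx, ← hy]
          abel
        | tmul x y =>
          simp [P, TensorProduct.add_tmul, TensorProduct.tmul_add, scaleL, add_assoc]
    have h2 : ∀ t, (freeComul ℓ β deg).lTensor (FreeAlgebra ℂ n) (comulStep ℓ β deg i t) =
        P ((freeComul ℓ β deg).lTensor (FreeAlgebra ℂ n) t) := by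
      intro t
      induction t using TensorProduct.induction_on with
      | zero => simp
      | add x y hx hy => simp only [map_add, hx, hy]
      | tmul a b => simp [P, freeComul_ι_mul]
    simp only [LinearMap.comp_apply, LinearEquiv.coe_coe, freeComul_ι_mul] at hx ⊢
    rw [h1, h2, hx]

theorem freeCounit_freeScale (X : AddChar (n → ℤ) ℂ) (x : FreeAlgebra ℂ n) :
    freeCounit (freeScale deg X x) = freeCounit x := by
  induction x using free_left_induction with
  | one => simp
  | add x y hx hy => simp [hx, hy]
  | smul c x hx => simp [hx]
  | ι_mul j x hx => simp

theorem freeCounit_scaleL (i : n) (x : FreeAlgebra ℂ n) :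
    freeCounit (scaleL ℓ β deg i x) = freeCounit x := freeCounit_freeScale deg _ x

theorem freeComul_counit_left (b : FreeAlgebra ℂ n) :
    TensorProduct.lid ℂ _ (freeCounit.rTensor (FreeAlgebra ℂ n) (freeComul ℓ β deg b)) = b := by
  induction b using free_left_induction with
  | one => simp [freeComul_one]
  | add x y hx hy => simp only [map_add, hx, hy]
  | smul c x hx => simp only [map_smul, hx]
  | ι_mul i x hx =>
    conv_rhs => rw [← hx]
    rw [freeComul_ι_mul]
    induction freeComul ℓ β deg x using TensorProduct.induction_on with
    | zero => simp
    | add x y hx hy => simp only [map_add, mul_add, hx, hy]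
    | tmul a b => simp [freeCounit_scaleL]

theorem freeComul_counit_right (b : FreeAlgebra ℂ n) :
    TensorProduct.rid ℂ _ (freeCounit.lTensor (FreeAlgebra ℂ n) (freeComul ℓ β deg b)) = b := by
  induction b using free_left_induction with
  | one => simp [freeComul_one]
  | add x y hx hy => simp only [map_add, hx, hy]
  | smul c x hx => simp only [map_smul, hx]
  | ι_mul i x hx =>
    conv_rhs => rw [← hx]
    rw [freeComul_ι_mul]
    induction freeComul ℓ β deg x using TensorProduct.induction_on with
    | zero => simp
    | add x y hx hy => simp only [map_add, mul_add, hx, hy]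
    | tmul a b => simp

theorem freeCounit_of_mem {d : n → ℤ} {b : FreeAlgebra ℂ n} (hb : b ∈ freeGrading deg d)
    (hd : d ≠ 0) : freeCounit b = 0 := by
  induction hb using mem_freeGrading_induction with
  | one => exact absurd rfl hd
  | zero d => simp
  | add d x y _ _ hx hy => rw [map_add, hx hd, hy hd, add_zero]
  | smul d c x _ hx => rw [map_smul, hx hd, smul_zero]
  | ι_mul d i x _ hx => simp

/-- The braided antipode of the free algebra, `S (x_i b) = - S (g_i b) x_i`. -/
noncomputable def freeAntipode : FreeAlgebra ℂ n →ₗ[ℂ] FreeAlgebra ℂ n :=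
  LinearMap.applyₗ (1 : FreeAlgebra ℂ n) ∘ₗ (FreeAlgebra.lift ℂ fun i =>
    (-(LinearMap.mulRight ℂ (ι ℂ i) ∘ₗ (scaleL ℓ β deg i).toLinearMap) :
      Module.End ℂ (FreeAlgebra ℂ n))).toLinearMap

theorem freeAntipode_one : freeAntipode ℓ β deg 1 = 1 := by simp [freeAntipode]

theorem freeAntipode_ι_mul (i : n) (b : FreeAlgebra ℂ n) : freeAntipode ℓ β deg (ι ℂ i * b) =
    -(scaleL ℓ β deg i (freeAntipode ℓ β deg b) * ι ℂ i) := by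
  simp [freeAntipode]

theorem freeAntipode_mem {d : n → ℤ} {b : FreeAlgebra ℂ n} (hb : b ∈ freeGrading deg d) :
    freeAntipode ℓ β deg b ∈ freeGrading deg d := by
  induction hb using mem_freeGrading_induction with
  | one => rw [freeAntipode_one]; exact SetLike.GradedOne.one_mem
  | zero d => simp
  | add d x y _ _ hx hy => rw [map_add]; exact Submodule.add_mem _ hx hy
  | smul d c x _ hx => rw [map_smul]; exact Submodule.smul_mem _ _ hx
  | ι_mul d i x _ hx =>
    rw [freeAntipode_ι_mul, add_comm]
    exact Submodule.neg_mem _ (SetLike.mul_mem_graded (freeScale_mem deg _ hx)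
      (ι_mem_freeGrading deg i))

/-- The antipode preserves degrees, and the scaling is a scalar in each degree. -/
theorem freeAntipode_scaleL (i : n) (b : FreeAlgebra ℂ n) :
    freeAntipode ℓ β deg (scaleL ℓ β deg i b) = scaleL ℓ β deg i (freeAntipode ℓ β deg b) := by
  classical
  suffices h : freeAntipode ℓ β deg ∘ₗ (scaleL ℓ β deg i).toLinearMap =
      (scaleL ℓ β deg i).toLinearMap ∘ₗ freeAntipode ℓ β deg from congr($h b)
  refine linearMap_ext_homogeneous (freeGrading deg) fun d x hx => ?_
  simp [scaleL_of_mem ℓ β deg i hx, scaleL_of_mem ℓ β deg i (freeAntipode_mem ℓ β deg hx)]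

/-- By the recursion for the antipode the two terms of `comulStep` contribute opposite products.
Words beginning with a generator are thus killed without any induction hypothesis. -/
theorem freeAntipode_left (b : FreeAlgebra ℂ n) :
    LinearMap.mul' ℂ _ ((freeAntipode ℓ β deg).rTensor _ (freeComul ℓ β deg b)) =
      algebraMap ℂ _ (freeCounit b) := by
  induction b using free_left_induction with
  | one => simp [freeComul_one, freeAntipode_one]
  | add x y hx hy => simp only [map_add, hx, hy]
  | smul c x hx => simp only [map_smul, hx, smul_eq_mul, map_mul]; rw [Algebra.smul_def]
  | ι_mul i x _ =>
    rw [freeComul_ι_mul]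
    simp only [freeCounit_mul, freeCounit_ι, zero_mul, map_zero]
    induction freeComul ℓ β deg x using TensorProduct.induction_on with
    | zero => simp
    | add x y hx hy => simp only [map_add, hx, hy, add_zero]
    | tmul a b => simp [freeAntipode_ι_mul, freeAntipode_scaleL, mul_assoc]

theorem freeAntipode_right (b : FreeAlgebra ℂ n) :
    LinearMap.mul' ℂ _ ((freeAntipode ℓ β deg).lTensor _ (freeComul ℓ β deg b)) =
      algebraMap ℂ _ (freeCounit b) := by
  induction b using free_left_induction with
  | one => simp [freeComul_one, freeAntipode_one]
  | add x y hx hy => simp only [map_add, hx, hy]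
  | smul c x hx => simp only [map_smul, hx, smul_eq_mul, map_mul]; rw [Algebra.smul_def]
  | ι_mul i x hx =>
    -- If `m` is the value for `t`, the new value is a twisted commutator of `x_i` with `m`. By
    -- induction `m` is a scalar, which the scaling fixes and which commutes with `x_i`.
    have key : ∀ t, LinearMap.mul' ℂ _ ((freeAntipode ℓ β deg).lTensor _ (comulStep ℓ β deg i t)) =
        ι ℂ i * LinearMap.mul' ℂ _ ((freeAntipode ℓ β deg).lTensor _ t) -
          scaleL ℓ β deg i (LinearMap.mul' ℂ _ ((freeAntipode ℓ β deg).lTensor _ t)) * ι ℂ i := by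
      intro t
      induction t using TensorProduct.induction_on with
      | zero => simp
      | add x y hx hy => simp only [map_add, hx, hy, mul_add, add_mul]; abel
      | tmul a b => simp [freeAntipode_ι_mul, mul_assoc, sub_eq_add_neg]
    rw [freeComul_ι_mul, key, hx]
    simp [Algebra.commutes]

/-- The free algebra is a braided group. -/
theorem isBraidedGroup_free :
    IsBraidedGroup ℓ β (freeGrading deg) (freeComul ℓ β deg) freeCounit where
  coassoc := freeComul_coassoc ℓ β deg
  counit_left := freeComul_counit_left ℓ β deg
  counit_right := freeComul_counit_right ℓ β deg
  comul_one := freeComul_one ℓ β deg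
  comul_mul := freeComul_mul ℓ β deg
  counit_one := freeCounit_one
  counit_mul := freeCounit_mul
  comul_degree _ _ hb := freeComul_mem ℓ β deg hb
  counit_degree _ _ hb hd := freeCounit_of_mem deg hb hd
  antipode := ⟨freeAntipode ℓ β deg, fun _ _ hb => freeAntipode_mem ℓ β deg hb,
    freeAntipode_left ℓ β deg, freeAntipode_right ℓ β deg⟩

end FreeCoproduct

end CStat

namespace CStat

/-! ### Braided differentiation and the duality pairing -/

section Pairing

variable {n : Type u} [Fintype n] [DecidableEq n] (ℓ : ℂ) (β : Matrix n n ℂ) (r : n → ℂ)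

open FreeAlgebra TensorProduct

/-- The map to the dual numbers that defines `freeCoeff` has the counit as its scalar part, so the
coefficient functional is a derivation over the counit. -/
theorem freeCoeff_ι_mul (i j : n) (x : FreeAlgebra ℂ n) :
    freeCoeff i (ι ℂ j * x) = if i = j then freeCounit x else 0 := by
  have h : (TrivSqZeroExt.fstHom ℂ ℂ ℂ).comp (FreeAlgebra.lift ℂ fun j : n =>
      (if j = i then DualNumber.eps else 0 : DualNumber ℂ)) = FreeAlgebra.lift ℂ fun _ : n => 0 := by
    ext j
    by_cases h : j = i <;> simp [h]
  have hx := congr($h x)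
  simp only [AlgHom.comp_apply, TrivSqZeroExt.fstHom_apply] at hx
  simp only [freeCoeff, freeCounit, LinearMap.comp_apply, AlgHom.toLinearMap_apply, map_mul,
    FreeAlgebra.lift_ι_apply, TrivSqZeroExt.sndHom_apply, TrivSqZeroExt.snd_mul, hx]
  by_cases h : i = j
  · subst h; simp
  · simp [h, Ne.symm h]

@[simp] theorem freeCoeff_one (i : n) : freeCoeff i 1 = 0 := by
  simp [freeCoeff]

theorem freeCoeff_freeScale (deg : n → n → ℤ) (X : AddChar (n → ℤ) ℂ) (i : n)
    (x : FreeAlgebra ℂ n) : freeCoeff i (freeScale deg X x) = X (deg i) * freeCoeff i x := by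
  induction x using free_left_induction with
  | one => simp
  | add x y hx hy => simp [hx, hy, mul_add]
  | smul c x hx => simp [hx]; ring
  | ι_mul j x hx =>
    rw [map_mul, freeScale_ι, smul_mul_assoc, map_smul, freeCoeff_ι_mul, freeCoeff_ι_mul,
      freeCounit_freeScale]
    split_ifs with h <;> simp [h]

/-- Contraction of the coproduct with a functional commutes with the coproduct. -/
theorem freeComul_contract (deg : n → n → ℤ) (φ : FreeAlgebra ℂ n →ₗ[ℂ] ℂ) (b : FreeAlgebra ℂ n) :
    freeComul ℓ β deg (TensorProduct.lid ℂ _ (φ.rTensor _ (freeComul ℓ β deg b))) =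
      (((TensorProduct.lid ℂ _).toLinearMap ∘ₗ φ.rTensor _ ∘ₗ freeComul ℓ β deg).rTensor _)
        (freeComul ℓ β deg b) := by
  have h1 : ∀ t, freeComul ℓ β deg (TensorProduct.lid ℂ _ (φ.rTensor _ t)) =
      TensorProduct.lid ℂ _ (φ.rTensor _ ((freeComul ℓ β deg).lTensor _ t)) := by
    intro t
    induction t using TensorProduct.induction_on with
    | zero => simp
    | add x y hx hy => simp only [map_add, hx, hy]
    | tmul x y => simp
  have h2 : ∀ t : FreeAlgebra ℂ n ⊗[ℂ] FreeAlgebra ℂ n, TensorProduct.lid ℂ _ (φ.rTensor _ (TensorProduct.assoc ℂ _ _ _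
      ((freeComul ℓ β deg).rTensor _ t))) =
      (((TensorProduct.lid ℂ _).toLinearMap ∘ₗ φ.rTensor _ ∘ₗ freeComul ℓ β deg).rTensor _) t := by
    intro t
    induction t using TensorProduct.induction_on with
    | zero => simp
    | add x y hx hy => simp only [map_add, hx, hy]
    | tmul x y =>
      simp only [LinearMap.rTensor_tmul, LinearMap.comp_apply, LinearEquiv.coe_coe]
      induction freeComul ℓ β deg x using TensorProduct.induction_on with
      | zero => simp
      | add x y hx hy => simp only [map_add, TensorProduct.add_tmul, hx, hy]
      | tmul a b => simp [TensorProduct.smul_tmul']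
  rw [h1, ← h2]
  exact congr(TensorProduct.lid ℂ _ (φ.rTensor _ ($(freeComul_coassoc ℓ β deg) b))).symm

theorem freeDiff_apply (i : n) (b : FreeAlgebra ℂ n) : freeDiff ℓ β r i b =
    TensorProduct.lid ℂ _ (((r i - (r i)⁻¹)⁻¹ • freeCoeff i).rTensor _ (freeComul ℓ β degE b)) :=
  rfl

theorem freeDiff_one (i : n) : freeDiff ℓ β r i 1 = 0 := by
  simp [freeDiff_apply, freeComul_one]

/-- In `comulStep` one term carries `e_j` in the first leg, where the functional leaves the counit;
the other only rescales the first leg, by a scalar that is fixed on the coefficient of `e_i`. -/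
theorem freeDiff_ι_mul (i j : n) (b : FreeAlgebra ℂ n) : freeDiff ℓ β r i (ι ℂ j * b) =
    (if i = j then (r i - (r i)⁻¹)⁻¹ • b else 0) +
      charL ℓ β (degE j) (degE i) • (ι ℂ j * freeDiff ℓ β r i b) := by
  have key : ∀ t, TensorProduct.lid ℂ _ (((r i - (r i)⁻¹)⁻¹ • freeCoeff i).rTensor _
      (comulStep ℓ β degE j t)) =
      (if i = j then (r i - (r i)⁻¹)⁻¹ •
        TensorProduct.lid ℂ _ (freeCounit.rTensor (FreeAlgebra ℂ n) t) else 0) +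
      charL ℓ β (degE j) (degE i) • (ι ℂ j *
        TensorProduct.lid ℂ _ (((r i - (r i)⁻¹)⁻¹ • freeCoeff i).rTensor _ t)) := by
    intro t
    induction t using TensorProduct.induction_on with
    | zero => simp
    | add x y hx hy =>
      simp only [map_add, hx, hy, mul_add, smul_add]
      split_ifs <;> abel
    | tmul x y =>
      simp only [comulStep_tmul, map_add, LinearMap.rTensor_tmul, TensorProduct.lid_tmul,
        LinearMap.smul_apply, freeCoeff_ι_mul, scaleL, freeCoeff_freeScale]
      split_ifs <;> simp [smul_smul, mul_comm, mul_assoc]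
  rw [freeDiff_apply, freeComul_ι_mul, key, freeComul_counit_left, ← freeDiff_apply]

/-- The scalars met when the derivative passes the letters of `a` one by one assemble into an
automorphism. This is the braided Leibniz rule. -/
theorem freeDiff_mul (i : n) (a b : FreeAlgebra ℂ n) : freeDiff ℓ β r i (a * b) =
    freeDiff ℓ β r i a * b + freeScale degE (charR ℓ β (degE i)) a * freeDiff ℓ β r i b := by
  induction a using free_left_induction with
  | one => simp [freeDiff_one]
  | add x y hx hy => simp only [add_mul, map_add, hx, hy]; abel
  | smul c x hx => simp only [smul_mul_assoc, map_smul, hx, smul_add]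
  | ι_mul j x hx =>
    rw [mul_assoc, freeDiff_ι_mul, hx, freeDiff_ι_mul, map_mul, freeScale_ι, charR_apply]
    split_ifs <;> simp [mul_add, add_mul, mul_assoc, add_assoc]

theorem freeDiff_mem (i : n) {d : n → ℤ} {b : FreeAlgebra ℂ n} (hb : b ∈ freeGrading degE d) :
    freeDiff ℓ β r i b ∈ freeGrading degE (degF i + d) := by
  induction hb using mem_freeGrading_induction with
  | one => simp [freeDiff_one]
  | zero d => simp
  | add d x y _ _ hx hy => rw [map_add]; exact Submodule.add_mem _ hx hy
  | smul d c x _ hx => rw [map_smul]; exact Submodule.smul_mem _ _ hx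
  | ι_mul d j x hx h =>
    rw [freeDiff_ι_mul]
    refine Submodule.add_mem _ ?_ (Submodule.smul_mem _ _ ?_)
    · split_ifs with hij
      · subst hij
        rw [show degF i + (degE i + d) = d by simp [degE, degF]]
        exact Submodule.smul_mem _ _ hx
      · exact Submodule.zero_mem _
    · rw [add_left_comm]
      exact ι_mul_mem_freeGrading degE j h

/-- The action of `ℂ⟨f⟩` on `ℂ⟨e⟩` by braided differentiation. -/
noncomputable def freeDiffAlg : FreeAlgebra ℂ n →ₐ[ℂ] Module.End ℂ (FreeAlgebra ℂ n) :=
  FreeAlgebra.lift ℂ (freeDiff ℓ β r)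

@[simp] theorem freeDiffAlg_ι (i : n) : freeDiffAlg ℓ β r (ι ℂ i) = freeDiff ℓ β r i := by
  simp [freeDiffAlg]

theorem freeEv_apply (c b : FreeAlgebra ℂ n) :
    freeEv ℓ β r c b = freeCounit (freeDiffAlg ℓ β r c b) := rfl

/-- Each derivative contracts the first leg of the coproduct, so by coassociativity a further
coproduct does not feel it in its second leg. -/
theorem freeComul_freeDiffAlg (c b : FreeAlgebra ℂ n) :
    freeComul ℓ β degE (freeDiffAlg ℓ β r c b) =
      (freeDiffAlg ℓ β r c).rTensor _ (freeComul ℓ β degE b) := by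
  induction c using free_left_induction generalizing b with
  | one => simp [Module.End.one_eq_id]
  | add x y hx hy => simp [hx, hy, LinearMap.rTensor_add]
  | smul c x hx => simp [hx, LinearMap.rTensor_smul]
  | ι_mul i x hx =>
    rw [map_mul, Module.End.mul_apply, freeDiffAlg_ι, freeDiff_apply, freeComul_contract, hx,
      LinearMap.rTensor_mul]
    rfl

theorem freeDiffAlg_mem {d d' : n → ℤ} {c b : FreeAlgebra ℂ n} (hc : c ∈ freeGrading degF d)
    (hb : b ∈ freeGrading degE d') : freeDiffAlg ℓ β r c b ∈ freeGrading degE (d + d') := by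
  induction hc using mem_freeGrading_induction with
  | one => simpa using hb
  | zero d => simp
  | add d x y _ _ hx hy =>
    rw [map_add, LinearMap.add_apply]; exact Submodule.add_mem _ hx hy
  | smul d c x _ hx => rw [map_smul]; exact Submodule.smul_mem _ _ hx
  | ι_mul d i x _ h =>
    rw [map_mul, freeDiffAlg_ι, add_assoc]
    exact freeDiff_mem ℓ β r i h

theorem freeEv_of_mem {d d' : n → ℤ} {c b : FreeAlgebra ℂ n} (hc : c ∈ freeGrading degF d)
    (hb : b ∈ freeGrading degE d') (h : d + d' ≠ 0) : freeEv ℓ β r c b = 0 :=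
  freeCounit_of_mem degE (freeDiffAlg_mem ℓ β r hc hb) h

theorem freeEv_one_left (b : FreeAlgebra ℂ n) : freeEv ℓ β r 1 b = freeCounit b := by
  simp [freeEv_apply]

/-- Applying the counit to the first leg in `freeComul_freeDiffAlg` recovers the derivative of `b`
along `d` from the coproduct of `b`; differentiating the remaining leg along `c` yields the other
factor. -/
theorem freeEv_mul_left (c d b : FreeAlgebra ℂ n) : freeEv ℓ β r (c * d) b =
    LinearMap.mul' ℂ ℂ (map (freeEv ℓ β r d) (freeEv ℓ β r c) (freeComul ℓ β degE b)) := by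
  have key : ∀ t, LinearMap.mul' ℂ ℂ (map (freeEv ℓ β r d) (freeEv ℓ β r c) t) =
      freeCounit (freeDiffAlg ℓ β r c (TensorProduct.lid ℂ _ (freeCounit.rTensor _
        ((freeDiffAlg ℓ β r d).rTensor _ t)))) := by
    intro t
    induction t using TensorProduct.induction_on with
    | zero => simp
    | add x y hx hy => simp only [map_add, hx, hy]
    | tmul x y => simp [freeEv_apply]
  rw [key, ← freeComul_freeDiffAlg, freeComul_counit_left, freeEv_apply, map_mul]
  rfl

theorem freeEv_one_right (c : FreeAlgebra ℂ n) : freeEv ℓ β r c 1 = freeCounit c := by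
  induction c using free_right_induction with
  | one => simp [freeEv_one_left]
  | add x y hx hy => simp [hx, hy]
  | smul c x hx => simp [hx]
  | mul_ι i x hx => simp [freeEv_apply, freeDiff_one]

theorem freeEv_mul_ι (c b : FreeAlgebra ℂ n) (i : n) :
    freeEv ℓ β r (c * ι ℂ i) b = freeEv ℓ β r c (freeDiff ℓ β r i b) := by
  simp [freeEv_apply]

theorem charL_degF (d : n → ℤ) (i : n) :
    charL ℓ β (degF i) d = charL ℓ β (degE i) (-d) := by
  simp [charL_apply, degE, degF]

/-- The pairing lives in opposite degrees, where two minus signs cancel: that of the degree of `f_i`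
and that of the degree of `c` against the degree of `b`. -/
theorem freeEv_freeScale (i : n) (c b : FreeAlgebra ℂ n) :
    freeEv ℓ β r (freeScale degF (charR ℓ β (degF i)) c) b =
      freeEv ℓ β r c (freeScale degE (charR ℓ β (degE i)) b) := by
  suffices h : freeEv ℓ β r ∘ₗ (freeScale degF (charR ℓ β (degF i))).toLinearMap =
      (freeEv ℓ β r).compl₂ (freeScale degE (charR ℓ β (degE i))).toLinearMap from congr($h c b)
  refine linearMap_ext_homogeneous (freeGrading degF) fun d c hc =>
    linearMap_ext_homogeneous (freeGrading degE) fun d' b hb => ?_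
  simp only [LinearMap.comp_apply, LinearMap.compl₂_apply, AlgHom.toLinearMap_apply,
    freeScale_of_mem degF _ hc, freeScale_of_mem degE _ hb, map_smul, LinearMap.smul_apply]
  by_cases h : d + d' = 0
  · obtain rfl := eq_neg_of_add_eq_zero_left h
    congr 1
    simp [charR_apply, charL_apply, degE, degF]
  · rw [freeEv_of_mem ℓ β r hc hb h, smul_zero, smul_zero]

/-- An appended generator has to pass the second leg, so here the scaling falls on that leg, unlike
in `braidedMul_generator`. -/
theorem braidedMul_generator_right (deg : n → n → ℤ) (i : n) (t) :
    braidedMul ℓ β (freeGrading deg) t (ι ℂ i ⊗ₜ 1 + 1 ⊗ₜ ι ℂ i) =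
      map (LinearMap.mulRight ℂ (ι ℂ i)) (freeScale deg (charR ℓ β (deg i))).toLinearMap t +
        map .id (LinearMap.mulRight ℂ (ι ℂ i)) t := by
  suffices h : (braidedMul ℓ β (freeGrading deg)).flip (ι ℂ i ⊗ₜ 1 + 1 ⊗ₜ ι ℂ i) =
      map (LinearMap.mulRight ℂ (ι ℂ i)) (freeScale deg (charR ℓ β (deg i))).toLinearMap +
        map .id (LinearMap.mulRight ℂ (ι ℂ i)) from congr($h t)
  refine tensor_ext_homogeneous (freeGrading deg) (freeGrading deg) fun d d' x hx y hy => ?_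
  have h0 : (1 : FreeAlgebra ℂ n) ∈ freeGrading deg 0 := SetLike.GradedOne.one_mem
  rw [LinearMap.flip_apply, map_add, braidedMul_eq_charL ℓ β _ _ _ hy h0,
    braidedMul_eq_charL ℓ β _ _ _ hy (ι_mem_freeGrading deg i)]
  simp [freeScale_of_mem deg _ hy, charR_apply]

/-- The last letter of `c` acts on `a * b` as a braided derivation. Its Leibniz rule matches the
coproduct of an appended letter once `freeEv_freeScale` has carried the scaling across the pairing.
-/
theorem freeEv_mul_right (c a b : FreeAlgebra ℂ n) : freeEv ℓ β r c (a * b) =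
    LinearMap.mul' ℂ ℂ (map ((freeEv ℓ β r).flip b) ((freeEv ℓ β r).flip a)
      (freeComul ℓ β degF c)) := by
  induction c using free_right_induction generalizing a b with
  | one => simp [freeComul_one, freeEv_one_left, mul_comm]
  | add x y hx hy => simp only [map_add, LinearMap.add_apply, hx, hy]
  | smul c x hx => simp only [map_smul, LinearMap.smul_apply, hx]
  | mul_ι i x hx =>
    rw [freeEv_mul_ι, freeDiff_mul, map_add, hx, hx, freeComul_mul, freeComul_ι,
      braidedMul_generator_right]
    induction freeComul ℓ β degF x using TensorProduct.induction_on with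
    | zero => simp
    | add x y hx hy =>
      simp only [map_add] at hx hy ⊢
      rw [add_add_add_comm, hx, hy]; abel
    | tmul x y => simp [freeEv_mul_ι, freeEv_freeScale, add_comm]

theorem freeEv_ι_ι (i j : n) : freeEv ℓ β r (ι ℂ i) (ι ℂ j) =
    if i = j then (r i - (r i)⁻¹)⁻¹ else 0 := by
  have h := freeDiff_ι_mul ℓ β r i j 1
  rw [mul_one, freeDiff_one] at h
  rw [freeEv_apply, freeDiffAlg_ι, h]
  split_ifs <;> simp

/-- The pairing of the free braided groups is a duality pairing. -/
theorem isDualPairing_free : IsDualPairing (freeGrading degE) (freeGrading degF)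
    (freeComul ℓ β degF) freeCounit (freeComul ℓ β degE) freeCounit (freeEv ℓ β r) where
  one_left := freeEv_one_left ℓ β r
  one_right := freeEv_one_right ℓ β r
  mul_left := freeEv_mul_left ℓ β r
  mul_right := freeEv_mul_right ℓ β r
  degree _ _ _ hc _ hb h := freeEv_of_mem ℓ β r hc hb h

end Pairing

end CStat

namespace CStat

open TensorProduct

/-! ### Anti-multiplicative extensions from the free algebra -/

section AntiLift

variable {n : Type*} {A : Type*} [Semiring A] [Algebra ℂ A]

/-- The linear map from the free algebra that sends a word `x_i x_j ⋯ x_k` to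
`F k ⋯ F j F i`. -/
noncomputable def antiLift (F : n → A) : FreeAlgebra ℂ n →ₗ[ℂ] A :=
  (MulOpposite.opLinearEquiv ℂ).symm.toLinearMap ∘ₗ
    (FreeAlgebra.lift ℂ fun i => MulOpposite.op (F i)).toLinearMap

@[simp] theorem antiLift_one (F : n → A) : antiLift F 1 = 1 := by simp [antiLift]

@[simp] theorem antiLift_ι (F : n → A) (i : n) : antiLift F (FreeAlgebra.ι ℂ i) = F i := by
  simp [antiLift]

@[simp] theorem antiLift_mul (F : n → A) (a b : FreeAlgebra ℂ n) :
    antiLift F (a * b) = antiLift F b * antiLift F a := by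
  simp [antiLift]

/-- The star of the free algebra reverses words, which undoes the reversal in `antiLift`. -/
theorem antiLift_star (F : n → A) (a : FreeAlgebra ℂ n) :
    antiLift F (star a) = FreeAlgebra.lift ℂ F a := by
  induction a using free_left_induction with
  | one => simp
  | add x y hx hy => simp [hx, hy]
  | smul c x hx =>
    -- This star is linear and not conjugate linear: it fixes the scalars.
    rw [Algebra.smul_def, star_mul, FreeAlgebra.star_algebraMap, ← Algebra.commutes,
      ← Algebra.smul_def, map_smul, hx, ← Algebra.smul_def, map_smul]
  | ι_mul i x hx => simp [hx]

theorem map_antiLift {A' : Type*} [Semiring A'] [Algebra ℂ A'] (Φ : A →ₐ[ℂ] A') (F : n → A)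
    (a : FreeAlgebra ℂ n) : Φ (antiLift F a) = antiLift (fun i => Φ (F i)) a := by
  induction a using free_left_induction with
  | one => simp
  | add x y hx hy => simp [hx, hy]
  | smul c x hx => simp [hx]
  | ι_mul i x hx => simp [hx]

end AntiLift

/-! ### Algebras with a triangular decomposition -/

section Triangular

variable {n : Type u} [DecidableEq n] {K : Type v} [CommRing K] [Algebra ℂ K]
  (σ : n → K ≃ₐ[ℂ] K) (κ : n → K) {A : Type w} [Semiring A] [Algebra ℂ A]

/-- The relations `e_i h = σ_i(h) e_i`, `h f_i = f_i σ_i(h)` and `[e_i, f_j] = δ_ij κ_i`. -/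
structure TriangularRelations (φ : K →ₐ[ℂ] A) (E F : n → A) : Prop where
  e_map : ∀ i h, E i * φ h = φ (σ i h) * E i
  map_f : ∀ i h, φ h * F i = F i * φ (σ i h)
  e_f : ∀ i j, E i * F j = F j * E i + if i = j then φ (κ i) else 0

/-- The linear map `c ⊗ h ⊗ b ↦ c h b`, where the words `c` are read backwards. -/
noncomputable def triangularMap (φ : K →ₐ[ℂ] A) (E F : n → A) :
    FreeAlgebra ℂ n ⊗[ℂ] (K ⊗[ℂ] FreeAlgebra ℂ n) →ₗ[ℂ] A :=
  TensorProduct.lift ((LinearMap.mul ℂ A).compl₁₂ (antiLift F)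
    (LinearMap.mul' ℂ A ∘ₗ map φ.toLinearMap (FreeAlgebra.lift ℂ E).toLinearMap))

theorem triangularMap_tmul (φ : K →ₐ[ℂ] A) (E F : n → A) (c : FreeAlgebra ℂ n) (x) :
    triangularMap φ E F (c ⊗ₜ x) = antiLift F c *
      LinearMap.mul' ℂ A (map φ.toLinearMap (FreeAlgebra.lift ℂ E).toLinearMap x) := rfl

open FreeAlgebra in
/-- The defining relations of `Presented`. -/
inductive PresentedRel : FreeAlgebra ℂ (n ⊕ n ⊕ K) → FreeAlgebra ℂ (n ⊕ n ⊕ K) → Prop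
  | add (h k : K) : PresentedRel (ι ℂ (.inr (.inr (h + k))))
      (ι ℂ (.inr (.inr h)) + ι ℂ (.inr (.inr k)))
  | mul (h k : K) : PresentedRel (ι ℂ (.inr (.inr (h * k))))
      (ι ℂ (.inr (.inr h)) * ι ℂ (.inr (.inr k)))
  | algebraMap (c : ℂ) : PresentedRel (ι ℂ (.inr (.inr (algebraMap ℂ K c)))) (algebraMap ℂ _ c)
  | e_map (i : n) (h : K) : PresentedRel (ι ℂ (.inl i) * ι ℂ (.inr (.inr h)))
      (ι ℂ (.inr (.inr (σ i h))) * ι ℂ (.inl i))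
  | map_f (i : n) (h : K) : PresentedRel (ι ℂ (.inr (.inr h)) * ι ℂ (.inr (.inl i)))
      (ι ℂ (.inr (.inl i)) * ι ℂ (.inr (.inr (σ i h))))
  | e_f (i j : n) : PresentedRel
      (ι ℂ (.inl i) * ι ℂ (.inr (.inl j)))
      (ι ℂ (.inr (.inl j)) * ι ℂ (.inl i) + if i = j then ι ℂ (.inr (.inr (κ i))) else 0)

/-- The algebra generated over `K` by elements `e_i` and `f_i` with the relations
`TriangularRelations`. -/
def Presented : Type (max u v) := RingQuot (PresentedRel σ κ)

namespace Presented

noncomputable instance : Ring (Presented σ κ) := inferInstanceAs (Ring (RingQuot _))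

noncomputable instance : Algebra ℂ (Presented σ κ) := inferInstanceAs (Algebra ℂ (RingQuot _))

/-- The quotient map. -/
noncomputable def mk : FreeAlgebra ℂ (n ⊕ n ⊕ K) →ₐ[ℂ] Presented σ κ :=
  RingQuot.mkAlgHom ℂ (PresentedRel σ κ)

theorem mk_surjective : Function.Surjective (mk σ κ) := RingQuot.mkAlgHom_surjective _ _

theorem mk_rel {x y : FreeAlgebra ℂ (n ⊕ n ⊕ K)} (h : PresentedRel σ κ x y) :
    mk σ κ x = mk σ κ y := RingQuot.mkAlgHom_rel _ h

/-- The generators `e_i`. -/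
noncomputable def e (i : n) : Presented σ κ := mk σ κ (FreeAlgebra.ι ℂ (.inl i))

/-- The generators `f_i`. -/
noncomputable def f (i : n) : Presented σ κ := mk σ κ (FreeAlgebra.ι ℂ (.inr (.inl i)))

/-- The map from the coefficient algebra. -/
noncomputable def of : K →ₐ[ℂ] Presented σ κ where
  toFun h := mk σ κ (FreeAlgebra.ι ℂ (.inr (.inr h)))
  map_one' := by
    have := mk_rel σ κ (.algebraMap 1)
    rw [map_one, map_one] at this
    rw [this, map_one]
  map_mul' h k := by rw [mk_rel σ κ (.mul h k), map_mul]
  map_zero' := by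
    have := mk_rel σ κ (.algebraMap 0)
    rw [map_zero, map_zero] at this
    rw [this, map_zero]
  map_add' h k := by rw [mk_rel σ κ (.add h k), map_add]
  commutes' c := by rw [mk_rel σ κ (.algebraMap c), AlgHom.commutes]

theorem relations : TriangularRelations σ κ (of σ κ) (e σ κ) (f σ κ) where
  e_map i h := by
    have := mk_rel σ κ (.e_map i h)
    rwa [map_mul, map_mul] at this
  map_f i h := by
    have := mk_rel σ κ (.map_f i h)
    rwa [map_mul, map_mul] at this
  e_f i j := by
    have := mk_rel σ κ (.e_f i j)
    rw [map_add, apply_ite (mk σ κ), map_zero, map_mul, map_mul] at this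
    exact this

theorem induction {P : Presented σ κ → Prop} (of : ∀ h, P (of σ κ h)) (e : ∀ i, P (e σ κ i))
    (f : ∀ i, P (f σ κ i)) (add : ∀ a b, P a → P b → P (a + b))
    (mul : ∀ a b, P a → P b → P (a * b)) (a : Presented σ κ) : P a := by
  obtain ⟨a, rfl⟩ := mk_surjective σ κ a
  induction a with
  | grade0 c =>
    rw [AlgHom.commutes, ← AlgHom.commutes (Presented.of σ κ)]
    exact of _
  | grade1 x =>
    rcases x with i | i | h
    exacts [e i, f i, of h]
  | mul a b ha hb => rw [map_mul]; exact mul _ _ ha hb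
  | add a b ha hb => rw [map_add]; exact add _ _ ha hb

variable {σ κ}

/-- The universal property. -/
noncomputable def lift {φ : K →ₐ[ℂ] A} {E F : n → A} (h : TriangularRelations σ κ φ E F) :
    Presented σ κ →ₐ[ℂ] A :=
  RingQuot.liftAlgHom ℂ ⟨FreeAlgebra.lift ℂ (Sum.elim E (Sum.elim F φ)), by
    rintro x y (⟨h, k⟩ | ⟨h, k⟩ | c | ⟨i, k⟩ | ⟨i, k⟩ | ⟨i, j⟩)
    · simp
    · simp
    · simp
    · simpa using h.e_map i k
    · simpa using h.map_f i k
    · rw [map_add, apply_ite (FreeAlgebra.lift ℂ _)]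
      simpa using h.e_f i j⟩

theorem lift_mk {φ : K →ₐ[ℂ] A} {E F : n → A} (h : TriangularRelations σ κ φ E F) (x) :
    lift h (mk σ κ x) = FreeAlgebra.lift ℂ (Sum.elim E (Sum.elim F φ)) x :=
  RingQuot.liftAlgHom_mkAlgHom_apply _ _ _ _

@[simp] theorem lift_e {φ : K →ₐ[ℂ] A} {E F : n → A} (h : TriangularRelations σ κ φ E F) (i) :
    lift h (e σ κ i) = E i := by simp [e, lift_mk]

@[simp] theorem lift_f {φ : K →ₐ[ℂ] A} {E F : n → A} (h : TriangularRelations σ κ φ E F) (i) :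
    lift h (f σ κ i) = F i := by simp [f, lift_mk]

@[simp] theorem lift_of {φ : K →ₐ[ℂ] A} {E F : n → A} (h : TriangularRelations σ κ φ E F) (k) :
    lift h (of σ κ k) = φ k := (lift_mk h _).trans (by simp)

theorem algHom_ext {f g : Presented σ κ →ₐ[ℂ] A} (hof : ∀ h, f (of σ κ h) = g (of σ κ h))
    (he : ∀ i, f (e σ κ i) = g (e σ κ i)) (hf : ∀ i, f (Presented.f σ κ i) = g (.f σ κ i)) :
    f = g := by
  refine AlgHom.ext fun a => ?_
  induction a using Presented.induction with
  | of h => exact hof h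
  | e i => exact he i
  | f i => exact hf i
  | add a b ha hb => rw [map_add, map_add, ha, hb]
  | mul a b ha hb => rw [map_mul, map_mul, ha, hb]

theorem lift_triangularMap {φ : K →ₐ[ℂ] A} {E F : n → A} (h : TriangularRelations σ κ φ E F) (t) :
    lift h (triangularMap (of σ κ) (e σ κ) (f σ κ) t) = triangularMap φ E F t := by
  suffices H : (lift h).toLinearMap ∘ₗ triangularMap (of σ κ) (e σ κ) (f σ κ) =
      triangularMap φ E F from congr($H t)
  have hE : ∀ b, lift h (FreeAlgebra.lift ℂ (e σ κ) b) = FreeAlgebra.lift ℂ E b := by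
    intro b
    have : (lift h).comp (FreeAlgebra.lift ℂ (e σ κ)) = FreeAlgebra.lift ℂ E := by ext; simp
    exact congr($this b)
  ext c k b
  simp [triangularMap_tmul, map_antiLift, hE]

variable (σ κ)

/-! The left regular representation is constructed on the space of triangular words. -/

/-- The automorphism of `K` by which a coefficient is moved to the right of a word in the
`f_i`. -/
def moveRight : List n → K →ₐ[ℂ] K
  | [] => AlgHom.id ℂ K
  | i :: l => (moveRight l).comp (σ i).toAlgHom

/-- The space of triangular words. -/
abbrev Words (n : Type u) (K : Type v) [CommRing K] [Algebra ℂ K] : Type (max u v) :=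
  List n →₀ (K ⊗[ℂ] FreeAlgebra ℂ n)

/-- Left multiplication by a coefficient. -/
noncomputable def actK (h : K) : Words n K →ₗ[ℂ] Words n K :=
  Finsupp.lsum ℂ fun l => Finsupp.lsingle l ∘ₗ
    map (LinearMap.mulLeft ℂ (moveRight σ l h)) LinearMap.id

/-- Left multiplication by `f_i`. -/
noncomputable def actF (i : n) : Words n K →ₗ[ℂ] Words n K :=
  Finsupp.lmapDomain _ ℂ (List.cons i)

/-- Left multiplication of the words starting with `l` by `e_i`. -/
noncomputable def actEAux (i : n) : List n → K ⊗[ℂ] FreeAlgebra ℂ n →ₗ[ℂ] Words n K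
  | [] => Finsupp.lsingle [] ∘ₗ
      map (σ i).toLinearMap (LinearMap.mulLeft ℂ (FreeAlgebra.ι ℂ i))
  | j :: l => actF j ∘ₗ actEAux i l +
      if i = j then actK σ (κ i) ∘ₗ Finsupp.lsingle l else 0

/-- Left multiplication by `e_i`. -/
noncomputable def actE (i : n) : Words n K →ₗ[ℂ] Words n K :=
  Finsupp.lsum ℂ (actEAux σ κ i)

theorem actK_single (h : K) (l : List n) (x) : actK σ h (.single l x) =
    .single l (map (LinearMap.mulLeft ℂ (moveRight σ l h)) LinearMap.id x) := by
  simp [actK]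

theorem actF_single (i : n) (l : List n) (x : K ⊗[ℂ] FreeAlgebra ℂ n) :
    actF i (.single l x) = .single (i :: l) x := by
  simp [actF]

theorem actE_single_nil (i : n) (x) : actE σ κ i (.single [] x) =
    .single [] (map (σ i).toLinearMap (LinearMap.mulLeft ℂ (FreeAlgebra.ι ℂ i)) x) := by
  simp [actE, actEAux]

/-- The recursion in `actEAux` is this relation, solved for the action of `e_i` on a word with
leading letter `f_j`. -/
theorem actE_actF (i j : n) (m : Words n K) : actE σ κ i (actF j m) =
    actF j (actE σ κ i m) + if i = j then actK σ (κ i) m else 0 := by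
  induction m using Finsupp.induction_linear with
  | zero => simp
  | add x y hx hy => simp only [map_add, hx, hy]; split_ifs <;> abel
  | single l x =>
    rw [actF_single]
    simp only [actE, Finsupp.lsum_single, actEAux, LinearMap.add_apply, LinearMap.comp_apply]
    split_ifs <;> simp

theorem actK_actF (i : n) (h : K) (m : Words n K) :
    actK σ h (actF i m) = actF i (actK σ (σ i h) m) := by
  induction m using Finsupp.induction_linear with
  | zero => simp
  | add x y hx hy => simp only [map_add, hx, hy]
  | single l x => simp only [actF_single, actK_single]; rfl

/-- The representation of `K` on triangular words. -/
noncomputable def actKAlg : K →ₐ[ℂ] Module.End ℂ (Words n K) :=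
  AlgHom.ofLinearMap
    { toFun := actK σ
      map_add' := fun h k => by
        refine Finsupp.lhom_ext fun l x => ?_
        simp only [LinearMap.add_apply, actK_single, map_add, ← Finsupp.single_add]
        congr 1
        induction x using TensorProduct.induction_on with
        | zero => simp
        | add x y hx hy => simp only [map_add, hx, hy]; abel
        | tmul a b => simp [add_mul, add_tmul]
      map_smul' := fun c h => by
        refine Finsupp.lhom_ext fun l x => ?_
        simp only [LinearMap.smul_apply, actK_single, map_smul, Finsupp.smul_single,
          RingHom.id_apply]
        congr 1
        induction x using TensorProduct.induction_on with
        | zero => simp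
        | add x y hx hy => simp only [map_add, hx, hy, smul_add]
        | tmul a b => simp [smul_tmul'] }
    (by
      refine Finsupp.lhom_ext fun l x => ?_
      simp only [LinearMap.coe_mk, AddHom.coe_mk, actK_single, map_one, Module.End.one_apply]
      congr 1
      induction x using TensorProduct.induction_on with
      | zero => simp
      | add x y hx hy => simp only [map_add, hx, hy]
      | tmul a b => simp)
    (fun h k => by
      refine Finsupp.lhom_ext fun l x => ?_
      simp only [LinearMap.coe_mk, AddHom.coe_mk, actK_single, map_mul, Module.End.mul_apply]
      congr 1
      induction x using TensorProduct.induction_on with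
      | zero => simp
      | add x y hx hy => simp only [map_add, hx, hy]
      | tmul a b => simp [mul_assoc])

theorem actKAlg_apply (h : K) : actKAlg σ h = actK σ h := rfl

theorem actK_mul (h k : K) (m : Words n K) : actK σ (h * k) m = actK σ h (actK σ k m) :=
  congr($(map_mul (actKAlg σ) h k) m)

variable (hσ : ∀ i j h, σ i (σ j h) = σ j (σ i h))

-- Past a leading `f_j` the coefficient is translated by `σ_j`, so the two orders agree because the
-- `σ`'s commute. For `i = j` there is also the correction by `κ_i`, which commutes with the
-- coefficient since `K` is commutative.
include hσ in
theorem actE_actK (i : n) (h : K) (m : Words n K) :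
    actE σ κ i (actK σ h m) = actK σ (σ i h) (actE σ κ i m) := by
  induction m using Finsupp.induction_linear with
  | zero => simp
  | add x y hx hy => simp only [map_add, hx, hy]
  | single l x =>
    induction l generalizing h with
    | nil =>
      simp only [actE_single_nil, actK_single]
      congr 1
      induction x using TensorProduct.induction_on with
      | zero => simp
      | add x y hx hy => simp only [map_add, hx, hy]
      | tmul a b => simp [moveRight]
    | cons j l ih =>
      rw [← actF_single, actK_actF, actE_actF, ih, actE_actF, map_add, actK_actF, hσ]
      split_ifs with hij
      · subst hij
        rw [← actK_mul, ← actK_mul, mul_comm]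
      · simp

include hσ in
theorem representation_relations : TriangularRelations (A := Module.End ℂ (Words n K)) σ κ
    (actKAlg σ) (actE σ κ) actF where
  e_map i h := LinearMap.ext fun m => actE_actK σ κ hσ i h m
  map_f i h := LinearMap.ext fun m => actK_actF σ i h m
  e_f i j := LinearMap.ext fun m => by
    rw [LinearMap.add_apply, Module.End.mul_apply, Module.End.mul_apply, actE_actF]
    split_ifs <;> rfl

/-- The representation on triangular words. -/
noncomputable def representation : Presented σ κ →ₐ[ℂ] Module.End ℂ (Words n K) :=
  lift (representation_relations σ κ hσ)

/-- A triangular word as an element of the tensor product. -/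
noncomputable def wordsToTensor :
    Words n K →ₗ[ℂ] FreeAlgebra ℂ n ⊗[ℂ] (K ⊗[ℂ] FreeAlgebra ℂ n) :=
  Finsupp.lsum ℂ fun l => TensorProduct.mk ℂ _ _ (l.reverse.map (FreeAlgebra.ι ℂ)).prod

/-- Lists record the product in its true order and the tensor factor records it reversed, so
prefixing to the list is appending to the word. -/
theorem wordsToTensor_actF (i : n) (m : Words n K) : wordsToTensor (actF i m) =
    map (LinearMap.mulRight ℂ (FreeAlgebra.ι ℂ i)) LinearMap.id (wordsToTensor m) := by
  induction m using Finsupp.induction_linear with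
  | zero => simp
  | add x y hx hy => simp only [map_add, hx, hy]
  | single l x => simp [actF_single, wordsToTensor]

theorem triangularMap_mulRight (c) (i : n) :
    triangularMap (of σ κ) (e σ κ) (f σ κ)
      (map (LinearMap.mulRight ℂ (FreeAlgebra.ι ℂ i)) LinearMap.id c) =
    f σ κ i * triangularMap (of σ κ) (e σ κ) (f σ κ) c := by
  induction c using TensorProduct.induction_on with
  | zero => simp
  | add x y hx hy => simp only [map_add, hx, hy, mul_add]
  | tmul a b => simp [triangularMap_tmul, mul_assoc]

/-- A triangular word as an element of the algebra. -/
noncomputable def wordsTo : Words n K →ₗ[ℂ] Presented σ κ :=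
  triangularMap (of σ κ) (e σ κ) (f σ κ) ∘ₗ wordsToTensor

theorem wordsTo_actF (i : n) (m : Words n K) : wordsTo σ κ (actF i m) =
    f σ κ i * wordsTo σ κ m := by
  rw [wordsTo, LinearMap.comp_apply, wordsToTensor_actF, triangularMap_mulRight,
    LinearMap.comp_apply]

theorem wordsTo_single_nil (x : K ⊗[ℂ] FreeAlgebra ℂ n) : wordsTo σ κ (.single [] x) =
    LinearMap.mul' ℂ _ (map (of σ κ).toLinearMap (FreeAlgebra.lift ℂ (e σ κ)).toLinearMap x) := by
  simp [wordsTo, wordsToTensor, triangularMap_tmul]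

theorem wordsTo_actK (h : K) (m : Words n K) : wordsTo σ κ (actK σ h m) =
    of σ κ h * wordsTo σ κ m := by
  induction m using Finsupp.induction_linear with
  | zero => simp
  | add x y hx hy => simp only [map_add, hx, hy, mul_add]
  | single l x =>
    induction l generalizing h with
    | nil =>
      rw [actK_single, wordsTo_single_nil, wordsTo_single_nil]
      induction x using TensorProduct.induction_on with
      | zero => simp
      | add x y hx hy => simp only [map_add, hx, hy, mul_add]
      | tmul a b => simp [moveRight, mul_assoc]
    | cons j l ih =>
      rw [← actF_single, actK_actF, wordsTo_actF, ih, wordsTo_actF, ← mul_assoc, ← mul_assoc,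
        (relations σ κ).map_f]

theorem wordsTo_actE (i : n) (m : Words n K) : wordsTo σ κ (actE σ κ i m) =
    e σ κ i * wordsTo σ κ m := by
  induction m using Finsupp.induction_linear with
  | zero => simp
  | add x y hx hy => simp only [map_add, hx, hy, mul_add]
  | single l x =>
    induction l with
    | nil =>
      rw [actE_single_nil, wordsTo_single_nil, wordsTo_single_nil]
      induction x using TensorProduct.induction_on with
      | zero => simp
      | add x y hx hy => simp only [map_add, hx, hy, mul_add]
      | tmul a b => simp [← mul_assoc, (relations σ κ).e_map]
    | cons j l ih =>
      rw [← actF_single, actE_actF, map_add, wordsTo_actF, wordsTo_actF, ih, ← mul_assoc,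
        ← mul_assoc, (relations σ κ).e_f, add_mul]
      split_ifs
      · rw [wordsTo_actK]
      · simp

/-- The operators on words perform the moves that the relations permit in the algebra. Applied to
the empty word, this equivariance shows that triangular words span. -/
theorem wordsTo_representation (a : Presented σ κ) (m : Words n K) :
    wordsTo σ κ (representation σ κ hσ a m) = a * wordsTo σ κ m := by
  induction a using Presented.induction generalizing m with
  | of h => rw [representation, lift_of]; exact wordsTo_actK σ κ h m
  | e i => rw [representation, lift_e]; exact wordsTo_actE σ κ i m
  | f i => rw [representation, lift_f]; exact wordsTo_actF σ κ i m
  | add a b ha hb => rw [map_add, LinearMap.add_apply, map_add, ha, hb, add_mul]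
  | mul a b ha hb => rw [map_mul, Module.End.mul_apply, ha, hb, mul_assoc]

theorem representation_lift_e (b : FreeAlgebra ℂ n) :
    representation σ κ hσ (FreeAlgebra.lift ℂ (e σ κ) b) (Finsupp.single [] (1 ⊗ₜ 1)) =
      .single [] (1 ⊗ₜ b) := by
  induction b using free_left_induction with
  | one => simp
  | add x y hx hy => simp only [map_add, LinearMap.add_apply, hx, hy, tmul_add, Finsupp.single_add]
  | smul c x hx =>
    rw [map_smul, map_smul, LinearMap.smul_apply, hx, tmul_smul, Finsupp.smul_single]
  | ι_mul i x hx =>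
    rw [map_mul, map_mul, Module.End.mul_apply, hx, FreeAlgebra.lift_ι_apply, representation,
      lift_e, actE_single_nil]
    simp

theorem wordsToTensor_representation (c : FreeAlgebra ℂ n) (x : K ⊗[ℂ] FreeAlgebra ℂ n) :
    wordsToTensor (representation σ κ hσ (antiLift (f σ κ) c) (Finsupp.single [] x)) = c ⊗ₜ x := by
  induction c using free_right_induction with
  | one => simp [wordsToTensor]
  | add x y hx hy => simp only [map_add, LinearMap.add_apply, hx, hy, add_tmul]
  | smul c x hx => rw [map_smul, map_smul, LinearMap.smul_apply, map_smul, hx, smul_tmul']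
  | mul_ι i x hx =>
    rw [antiLift_mul, map_mul, Module.End.mul_apply, antiLift_ι, representation, lift_f,
      wordsToTensor_actF]
    rw [representation] at hx
    rw [hx]
    simp

include hσ in
/-- The triangular decomposition. -/
theorem triangularMap_bijective :
    Function.Bijective (triangularMap (of σ κ) (e σ κ) (f σ κ)) := by
  -- The inverse lets `a` act on the empty word with coefficient `1 ⊗ 1`. Evaluating this on `c h b`
  -- gives independence of triangular words, and equivariance of `wordsTo` gives spanning.
  refine Function.bijective_iff_has_inverse.mpr
    ⟨fun a => wordsToTensor (representation σ κ hσ a (Finsupp.single [] (1 ⊗ₜ 1))), fun t => ?_,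
      fun a => ?_⟩
  · suffices H : wordsToTensor ∘ₗ LinearMap.applyₗ (Finsupp.single [] (1 ⊗ₜ 1)) ∘ₗ
        (representation σ κ hσ).toLinearMap ∘ₗ triangularMap (of σ κ) (e σ κ) (f σ κ) = .id from
      congr($H t)
    ext c h b
    have hb := representation_lift_e σ κ hσ b
    have h1 : representation σ κ hσ (of σ κ h) (Finsupp.single [] (1 ⊗ₜ b)) = .single [] (h ⊗ₜ b) := by
      rw [representation, lift_of, actKAlg_apply, actK_single]
      simp [moveRight]
    simp only [AlgebraTensorModule.curry_apply, curry_apply, LinearMap.coe_restrictScalars,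
      LinearMap.comp_apply, AlgHom.toLinearMap_apply, triangularMap_tmul, map_tmul,
      LinearMap.mul'_apply, map_mul, LinearMap.applyₗ_apply_apply, Module.End.mul_apply, hb, h1,
      LinearMap.id_apply]
    exact wordsToTensor_representation σ κ hσ c _
  · have := wordsTo_representation σ κ hσ a (Finsupp.single [] (1 ⊗ₜ 1))
    rw [wordsTo_single_nil, wordsTo, LinearMap.comp_apply] at this
    simpa using this

end Presented

end Triangular

end CStat

namespace CStat

open TensorProduct

/-! ### Translations of the quantum group -/

section Shift

variable {n : Type u} [Fintype n] {ℓ : ℂ} {β : Matrix n n ℂ}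

/-- Evaluation of the first tensor factor. -/
noncomputable def evalLeft (z : n → ℂ) : Uq ℓ β ⊗[ℂ] Uq ℓ β →ₐ[ℂ] Uq ℓ β :=
  Algebra.TensorProduct.lift ((Algebra.ofId ℂ _).comp (evalAt ℓ β z)) (AlgHom.id ℂ _)
    fun _ _ => Commute.all _ _

/-- Evaluation of the second tensor factor. -/
noncomputable def evalRight (z : n → ℂ) : Uq ℓ β ⊗[ℂ] Uq ℓ β →ₐ[ℂ] Uq ℓ β :=
  Algebra.TensorProduct.lift (AlgHom.id ℂ _) ((Algebra.ofId ℂ _).comp (evalAt ℓ β z))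
    fun _ _ => Commute.all _ _

@[simp] theorem evalLeft_tmul (z : n → ℂ) (a b : Uq ℓ β) :
    evalLeft z (a ⊗ₜ[ℂ] b) = evalAt ℓ β z a • b := by
  simp [evalLeft, Algebra.ofId_apply, Algebra.smul_def]

@[simp] theorem evalRight_tmul (z : n → ℂ) (a b : Uq ℓ β) :
    evalRight z (a ⊗ₜ[ℂ] b) = evalAt ℓ β z b • a := by
  simp [evalRight, Algebra.ofId_apply, Algebra.smul_def, mul_comm]

theorem evalAt_evalLeft (z y : n → ℂ) (t : Uq ℓ β ⊗[ℂ] Uq ℓ β) :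
    evalAt ℓ β y (evalLeft z t) = evalAt₂ z y t := by
  induction t using TensorProduct.induction_on with
  | zero => simp
  | add a b ha hb => simp only [map_add, ha, hb]
  | tmul a b => simp

theorem evalAt_evalRight (z y : n → ℂ) (t : Uq ℓ β ⊗[ℂ] Uq ℓ β) :
    evalAt ℓ β y (evalRight z t) = evalAt₂ y z t := by
  induction t using TensorProduct.induction_on with
  | zero => simp
  | add a b ha hb => simp only [map_add, ha, hb]
  | tmul a b => simp [mul_comm]

/-- Translation of the variables by `z`. -/
noncomputable def shiftHom (z : n → ℂ) : Uq ℓ β →ₐ[ℂ] Uq ℓ β := (evalLeft z).comp comulUq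

@[simp] theorem evalAt_shiftHom (z y : n → ℂ) (a : Uq ℓ β) :
    evalAt ℓ β y (shiftHom z a) = evalAt ℓ β (z + y) a := by
  simp [shiftHom, evalAt_evalLeft]

theorem evalLeft_comul (z : n → ℂ) (a : Uq ℓ β) :
    evalLeft z (Coalgebra.comul a) = shiftHom z a := rfl

/-- Addition of points is commutative, so evaluating either leg of the coproduct gives the same
translation. This is why the cross relations of `B` and `C` with `U_q(β)` take the same form despite
the exchanged legs. -/
theorem evalRight_comul (z : n → ℂ) (a : Uq ℓ β) :
    evalRight z (Coalgebra.comul a) = shiftHom z a :=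
  evalAt_ext fun y => by
    rw [evalAt_evalRight, evalAt_shiftHom, add_comm]
    exact evalAt₂_comulUq y z a

theorem shiftHom_add (z y : n → ℂ) (a : Uq ℓ β) :
    shiftHom z (shiftHom y a) = shiftHom (z + y) a :=
  evalAt_ext fun x => by simp only [evalAt_shiftHom]; congr 1; abel_nf

theorem shiftHom_zero (a : Uq ℓ β) : shiftHom 0 a = a :=
  evalAt_ext fun x => by simp

theorem shiftHom_xi (z : n → ℂ) (i : n) :
    shiftHom z (xi ℓ β i) = xi ℓ β i + algebraMap ℂ _ (z i) :=
  evalAt_ext fun x => by simp [add_comm]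

theorem shiftHom_expUp (z : n → ℂ) (i : n) (t : ℤ) : shiftHom z (expUp ℓ β i t) =
    qpow ℓ (t * ∑ j, β i j * z j) • expUp ℓ β i t :=
  evalAt_ext fun x => by
    simp [← qpow_add, ← mul_add, ← Finset.sum_add_distrib]

theorem shiftHom_expDown (z : n → ℂ) (i : n) (t : ℤ) : shiftHom z (expDown ℓ β i t) =
    qpow ℓ (t * ∑ j, z j * β j i) • expDown ℓ β i t :=
  evalAt_ext fun x => by
    simp [← qpow_add, ← mul_add, ← Finset.sum_add_distrib, add_mul]

theorem expUp_add (i : n) (s t : ℤ) : expUp ℓ β i (s + t) = expUp ℓ β i s * expUp ℓ β i t :=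
  evalAt_ext fun x => by simp [← qpow_add, add_mul]

theorem expUp_zero (i : n) : expUp ℓ β i 0 = 1 := evalAt_ext fun x => by simp [qpow_zero]

theorem expDown_add (i : n) (s t : ℤ) :
    expDown ℓ β i (s + t) = expDown ℓ β i s * expDown ℓ β i t :=
  evalAt_ext fun x => by simp [← qpow_add, add_mul]

theorem expDown_zero (i : n) : expDown ℓ β i 0 = 1 := evalAt_ext fun x => by simp [qpow_zero]

variable (ℓ β)

/-- Translation by an integer degree. -/
noncomputable def shift (d : n → ℤ) : Uq ℓ β ≃ₐ[ℂ] Uq ℓ β :=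
  AlgEquiv.ofAlgHom (shiftHom (toPt d)) (shiftHom (-toPt d))
    (AlgHom.ext fun a => by simp [shiftHom_add, shiftHom_zero])
    (AlgHom.ext fun a => by simp [shiftHom_add, shiftHom_zero])

theorem shift_apply (d : n → ℤ) (a : Uq ℓ β) : shift ℓ β d a = shiftHom (toPt d) a := rfl

theorem toPt_add (d d' : n → ℤ) : toPt (d + d') = toPt d + toPt d' := by
  ext; simp [toPt]

theorem shift_add (d d' : n → ℤ) (a : Uq ℓ β) :
    shift ℓ β (d + d') a = shift ℓ β d (shift ℓ β d' a) := by
  rw [shift_apply, shift_apply, shift_apply, shiftHom_add, toPt_add]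

theorem shift_comm (d d' : n → ℤ) (a : Uq ℓ β) :
    shift ℓ β d (shift ℓ β d' a) = shift ℓ β d' (shift ℓ β d a) := by
  rw [← shift_add, ← shift_add, add_comm]

theorem shift_zero (a : Uq ℓ β) : shift ℓ β 0 a = a := by
  rw [shift_apply, show toPt (0 : n → ℤ) = 0 by ext; simp [toPt], shiftHom_zero]

variable [DecidableEq n]

/-- Translation by the degree of `e_i`. -/
noncomputable def shiftE (i : n) : Uq ℓ β ≃ₐ[ℂ] Uq ℓ β := shift ℓ β (degE i)

theorem shiftE_comm (i j : n) (a : Uq ℓ β) :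
    shiftE ℓ β i (shiftE ℓ β j a) = shiftE ℓ β j (shiftE ℓ β i a) := shift_comm ℓ β _ _ a

theorem toPt_degE (i j : n) : toPt (degE i) j = if j = i then 1 else 0 := by
  by_cases h : j = i <;> simp [toPt, degE, h]

theorem shiftE_xi (i j : n) :
    shiftE ℓ β i (xi ℓ β j) = xi ℓ β j + if i = j then 1 else 0 := by
  rw [shiftE, shift_apply, shiftHom_xi, toPt_degE]
  by_cases h : i = j
  · simp [h]
  · simp [h, Ne.symm h]

theorem shiftE_expUp (i j : n) (t : ℤ) :
    shiftE ℓ β i (expUp ℓ β j t) = qpow ℓ (t * β j i) • expUp ℓ β j t := by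
  rw [shiftE, shift_apply, shiftHom_expUp]
  simp [toPt_degE]

theorem shiftE_expDown (i j : n) (t : ℤ) :
    shiftE ℓ β i (expDown ℓ β j t) = qpow ℓ (t * β i j) • expDown ℓ β j t := by
  rw [shiftE, shift_apply, shiftHom_expDown]
  simp [toPt_degE]

/-- The commutator of `e_i` and `f_i`. -/
noncomputable def kappa (r : n → ℂ) (i : n) : Uq ℓ β :=
  (r i - (r i)⁻¹)⁻¹ • (expUp ℓ β i 1 - expDown ℓ β i (-1))

/-- Translation only multiplies each exponential by a scalar, so no `ξ_j` can appear. This allows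
the triangular construction to be carried out over the exponentials alone. -/
theorem shiftE_mem_UqExp (d : n → ℤ) {a : Uq ℓ β} (ha : a ∈ UqExp ℓ β) :
    shift ℓ β d a ∈ UqExp ℓ β := by
  have h : UqExp ℓ β ≤ (UqExp ℓ β).comap (shift ℓ β d).toAlgHom := by
    refine Algebra.adjoin_le ?_
    rintro _ (⟨i, t, rfl⟩ | ⟨i, t, rfl⟩)
    · change shiftHom (toPt d) _ ∈ UqExp ℓ β
      rw [shiftHom_expUp]
      exact Subalgebra.smul_mem _ (UqExp.up ℓ β i t).2 _
    · change shiftHom (toPt d) _ ∈ UqExp ℓ β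
      rw [shiftHom_expDown]
      exact Subalgebra.smul_mem _ (UqExp.down ℓ β i t).2 _
  exact h ha

theorem shift_symm_apply (d : n → ℤ) (a : Uq ℓ β) :
    (shift ℓ β d).symm a = shift ℓ β (-d) a := by
  rw [AlgEquiv.symm_apply_eq, ← shift_add, add_neg_cancel, shift_zero]

/-- Translation of `UqExp` by the degree of `e_i`. -/
noncomputable def shiftExp (i : n) : UqExp ℓ β ≃ₐ[ℂ] UqExp ℓ β where
  toFun a := ⟨shiftE ℓ β i a, shiftE_mem_UqExp ℓ β _ a.2⟩
  invFun a := ⟨(shiftE ℓ β i).symm a, by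
    rw [shiftE, shift_symm_apply]; exact shiftE_mem_UqExp ℓ β _ a.2⟩
  left_inv a := by ext1; simp
  right_inv a := by ext1; simp
  map_mul' a b := by ext1; simp
  map_add' a b := by ext1; simp
  commutes' c := by ext1; exact (shiftE ℓ β i).commutes c

theorem shiftExp_comm (i j : n) (a : UqExp ℓ β) :
    shiftExp ℓ β i (shiftExp ℓ β j a) = shiftExp ℓ β j (shiftExp ℓ β i a) :=
  Subtype.ext (shiftE_comm ℓ β i j a)

/-- The commutator of `e_i` and `f_i` in `UqExp`. -/
noncomputable def kappaExp (r : n → ℂ) (i : n) : UqExp ℓ β :=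
  (r i - (r i)⁻¹)⁻¹ • (UqExp.up ℓ β i 1 - UqExp.down ℓ β i (-1))

end Shift

/-! ### Comparison of the relations -/

section Relations

variable {K A : Type*} [CommRing K] [Algebra ℂ K] [Ring A] [Algebra ℂ A]

/-- The elements on which `φ` and `ψ` are intertwined by `x`. -/
def intertwined (x : A) (φ ψ : K →ₐ[ℂ] A) : Subalgebra ℂ K where
  carrier := {h | x * φ h = ψ h * x}
  mul_mem' {a b} ha hb := by
    simp only [Set.mem_setOf_eq, map_mul] at *
    rw [← mul_assoc, ha, mul_assoc, hb, mul_assoc]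
  add_mem' {a b} ha hb := by
    simp only [Set.mem_setOf_eq, map_add] at *
    rw [mul_add, add_mul, ha, hb]
  algebraMap_mem' c := by simp [Algebra.commutes]

theorem mem_intertwined {x : A} {φ ψ : K →ₐ[ℂ] A} {h : K} :
    h ∈ intertwined x φ ψ ↔ x * φ h = ψ h * x := Iff.rfl

theorem inverse_mem_intertwined {x : A} {φ ψ : K →ₐ[ℂ] A} {h k : K} (hk : h * k = 1)
    (hh : h ∈ intertwined x φ ψ) : k ∈ intertwined x φ ψ := by
  rw [mem_intertwined] at *
  have h1 : φ h * φ k = 1 := by rw [← map_mul, hk, map_one]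
  have h2 : ψ k * ψ h = 1 := by rw [← map_mul, mul_comm, hk, map_one]
  calc x * φ k = ψ k * ψ h * (x * φ k) := by rw [h2, one_mul]
    _ = ψ k * (x * φ h) * φ k := by rw [hh]; simp only [mul_assoc]
    _ = ψ k * x := by rw [mul_assoc, mul_assoc, h1, mul_one]

/-- The relations are imposed only for exponent `1`. Inverses of intertwined elements are
intertwined, and the other integer powers follow. -/
theorem exponential_mem_intertwined {x : A} {φ ψ : K →ₐ[ℂ] A} {p : ℤ → K}
    (hadd : ∀ s t, p (s + t) = p s * p t) (hzero : p 0 = 1) (h : p 1 ∈ intertwined x φ ψ) (t : ℤ) :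
    p t ∈ intertwined x φ ψ := by
  have hneg : p (-1) ∈ intertwined x φ ψ :=
    inverse_mem_intertwined (by rw [← hadd, add_neg_cancel, hzero]) h
  induction t using Int.induction_on with
  | zero => rw [hzero]; exact one_mem _
  | succ t ht => rw [hadd]; exact mul_mem ht h
  | pred t ht => rw [sub_eq_add_neg, hadd]; exact mul_mem ht hneg

variable {n : Type u} [Fintype n] [DecidableEq n] {ℓ : ℂ} {β : Matrix n n ℂ} {r : n → ℂ}

/-- The cross relations imply the relations with all elements of `U_q(β)`. -/
theorem CrossRelations.triangular {φ : Uq ℓ β →ₐ[ℂ] A} {E F : n → A}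
    (h : CrossRelations ℓ β r (fun i => φ (xi ℓ β i)) (fun i t => φ (expUp ℓ β i t))
      (fun i t => φ (expDown ℓ β i t)) E F) :
    TriangularRelations (shiftE ℓ β) (kappa ℓ β r) φ E F where
  e_map i a := by
    change a ∈ intertwined (E i) φ (φ.comp (shiftE ℓ β i).toAlgHom)
    induction a using Uq.induction with
    | hxi j =>
      have := h.e_xi i j
      rw [sub_eq_iff_eq_add'] at this
      rw [mem_intertwined, this]
      change _ = φ (shiftE ℓ β i (xi ℓ β j)) * E i
      rw [shiftE_xi]
      split_ifs <;> simp [add_mul]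
    | hup j t =>
      refine exponential_mem_intertwined (expUp_add j) (expUp_zero j) ?_ t
      rw [mem_intertwined, h.e_up i j]
      simp [shiftE_expUp]
    | hdown j t =>
      refine exponential_mem_intertwined (expDown_add j) (expDown_zero j) ?_ t
      rw [mem_intertwined, h.e_down i j]
      simp [shiftE_expDown]
    | hc c => exact algebraMap_mem _ c
    | hadd a b ha hb => exact add_mem ha hb
    | hmul a b ha hb => exact mul_mem ha hb
  map_f i a := by
    -- With `φ` and its translate exchanged, the relation for `F i` is again an intertwining
    -- relation, so its solutions form a subalgebra.
    suffices H : a ∈ intertwined (F i) (φ.comp (shiftE ℓ β i).toAlgHom) φ from H.symm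
    induction a using Uq.induction with
    | hxi j =>
      have := h.f_xi i j
      rw [sub_eq_iff_eq_add'] at this
      change F i * φ (shiftE ℓ β i (xi ℓ β j)) = _
      rw [shiftE_xi, map_add, mul_add, this]
      split_ifs <;> simp
    | hup j t =>
      refine exponential_mem_intertwined (expUp_add j) (expUp_zero j) ?_ t
      rw [mem_intertwined]
      simp [shiftE_expUp, h.f_up i j, qpow_neg, smul_smul, qpow_ne_zero]
    | hdown j t =>
      refine exponential_mem_intertwined (expDown_add j) (expDown_zero j) ?_ t
      rw [mem_intertwined]
      simp [shiftE_expDown, h.f_down i j, qpow_neg, smul_smul, qpow_ne_zero]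
    | hc c => exact algebraMap_mem _ c
    | hadd a b ha hb => exact add_mem ha hb
    | hmul a b ha hb => exact mul_mem ha hb
  e_f i j := by
    rw [← sub_eq_iff_eq_add', h.e_f i j, kappa]
    simp

/-- The relations without `ξ` imply the relations with all elements of `UqExp`. -/
theorem ExpRelations.triangular {φ : UqExp ℓ β →ₐ[ℂ] A} {E F : n → A}
    (h : ExpRelations ℓ β r (fun i t => φ (UqExp.up ℓ β i t))
      (fun i t => φ (UqExp.down ℓ β i t)) E F) :
    TriangularRelations (shiftExp ℓ β) (kappaExp ℓ β r) φ E F := by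
  -- Generation by exponentials is known inside `U_q(β)`; this transfers it to subalgebras of
  -- `UqExp` itself.
  have top : ∀ T : Subalgebra ℂ (UqExp ℓ β), (∀ i t, UqExp.up ℓ β i t ∈ T) →
      (∀ i t, UqExp.down ℓ β i t ∈ T) → ∀ a, a ∈ T := by
    intro T hup hdown
    suffices H : UqExp ℓ β ≤ T.map (UqExp ℓ β).val by
      rintro ⟨a, ha⟩
      obtain ⟨b, hb, hab⟩ := H ha
      rwa [show (⟨a, ha⟩ : UqExp ℓ β) = b from Subtype.ext hab.symm]
    refine Algebra.adjoin_le ?_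
    rintro _ (⟨i, t, rfl⟩ | ⟨i, t, rfl⟩)
    exacts [⟨_, hup i t, rfl⟩, ⟨_, hdown i t, rfl⟩]
  have up_add : ∀ i s t, UqExp.up ℓ β i (s + t) = UqExp.up ℓ β i s * UqExp.up ℓ β i t :=
    fun i s t => Subtype.ext (expUp_add i s t)
  have up_zero : ∀ i, UqExp.up ℓ β i 0 = 1 := fun i => Subtype.ext (expUp_zero i)
  have down_add : ∀ i s t, UqExp.down ℓ β i (s + t) = UqExp.down ℓ β i s * UqExp.down ℓ β i t :=
    fun i s t => Subtype.ext (expDown_add i s t)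
  have down_zero : ∀ i, UqExp.down ℓ β i 0 = 1 := fun i => Subtype.ext (expDown_zero i)
  have shift_up : ∀ i j, shiftExp ℓ β i (UqExp.up ℓ β j 1) =
      qpow ℓ (β j i) • UqExp.up ℓ β j 1 := fun i j =>
    Subtype.ext ((shiftE_expUp ℓ β i j 1).trans (by simp [UqExp.up]))
  have shift_down : ∀ i j, shiftExp ℓ β i (UqExp.down ℓ β j 1) =
      qpow ℓ (β i j) • UqExp.down ℓ β j 1 := fun i j =>
    Subtype.ext ((shiftE_expDown ℓ β i j 1).trans (by simp [UqExp.down]))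
  constructor
  · intro i
    refine top (intertwined (K := UqExp ℓ β) (E i) φ (φ.comp (shiftExp ℓ β i).toAlgHom)) (fun j t => ?_)
      fun j t => ?_
    · refine exponential_mem_intertwined (up_add j) (up_zero j) ?_ t
      rw [mem_intertwined, h.e_up i j]
      simp [shift_up]
    · refine exponential_mem_intertwined (down_add j) (down_zero j) ?_ t
      rw [mem_intertwined, h.e_down i j]
      simp [shift_down]
  · intro i a
    refine (top (intertwined (K := UqExp ℓ β) (F i) (φ.comp (shiftExp ℓ β i).toAlgHom) φ) (fun j t => ?_)
      (fun j t => ?_) a).symm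
    · refine exponential_mem_intertwined (up_add j) (up_zero j) ?_ t
      rw [mem_intertwined]
      simp [shift_up, h.f_up i j, qpow_neg, smul_smul, qpow_ne_zero]
    · refine exponential_mem_intertwined (down_add j) (down_zero j) ?_ t
      rw [mem_intertwined]
      simp [shift_down, h.f_down i j, qpow_neg, smul_smul, qpow_ne_zero]
  · intro i j
    have hκ : φ (kappaExp ℓ β r i) =
        (r i - (r i)⁻¹)⁻¹ • (φ (UqExp.up ℓ β i 1) - φ (UqExp.down ℓ β i (-1))) := by
      rw [kappaExp, map_smul]
      exact congrArg _ (map_sub φ _ _)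
    rw [← sub_eq_iff_eq_add', h.e_f i j, hκ]

/-- The cross relations are a special case of the relations with all elements of `U_q(β)`. -/
theorem TriangularRelations.cross {φ : Uq ℓ β →ₐ[ℂ] A} {E F : n → A}
    (h : TriangularRelations (shiftE ℓ β) (kappa ℓ β r) φ E F) :
    CrossRelations ℓ β r (fun i => φ (xi ℓ β i)) (fun i t => φ (expUp ℓ β i t))
      (fun i t => φ (expDown ℓ β i t)) E F where
  e_up i j := by simpa [shiftE_expUp] using h.e_map i (expUp ℓ β j 1)
  e_down i j := by simpa [shiftE_expDown] using h.e_map i (expDown ℓ β j 1)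
  f_up i j := by simp [h.map_f, shiftE_expUp, smul_smul, qpow_neg, qpow_ne_zero]
  f_down i j := by simp [h.map_f, shiftE_expDown, smul_smul, qpow_neg, qpow_ne_zero]
  e_f i j := by
    rw [h.e_f i j, kappa]
    simp
  e_xi i j := by
    rw [h.e_map, shiftE_xi]
    split_ifs <;> simp [add_mul]
  f_xi i j := by
    rw [h.map_f, shiftE_xi]
    split_ifs <;> simp [mul_add]

theorem TriangularRelations.restrict {φ : Uq ℓ β →ₐ[ℂ] A} {E F : n → A}
    (h : TriangularRelations (shiftE ℓ β) (kappa ℓ β r) φ E F) :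
    TriangularRelations (shiftExp ℓ β) (kappaExp ℓ β r) (φ.comp (UqExp ℓ β).val) E F where
  e_map i a := h.e_map i a
  map_f i a := h.map_f i a
  e_f i j := h.e_f i j

end Relations

end CStat

namespace CStat

open TensorProduct

/-! ### The Hopf algebra of the double-bosonisation -/

section Hopf

variable {n : Type u} [Fintype n] [DecidableEq n] (ℓ : ℂ) (β : Matrix n n ℂ) (r : n → ℂ)

/-- The algebra generated over `U_q(β)` by `e_i` and `f_i` with the cross relations. -/
abbrev FreeDouble : Type u := Presented (shiftE ℓ β) (kappa ℓ β r)

namespace FreeDouble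

/-- The generators `e_i`. -/
noncomputable abbrev e (i : n) : FreeDouble ℓ β r := Presented.e _ _ i

/-- The generators `f_i`. -/
noncomputable abbrev f (i : n) : FreeDouble ℓ β r := Presented.f _ _ i

/-- The inclusion of `U_q(β)`. -/
noncomputable abbrev of : Uq ℓ β →ₐ[ℂ] FreeDouble ℓ β r := Presented.of _ _

theorem relations :
    TriangularRelations (shiftE ℓ β) (kappa ℓ β r) (of ℓ β r) (e ℓ β r) (f ℓ β r) :=
  Presented.relations _ _

variable {ℓ β r} in
theorem algHom_ext {A : Type*} [Semiring A] [Algebra ℂ A] {g h : FreeDouble ℓ β r →ₐ[ℂ] A}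
    (hxi : ∀ i, g (of ℓ β r (xi ℓ β i)) = h (of ℓ β r (xi ℓ β i)))
    (hup : ∀ i t, g (of ℓ β r (expUp ℓ β i t)) = h (of ℓ β r (expUp ℓ β i t)))
    (hdown : ∀ i t, g (of ℓ β r (expDown ℓ β i t)) = h (of ℓ β r (expDown ℓ β i t)))
    (he : ∀ i, g (e ℓ β r i) = h (e ℓ β r i)) (hf : ∀ i, g (f ℓ β r i) = h (f ℓ β r i)) :
    g = h := by
  refine Presented.algHom_ext (fun a => ?_) he hf
  have : g.comp (of ℓ β r) = h.comp (of ℓ β r) := Uq.algHom_ext hxi hup hdown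
  exact congr($this a)

/-- The coproduct evaluates `a` at a sum of two points, and a translation of the sum may be absorbed
in either summand. -/
theorem comulUq_shiftE_left (i : n) (a : Uq ℓ β) : comulUq (shiftE ℓ β i a) =
    Algebra.TensorProduct.map (shiftE ℓ β i).toAlgHom (AlgHom.id ℂ _) (comulUq a) := by
  have key : ∀ (z y) (t : Uq ℓ β ⊗[ℂ] Uq ℓ β),
      evalAt₂ z y (Algebra.TensorProduct.map (shiftE ℓ β i).toAlgHom (AlgHom.id ℂ _) t) =
        evalAt₂ (toPt (degE i) + z) y t := by
    intro z y t
    induction t using TensorProduct.induction_on with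
    | zero => simp
    | add a b ha hb => simp only [map_add, ha, hb]
    | tmul a b => simp [shiftE, shift_apply]
  refine evalAt₂_ext fun z y => ?_
  rw [key, evalAt₂_comulUq, evalAt₂_comulUq, shiftE, shift_apply, evalAt_shiftHom, add_assoc]

theorem comulUq_shiftE_right (i : n) (a : Uq ℓ β) : comulUq (shiftE ℓ β i a) =
    Algebra.TensorProduct.map (AlgHom.id ℂ _) (shiftE ℓ β i).toAlgHom (comulUq a) := by
  have key : ∀ (z y) (t : Uq ℓ β ⊗[ℂ] Uq ℓ β),
      evalAt₂ z y (Algebra.TensorProduct.map (AlgHom.id ℂ _) (shiftE ℓ β i).toAlgHom t) =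
        evalAt₂ z (toPt (degE i) + y) t := by
    intro z y t
    induction t using TensorProduct.induction_on with
    | zero => simp
    | add a b ha hb => simp only [map_add, ha, hb]
    | tmul a b => simp [shiftE, shift_apply]
  refine evalAt₂_ext fun z y => ?_
  rw [key, evalAt₂_comulUq, evalAt₂_comulUq, shiftE, shift_apply, evalAt_shiftHom, add_left_comm]

/-- The coproduct on `U_q(β)` with values in the tensor square. -/
noncomputable def comulOf : Uq ℓ β →ₐ[ℂ] FreeDouble ℓ β r ⊗[ℂ] FreeDouble ℓ β r :=
  (Algebra.TensorProduct.map (of ℓ β r) (of ℓ β r)).comp comulUq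

theorem of_mul_comm (a b : Uq ℓ β) : of ℓ β r a * of ℓ β r b = of ℓ β r b * of ℓ β r a := by
  rw [← map_mul, ← map_mul, mul_comm]

/-- Each summand of the coproduct of `e_i` or `f_i` translates one leg of the coproduct of `h`, and
translating either leg gives the coproduct of the translate. In the commutator of `e_i` and `f_j`
the mixed terms cancel. -/
theorem comul_relations : TriangularRelations (shiftE ℓ β) (kappa ℓ β r) (comulOf ℓ β r)
    (fun i => e ℓ β r i ⊗ₜ[ℂ] of ℓ β r (expUp ℓ β i 1) + 1 ⊗ₜ[ℂ] e ℓ β r i)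
    (fun i => f ℓ β r i ⊗ₜ[ℂ] 1 + of ℓ β r (expDown ℓ β i (-1)) ⊗ₜ[ℂ] f ℓ β r i) where
  e_map i h := by
    have h1 : ∀ t : Uq ℓ β ⊗[ℂ] Uq ℓ β, (e ℓ β r i ⊗ₜ[ℂ] of ℓ β r (expUp ℓ β i 1)) *
        Algebra.TensorProduct.map (of ℓ β r) (of ℓ β r) t =
        Algebra.TensorProduct.map (of ℓ β r) (of ℓ β r)
          (Algebra.TensorProduct.map (shiftE ℓ β i).toAlgHom (AlgHom.id ℂ _) t) *
        (e ℓ β r i ⊗ₜ[ℂ] of ℓ β r (expUp ℓ β i 1)) := by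
      intro t
      induction t using TensorProduct.induction_on with
      | zero => simp
      | add a b ha hb => simp only [map_add, mul_add, add_mul, ha, hb]
      | tmul a b =>
        simp only [Algebra.TensorProduct.map_tmul, Algebra.TensorProduct.tmul_mul_tmul,
          AlgHom.id_apply]
        rw [(relations ℓ β r).e_map, of_mul_comm]
        rfl
    have h2 : ∀ t : Uq ℓ β ⊗[ℂ] Uq ℓ β, ((1 : FreeDouble ℓ β r) ⊗ₜ[ℂ] e ℓ β r i) *
        Algebra.TensorProduct.map (of ℓ β r) (of ℓ β r) t =
        Algebra.TensorProduct.map (of ℓ β r) (of ℓ β r)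
          (Algebra.TensorProduct.map (AlgHom.id ℂ _) (shiftE ℓ β i).toAlgHom t) *
        ((1 : FreeDouble ℓ β r) ⊗ₜ[ℂ] e ℓ β r i) := by
      intro t
      induction t using TensorProduct.induction_on with
      | zero => simp
      | add a b ha hb => simp only [map_add, mul_add, add_mul, ha, hb]
      | tmul a b =>
        simp only [Algebra.TensorProduct.map_tmul, Algebra.TensorProduct.tmul_mul_tmul,
          AlgHom.id_apply, one_mul, mul_one]
        rw [(relations ℓ β r).e_map]
        rfl
    simp only [comulOf, AlgHom.comp_apply]
    rw [add_mul, h1, h2, ← comulUq_shiftE_left, ← comulUq_shiftE_right, mul_add]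
  map_f i h := by
    have h1 : ∀ t : Uq ℓ β ⊗[ℂ] Uq ℓ β, Algebra.TensorProduct.map (of ℓ β r) (of ℓ β r) t *
        (f ℓ β r i ⊗ₜ[ℂ] (1 : FreeDouble ℓ β r)) = (f ℓ β r i ⊗ₜ[ℂ] (1 : FreeDouble ℓ β r)) *
        Algebra.TensorProduct.map (of ℓ β r) (of ℓ β r)
          (Algebra.TensorProduct.map (shiftE ℓ β i).toAlgHom (AlgHom.id ℂ _) t) := by
      intro t
      induction t using TensorProduct.induction_on with
      | zero => simp
      | add a b ha hb => simp only [map_add, mul_add, add_mul, ha, hb]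
      | tmul a b =>
        simp only [Algebra.TensorProduct.map_tmul, Algebra.TensorProduct.tmul_mul_tmul,
          AlgHom.id_apply, one_mul, mul_one]
        rw [(relations ℓ β r).map_f]
        rfl
    have h2 : ∀ t : Uq ℓ β ⊗[ℂ] Uq ℓ β, Algebra.TensorProduct.map (of ℓ β r) (of ℓ β r) t *
        (of ℓ β r (expDown ℓ β i (-1)) ⊗ₜ[ℂ] f ℓ β r i) =
        (of ℓ β r (expDown ℓ β i (-1)) ⊗ₜ[ℂ] f ℓ β r i) *
        Algebra.TensorProduct.map (of ℓ β r) (of ℓ β r)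
          (Algebra.TensorProduct.map (AlgHom.id ℂ _) (shiftE ℓ β i).toAlgHom t) := by
      intro t
      induction t using TensorProduct.induction_on with
      | zero => simp
      | add a b ha hb => simp only [map_add, mul_add, add_mul, ha, hb]
      | tmul a b =>
        simp only [Algebra.TensorProduct.map_tmul, Algebra.TensorProduct.tmul_mul_tmul,
          AlgHom.id_apply]
        rw [(relations ℓ β r).map_f, of_mul_comm]
        rfl
    simp only [comulOf, AlgHom.comp_apply]
    rw [mul_add, h1, h2, ← comulUq_shiftE_left, ← comulUq_shiftE_right, add_mul]
  e_f i j := by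
    have hef := (relations ℓ β r).e_f i j
    -- The scalars of `h1` and `h2` are inverse to each other, so the mixed term `q^{-H_j} e_i ⊗ f_j
    -- q^{H^i}` occurs with coefficient one in both orders.
    have h1 : e ℓ β r i * of ℓ β r (expDown ℓ β j (-1)) =
        qpow ℓ (-β i j) • (of ℓ β r (expDown ℓ β j (-1)) * e ℓ β r i) := by
      rw [(relations ℓ β r).e_map, shiftE_expDown]; simp
    have h2 : of ℓ β r (expUp ℓ β i 1) * f ℓ β r j =
        qpow ℓ (β i j) • (f ℓ β r j * of ℓ β r (expUp ℓ β i 1)) := by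
      rw [(relations ℓ β r).map_f, shiftE_expUp]; simp
    -- `κ_i` is a multiple of a difference of group-like elements, and the right-hand side
    -- telescopes.
    have h3 : comulOf ℓ β r (kappa ℓ β r i) =
        of ℓ β r (kappa ℓ β r i) ⊗ₜ[ℂ] of ℓ β r (expUp ℓ β i 1) +
          of ℓ β r (expDown ℓ β i (-1)) ⊗ₜ[ℂ] of ℓ β r (kappa ℓ β r i) := by
      simp only [kappa, comulOf, map_smul, map_sub, AlgHom.comp_apply, comulUq_expUp,
        comulUq_expDown, Algebra.TensorProduct.map_tmul, ← smul_tmul', tmul_smul, ← smul_add,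
        sub_tmul, tmul_sub]
      congr 1
      abel
    simp only [mul_add, add_mul, Algebra.TensorProduct.tmul_mul_tmul, one_mul, mul_one, hef, h1,
      h2, ← smul_tmul', tmul_smul, smul_smul, ← qpow_add, neg_add_cancel, add_neg_cancel,
      qpow_zero, one_smul, add_tmul, tmul_add]
    split_ifs with hij
    · subst hij
      rw [h3]
      abel
    · simp only [zero_tmul, tmul_zero]
      abel

theorem counit_relations : TriangularRelations (shiftE ℓ β) (kappa ℓ β r) (evalAt ℓ β 0)
    (fun _ => (0 : ℂ)) (fun _ => 0) where
  e_map i h := by simp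
  map_f i h := by simp
  e_f i j := by simp [kappa]

/-- The coproduct of the double-bosonisation. -/
noncomputable def comulHom : FreeDouble ℓ β r →ₐ[ℂ] FreeDouble ℓ β r ⊗[ℂ] FreeDouble ℓ β r :=
  Presented.lift (comul_relations ℓ β r)

/-- The counit of the double-bosonisation. -/
noncomputable def counitHom : FreeDouble ℓ β r →ₐ[ℂ] ℂ := Presented.lift (counit_relations ℓ β r)

theorem comulHom_e (i : n) : comulHom ℓ β r (e ℓ β r i) =
    e ℓ β r i ⊗ₜ[ℂ] of ℓ β r (expUp ℓ β i 1) + 1 ⊗ₜ[ℂ] e ℓ β r i := Presented.lift_e _ _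

theorem comulHom_f (i : n) : comulHom ℓ β r (f ℓ β r i) =
    f ℓ β r i ⊗ₜ[ℂ] 1 + of ℓ β r (expDown ℓ β i (-1)) ⊗ₜ[ℂ] f ℓ β r i := Presented.lift_f _ _

theorem comulHom_of (h : Uq ℓ β) : comulHom ℓ β r (of ℓ β r h) =
    Algebra.TensorProduct.map (of ℓ β r) (of ℓ β r) (comulUq h) := Presented.lift_of _ _

theorem counitHom_e (i : n) : counitHom ℓ β r (e ℓ β r i) = 0 := Presented.lift_e _ _

theorem counitHom_f (i : n) : counitHom ℓ β r (f ℓ β r i) = 0 := Presented.lift_f _ _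

theorem counitHom_of (h : Uq ℓ β) : counitHom ℓ β r (of ℓ β r h) = evalAt ℓ β 0 h :=
  Presented.lift_of _ _

noncomputable instance : Bialgebra ℂ (FreeDouble ℓ β r) :=
  Bialgebra.ofAlgHom (comulHom ℓ β r) (counitHom ℓ β r)
    (by
      apply algHom_ext
      · intro i
        simp [comulHom_of, comulUq_xi, add_tmul, tmul_add, Algebra.TensorProduct.one_def,
          add_assoc]
      · intro i t
        simp [comulHom_of, comulUq_expUp]
      · intro i t
        simp [comulHom_of, comulUq_expDown]
      · intro i
        simp [comulHom_of, comulHom_e, comulUq_expUp, add_tmul, tmul_add,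
          Algebra.TensorProduct.one_def, add_assoc]
      · intro i
        simp [comulHom_of, comulHom_f, comulUq_expDown, add_tmul, tmul_add,
          Algebra.TensorProduct.one_def, add_assoc])
    (by
      apply algHom_ext
      · intro i; simp [comulHom_of, counitHom_of, comulUq_xi]
      · intro i t; simp [comulHom_of, counitHom_of, comulUq_expUp, qpow_zero]
      · intro i t; simp [comulHom_of, counitHom_of, comulUq_expDown, qpow_zero]
      · intro i; simp [comulHom_e, counitHom_e]
      · intro i; simp [comulHom_f, counitHom_f, counitHom_of, qpow_zero])
    (by
      apply algHom_ext
      · intro i; simp [comulHom_of, counitHom_of, comulUq_xi]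
      · intro i t; simp [comulHom_of, counitHom_of, comulUq_expUp, qpow_zero]
      · intro i t; simp [comulHom_of, counitHom_of, comulUq_expDown, qpow_zero]
      · intro i; simp [comulHom_e, counitHom_e, counitHom_of, qpow_zero]
      · intro i; simp [comulHom_f, counitHom_f])

/-- The antipode reflects the variables, which turns a translation into its inverse. -/
theorem shiftE_antipode (i : n) (a : Uq ℓ β) :
    shiftE ℓ β i (antipodeUq (shiftE ℓ β i a)) = antipodeUq a :=
  evalAt_ext fun z => by simp [shiftE, shift_apply]

/-- The antipode on `U_q(β)`, with values in the opposite algebra. -/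
noncomputable def antipodeOf : Uq ℓ β →ₐ[ℂ] (FreeDouble ℓ β r)ᵐᵒᵖ :=
  ((of ℓ β r).comp antipodeUq).toOpposite fun _ _ => of_mul_comm ℓ β r _ _

theorem antipodeOf_apply (a : Uq ℓ β) :
    antipodeOf ℓ β r a = MulOpposite.op (of ℓ β r (antipodeUq a)) := rfl

theorem antipodeUq_expUp (i : n) (t : ℤ) :
    antipodeUq (expUp ℓ β i t) = expUp ℓ β i (-t) := evalAt_ext fun z => by simp

theorem antipodeUq_expDown (i : n) (t : ℤ) :
    antipodeUq (expDown ℓ β i t) = expDown ℓ β i (-t) := evalAt_ext fun z => by simp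

/-- An antipode reverses products, hence the opposite algebra. Its values on `e_i` and `f_i` are
forced by the antipode axiom applied to their coproducts. -/
theorem antipode_relations : TriangularRelations (shiftE ℓ β) (kappa ℓ β r) (antipodeOf ℓ β r)
    (fun i => MulOpposite.op (-(e ℓ β r i * of ℓ β r (expUp ℓ β i (-1)))))
    (fun i => MulOpposite.op (-(of ℓ β r (expDown ℓ β i 1) * f ℓ β r i))) where
  e_map i h := by
    rw [antipodeOf_apply, antipodeOf_apply, ← MulOpposite.op_mul, ← MulOpposite.op_mul]
    congr 1
    rw [neg_mul, mul_neg, mul_assoc, of_mul_comm, ← mul_assoc, ← mul_assoc,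
      (relations ℓ β r).e_map, shiftE_antipode]
  map_f i h := by
    rw [antipodeOf_apply, antipodeOf_apply, ← MulOpposite.op_mul, ← MulOpposite.op_mul]
    congr 1
    rw [neg_mul, mul_neg, ← mul_assoc, of_mul_comm, mul_assoc, mul_assoc,
      (relations ℓ β r).map_f i (antipodeUq _), shiftE_antipode]
  e_f i j := by
    have hef := (relations ℓ β r).e_f i j
    have h1 : of ℓ β r (expUp ℓ β i (-1)) * of ℓ β r (expDown ℓ β j 1) * f ℓ β r j =
        (qpow ℓ (-β i j) * qpow ℓ (β j j)) •
          (f ℓ β r j * of ℓ β r (expUp ℓ β i (-1)) * of ℓ β r (expDown ℓ β j 1)) := by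
      rw [← map_mul, (relations ℓ β r).map_f, map_mul, shiftE_expUp, shiftE_expDown,
        smul_mul_smul_comm, map_smul, map_mul, mul_smul_comm, ← mul_assoc]
      simp
    have h2 : of ℓ β r (expDown ℓ β j 1) * f ℓ β r j =
        qpow ℓ (β j j) • (f ℓ β r j * of ℓ β r (expDown ℓ β j 1)) := by
      rw [(relations ℓ β r).map_f, shiftE_expDown]; simp
    have h3 : of ℓ β r (expDown ℓ β j 1) * e ℓ β r i =
        qpow ℓ (-β i j) • (e ℓ β r i * of ℓ β r (expDown ℓ β j 1)) := by
      rw [(relations ℓ β r).e_map, shiftE_expDown]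
      simp [smul_smul, ← qpow_add, qpow_zero]
    have h4 : (of ℓ β r (expDown ℓ β j 1) * f ℓ β r j) *
        (e ℓ β r i * of ℓ β r (expUp ℓ β i (-1))) = (qpow ℓ (-β i j) * qpow ℓ (β j j)) •
          (f ℓ β r j * e ℓ β r i * of ℓ β r (expUp ℓ β i (-1)) * of ℓ β r (expDown ℓ β j 1)) := by
      rw [h2, smul_mul_assoc, mul_assoc (f ℓ β r j), ← mul_assoc (of ℓ β r (expDown ℓ β j 1)), h3,
        smul_mul_assoc, mul_smul_comm, smul_smul, mul_comm (qpow ℓ (β j j)),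
        mul_assoc (e ℓ β r i), of_mul_comm]
      simp only [mul_assoc]
    have h5 : (e ℓ β r i * of ℓ β r (expUp ℓ β i (-1))) *
        (of ℓ β r (expDown ℓ β j 1) * f ℓ β r j) = (qpow ℓ (-β i j) * qpow ℓ (β j j)) •
          ((e ℓ β r i * f ℓ β r j) * of ℓ β r (expUp ℓ β i (-1)) *
            of ℓ β r (expDown ℓ β j 1)) := by
      rw [mul_assoc, ← mul_assoc (of ℓ β r (expUp ℓ β i (-1))), h1, mul_smul_comm]
      simp only [mul_assoc]
    -- Both orders carry the same scalar, so the relation between `e_i` and `f_j` can be inserted.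
    -- For `i = j` the remaining claim is `κ_i q^{-H^i} q^{H_i} + S(κ_i) = 0`.
    rw [← MulOpposite.op_mul, ← MulOpposite.op_mul, neg_mul_neg, neg_mul_neg, h4, h5, hef]
    split_ifs with hij
    · subst hij
      rw [antipodeOf_apply, ← MulOpposite.op_add]
      congr 1
      rw [add_mul, add_mul, smul_add, add_assoc, ← qpow_add, neg_add_cancel, qpow_zero, one_smul,
        one_smul, ← map_mul, ← map_mul, ← map_add, left_eq_add]
      convert map_zero (of ℓ β r)
      simp only [kappa, map_smul, map_sub, antipodeUq_expUp, antipodeUq_expDown, smul_mul_assoc,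
        ← smul_add, sub_mul, ← expUp_add, mul_assoc (expDown ℓ β i (-1)),
        mul_comm (expUp ℓ β i (-1)), neg_neg]
      rw [← mul_assoc, ← expDown_add]
      simp [expUp_zero, expDown_zero]
    · simp

/-- The antipode of the double-bosonisation, with values in the opposite algebra. -/
noncomputable def antipodeHom : FreeDouble ℓ β r →ₐ[ℂ] (FreeDouble ℓ β r)ᵐᵒᵖ :=
  Presented.lift (antipode_relations ℓ β r)

/-- The antipode of the double-bosonisation. -/
noncomputable def antipodeMap : FreeDouble ℓ β r →ₗ[ℂ] FreeDouble ℓ β r :=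
  (MulOpposite.opLinearEquiv ℂ).symm.toLinearMap ∘ₗ (antipodeHom ℓ β r).toLinearMap

theorem antipodeMap_e (i : n) : antipodeMap ℓ β r (e ℓ β r i) =
    -(e ℓ β r i * of ℓ β r (expUp ℓ β i (-1))) := by
  simp [antipodeMap, antipodeHom]

theorem antipodeMap_f (i : n) : antipodeMap ℓ β r (f ℓ β r i) =
    -(of ℓ β r (expDown ℓ β i 1) * f ℓ β r i) := by
  simp [antipodeMap, antipodeHom]

theorem antipodeMap_of (h : Uq ℓ β) : antipodeMap ℓ β r (of ℓ β r h) =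
    of ℓ β r (antipodeUq h) := by
  simp [antipodeMap, antipodeHom, antipodeOf_apply]

theorem antipodeMap_mul (a b : FreeDouble ℓ β r) : antipodeMap ℓ β r (a * b) =
    antipodeMap ℓ β r b * antipodeMap ℓ β r a := by
  simp [antipodeMap]

theorem antipodeMap_one : antipodeMap ℓ β r 1 = 1 := by simp [antipodeMap]

theorem antipode_left (a : FreeDouble ℓ β r) : LinearMap.mul' ℂ _
    ((antipodeMap ℓ β r).rTensor _ (comulHom ℓ β r a)) = algebraMap ℂ _ (counitHom ℓ β r a) := by
  induction a using Presented.induction with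
  | of h =>
    have key : ∀ t : Uq ℓ β ⊗[ℂ] Uq ℓ β, LinearMap.mul' ℂ _ ((antipodeMap ℓ β r).rTensor _
        (Algebra.TensorProduct.map (of ℓ β r) (of ℓ β r) t)) =
        of ℓ β r (LinearMap.mul' ℂ _ ((HopfAlgebra.antipode ℂ).rTensor _ t)) := by
      intro t
      induction t using TensorProduct.induction_on with
      | zero => simp
      | add a b ha hb => simp only [map_add, ha, hb]
      | tmul a b =>
        simp only [Algebra.TensorProduct.map_tmul, LinearMap.rTensor_tmul, LinearMap.mul'_apply,
          antipodeMap_of, map_mul]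
        rfl
    change LinearMap.mul' ℂ _ ((antipodeMap ℓ β r).rTensor _
      (comulHom ℓ β r (of ℓ β r h))) = algebraMap ℂ _ (counitHom ℓ β r (of ℓ β r h))
    rw [comulHom_of, key, counitHom_of]
    refine (congrArg _ (HopfAlgebra.mul_antipode_rTensor_comul_apply (R := ℂ) h)).trans ?_
    exact (of ℓ β r).commutes _
  | e i =>
    change LinearMap.mul' ℂ _ ((antipodeMap ℓ β r).rTensor _
      (comulHom ℓ β r (e ℓ β r i))) = algebraMap ℂ _ (counitHom ℓ β r (e ℓ β r i))
    simp [comulHom_e, counitHom_e, antipodeMap_e, antipodeMap_one, mul_assoc, ← map_mul,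
      ← expUp_add, expUp_zero]
  | f i =>
    change LinearMap.mul' ℂ _ ((antipodeMap ℓ β r).rTensor _
      (comulHom ℓ β r (f ℓ β r i))) = algebraMap ℂ _ (counitHom ℓ β r (f ℓ β r i))
    simp [comulHom_f, counitHom_f, antipodeMap_f, antipodeMap_of, antipodeUq_expDown]
  | add a b ha hb => simp only [map_add, ha, hb]
  | mul a b ha hb =>
    -- Anti-multiplicativity puts `S(a₁) a₂` in the middle of the product, where it is the scalar
    -- `ε(a)`. The axiom therefore passes from factors to products.
    have key : ∀ t, LinearMap.mul' ℂ _ ((antipodeMap ℓ β r).rTensor _ (comulHom ℓ β r a * t)) =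
        counitHom ℓ β r a • LinearMap.mul' ℂ _ ((antipodeMap ℓ β r).rTensor _ t) := by
      intro t
      induction t using TensorProduct.induction_on with
      | zero => simp
      | add a b ha hb => simp only [map_add, mul_add, smul_add, ha, hb]
      | tmul x y =>
        have h1 : ∀ s, LinearMap.mul' ℂ _ ((antipodeMap ℓ β r).rTensor _ (s * x ⊗ₜ[ℂ] y)) =
            antipodeMap ℓ β r x * LinearMap.mul' ℂ _ ((antipodeMap ℓ β r).rTensor _ s) * y := by
          intro s
          induction s using TensorProduct.induction_on with
          | zero => simp
          | add a b ha hb => simp only [map_add, mul_add, add_mul, ha, hb]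
          | tmul a b => simp [antipodeMap_mul, mul_assoc]
        rw [h1, ha, ← Algebra.commutes, mul_assoc, ← Algebra.smul_def]
        simp
    rw [map_mul, key, hb, map_mul, map_mul, Algebra.smul_def]

theorem antipode_right (a : FreeDouble ℓ β r) : LinearMap.mul' ℂ _
    ((antipodeMap ℓ β r).lTensor _ (comulHom ℓ β r a)) = algebraMap ℂ _ (counitHom ℓ β r a) := by
  induction a using Presented.induction with
  | of h =>
    have key : ∀ t : Uq ℓ β ⊗[ℂ] Uq ℓ β, LinearMap.mul' ℂ _ ((antipodeMap ℓ β r).lTensor _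
        (Algebra.TensorProduct.map (of ℓ β r) (of ℓ β r) t)) =
        of ℓ β r (LinearMap.mul' ℂ _ ((HopfAlgebra.antipode ℂ).lTensor _ t)) := by
      intro t
      induction t using TensorProduct.induction_on with
      | zero => simp
      | add a b ha hb => simp only [map_add, ha, hb]
      | tmul a b =>
        simp only [Algebra.TensorProduct.map_tmul, LinearMap.lTensor_tmul, LinearMap.mul'_apply,
          antipodeMap_of, map_mul]
        rfl
    change LinearMap.mul' ℂ _ ((antipodeMap ℓ β r).lTensor _
      (comulHom ℓ β r (of ℓ β r h))) = algebraMap ℂ _ (counitHom ℓ β r (of ℓ β r h))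
    rw [comulHom_of, key, counitHom_of]
    refine (congrArg _ (HopfAlgebra.mul_antipode_lTensor_comul_apply (R := ℂ) h)).trans ?_
    exact (of ℓ β r).commutes _
  | e i =>
    change LinearMap.mul' ℂ _ ((antipodeMap ℓ β r).lTensor _
      (comulHom ℓ β r (e ℓ β r i))) = algebraMap ℂ _ (counitHom ℓ β r (e ℓ β r i))
    simp [comulHom_e, counitHom_e, antipodeMap_e, antipodeMap_of, antipodeUq_expUp]
  | f i =>
    change LinearMap.mul' ℂ _ ((antipodeMap ℓ β r).lTensor _
      (comulHom ℓ β r (f ℓ β r i))) = algebraMap ℂ _ (counitHom ℓ β r (f ℓ β r i))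
    simp [comulHom_f, counitHom_f, antipodeMap_f, antipodeMap_one, ← mul_assoc, ← map_mul,
      ← expDown_add, expDown_zero]
  | add a b ha hb => simp only [map_add, ha, hb]
  | mul a b ha hb =>
    have key : ∀ s, LinearMap.mul' ℂ _ ((antipodeMap ℓ β r).lTensor _ (s * comulHom ℓ β r b)) =
        counitHom ℓ β r b • LinearMap.mul' ℂ _ ((antipodeMap ℓ β r).lTensor _ s) := by
      intro s
      induction s using TensorProduct.induction_on with
      | zero => simp
      | add a b ha hb => simp only [map_add, add_mul, smul_add, ha, hb]
      | tmul x y =>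
        have h1 : ∀ t, LinearMap.mul' ℂ _ ((antipodeMap ℓ β r).lTensor _ (x ⊗ₜ[ℂ] y * t)) =
            x * LinearMap.mul' ℂ _ ((antipodeMap ℓ β r).lTensor _ t) * antipodeMap ℓ β r y := by
          intro t
          induction t using TensorProduct.induction_on with
          | zero => simp
          | add a b ha hb => simp only [map_add, mul_add, add_mul, ha, hb]
          | tmul a b => simp [antipodeMap_mul, mul_assoc]
        rw [h1, hb, ← Algebra.commutes, mul_assoc, ← Algebra.smul_def]
        simp
    rw [map_mul, key, ha, map_mul, mul_comm (counitHom ℓ β r a), map_mul, Algebra.smul_def]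

noncomputable instance : HopfAlgebra ℂ (FreeDouble ℓ β r) where
  antipode := antipodeMap ℓ β r
  mul_antipode_rTensor_comul := LinearMap.ext (antipode_left ℓ β r)
  mul_antipode_lTensor_comul := LinearMap.ext (antipode_right ℓ β r)

end FreeDouble

end Hopf

end CStat

namespace CStat

open TensorProduct

/-! ### Existence of the double-bosonisation -/

/-! ### The legs of `R` and the cross relations in a fixed degree -/

section Degrees

variable {n : Type u} [Fintype n] {ℓ : ℂ} {β : Matrix n n ℂ}

variable (ℓ β) in
theorem RFst_add (d d' : n → ℤ) : RFst ℓ β (d + d') = RFst ℓ β d * RFst ℓ β d' := by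
  simp [RFst, expUp_add, Finset.prod_mul_distrib]

variable (ℓ β) in
theorem RSnd_add (d d' : n → ℤ) : RSnd ℓ β (d + d') = RSnd ℓ β d * RSnd ℓ β d' := by
  simp [RSnd, expDown_add, Finset.prod_mul_distrib]

variable (ℓ β) in
theorem RFst_zero : RFst ℓ β 0 = 1 := by simp [RFst, expUp_zero]

variable (ℓ β) in
theorem RSnd_zero : RSnd ℓ β 0 = 1 := by simp [RSnd, expDown_zero]

theorem mul_map_act_right {B D : Type*} [Ring B] [Algebra ℂ B] (𝓑 : (n → ℤ) → Submodule ℂ B)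
    [GradedAlgebra 𝓑] [Ring D] [Algebra ℂ D] (iH : Uq ℓ β →ₗ[ℂ] D) (iB : B →ₗ[ℂ] D)
    {d : n → ℤ} {b : B} (hb : b ∈ 𝓑 d) (t : Uq ℓ β ⊗[ℂ] Uq ℓ β) :
    LinearMap.mul' ℂ D (map iH (iB ∘ₗ (act ℓ β 𝓑).flip b) t) =
      iH (evalRight (toPt d) t) * iB b := by
  induction t using TensorProduct.induction_on with
  | zero => simp
  | add x y hx hy => simp only [map_add, add_mul, hx, hy]
  | tmul x y => simp [act_of_mem ℓ β 𝓑 _ hb]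

theorem mul_map_act_left {C D : Type*} [Ring C] [Algebra ℂ C] (𝓒 : (n → ℤ) → Submodule ℂ C)
    [GradedAlgebra 𝓒] [Ring D] [Algebra ℂ D] (iH : Uq ℓ β →ₗ[ℂ] D) (iC : C →ₗ[ℂ] D)
    {d : n → ℤ} {c : C} (hc : c ∈ 𝓒 d) (t : Uq ℓ β ⊗[ℂ] Uq ℓ β) :
    LinearMap.mul' ℂ D (map iH (iC ∘ₗ (act ℓ β 𝓒).flip c) (TensorProduct.comm ℂ _ _ t)) =
      iH (evalLeft (toPt d) t) * iC c := by
  induction t using TensorProduct.induction_on with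
  | zero => rw [LinearEquiv.map_zero, LinearMap.map_zero, LinearMap.map_zero, map_zero (evalLeft _),
      map_zero iH, zero_mul]
  | add x y hx hy => simp only [map_add, add_mul, hx, hy]
  | tmul x y => simp [act_of_mem ℓ β 𝓒 _ hc]

/-- In degree `d` the action evaluates one leg of the coproduct of `h` at `d`, and the other leg is
then the translate of `h`. The relation thus becomes a translation rule in each degree. -/
theorem cross_right_of_homogeneous {B D : Type*} [Ring B] [Algebra ℂ B]
    (𝓑 : (n → ℤ) → Submodule ℂ B) [GradedAlgebra 𝓑] [Ring D] [Algebra ℂ D] (iH : Uq ℓ β →ₗ[ℂ] D)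
    (iB : B →ₗ[ℂ] D) (h : Uq ℓ β)
    (H : ∀ d, ∀ b ∈ 𝓑 d, iB b * iH h = iH (shift ℓ β d h) * iB b) (b : B) :
    iB b * iH h = LinearMap.mul' ℂ D
      (map iH (iB ∘ₗ (act ℓ β 𝓑).flip b) (Coalgebra.comul h)) := by
  induction b using DirectSum.Decomposition.inductionOn 𝓑 with
  | zero => simp
  | homogeneous b =>
    rw [mul_map_act_right 𝓑 iH iB b.2, evalRight_comul]
    exact H _ _ b.2
  | add x y hx hy =>
    rw [map_add, add_mul, hx, hy, map_add, LinearMap.comp_add, map_add_right,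
      LinearMap.add_apply, map_add]

theorem cross_left_of_homogeneous {C D : Type*} [Ring C] [Algebra ℂ C]
    (𝓒 : (n → ℤ) → Submodule ℂ C) [GradedAlgebra 𝓒] [Ring D] [Algebra ℂ D] (iH : Uq ℓ β →ₗ[ℂ] D)
    (iC : C →ₗ[ℂ] D) (h : Uq ℓ β)
    (H : ∀ d, ∀ c ∈ 𝓒 d, iC c * iH h = iH (shift ℓ β d h) * iC c) (c : C) :
    iC c * iH h = LinearMap.mul' ℂ D
      (map iH (iC ∘ₗ (act ℓ β 𝓒).flip c) (TensorProduct.comm ℂ _ _ (Coalgebra.comul h))) := by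
  induction c using DirectSum.Decomposition.inductionOn 𝓒 with
  | zero => simp
  | homogeneous c =>
    rw [mul_map_act_left 𝓒 iH iC c.2, evalLeft_comul]
    exact H _ _ c.2
  | add x y hx hy =>
    rw [map_add, add_mul, hx, hy, map_add, LinearMap.comp_add, map_add_right,
      LinearMap.add_apply, map_add]

theorem shift_expDown (d : n → ℤ) (i : n) (t : ℤ) : shift ℓ β d (expDown ℓ β i t) =
    qpow ℓ (t * ∑ j, d j * β j i) • expDown ℓ β i t := shiftHom_expDown _ i t

variable [DecidableEq n]

theorem charL_degE (i : n) (d : n → ℤ) :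
    charL ℓ β (degE i) d = qpow ℓ (∑ j, d j * β j i) := by
  rw [charL_apply]
  congr 1
  refine Finset.sum_congr rfl fun j _ => ?_
  rw [Finset.sum_eq_single i] <;> simp +contextual [degE, mul_comm]

theorem charL_degF_eq (i : n) (d : n → ℤ) :
    charL ℓ β (degF i) d = qpow ℓ (-∑ j, d j * β j i) := by
  rw [charL_degF, charL_degE]
  simp

theorem charL_degF_degF (i j : n) : charL ℓ β (degF i) (degF j) = qpow ℓ (β j i) := by
  rw [charL_degF, ← charL_degE_degE]
  simp [degF, degE]

theorem RFst_degE (i : n) : RFst ℓ β (degE i) = expUp ℓ β i 1 := by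
  rw [RFst, Finset.prod_eq_single i] <;> simp +contextual [degE, expUp_zero]

theorem RSnd_degE (i : n) : RSnd ℓ β (degE i) = expDown ℓ β i 1 := by
  rw [RSnd, Finset.prod_eq_single i] <;> simp +contextual [degE, expDown_zero]

theorem RSnd_degF (i : n) : RSnd ℓ β (degF i) = expDown ℓ β i (-1) := by
  rw [RSnd, Finset.prod_eq_single i] <;> simp +contextual [degF, expDown_zero]

/-- `R` is multiplicative in its second variable, so translating that variable by a degree produces
a scalar. -/
theorem shiftE_RFst (i : n) (d : n → ℤ) :
    shiftE ℓ β i (RFst ℓ β d) = charL ℓ β (degE i) d • RFst ℓ β d :=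
  evalAt_ext fun z => by
    rw [shiftE, shift_apply, evalAt_shiftHom, map_smul, evalAt_RFst, evalAt_RFst, universalR,
      universalR, charL_apply, smul_eq_mul, ← qpow_add, ← Finset.sum_add_distrib]
    simp only [← Finset.sum_add_distrib, Pi.add_apply, mul_add]
    rfl

end Degrees

/-! ### Derivations of `ℂ⟨f⟩` dual to multiplication by `e_i` -/

section DualDerivations

variable {n : Type u} [Fintype n] (ℓ : ℂ) (β : Matrix n n ℂ) (deg : n → n → ℤ)

open FreeAlgebra

/-- Contraction of the first leg of the coproduct. -/
noncomputable def contractLeft (φ : FreeAlgebra ℂ n →ₗ[ℂ] ℂ) :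
    FreeAlgebra ℂ n →ₗ[ℂ] FreeAlgebra ℂ n :=
  (TensorProduct.lid ℂ _).toLinearMap ∘ₗ φ.rTensor _ ∘ₗ freeComul ℓ β deg

/-- Contraction of the second leg of the coproduct. -/
noncomputable def contractRight (φ : FreeAlgebra ℂ n →ₗ[ℂ] ℂ) :
    FreeAlgebra ℂ n →ₗ[ℂ] FreeAlgebra ℂ n :=
  (TensorProduct.rid ℂ _).toLinearMap ∘ₗ φ.lTensor _ ∘ₗ freeComul ℓ β deg

/-- Both sides evaluate `φ` on the last leg of the threefold coproduct. -/
theorem freeComul_contractRight (φ : FreeAlgebra ℂ n →ₗ[ℂ] ℂ) (c : FreeAlgebra ℂ n) :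
    (contractRight ℓ β deg φ).lTensor _ (freeComul ℓ β deg c) =
      freeComul ℓ β deg (contractRight ℓ β deg φ c) := by
  have h1 : ∀ t : FreeAlgebra ℂ n ⊗[ℂ] FreeAlgebra ℂ n,
      freeComul ℓ β deg (TensorProduct.rid ℂ _ (φ.lTensor _ t)) =
      ((TensorProduct.rid ℂ _).toLinearMap ∘ₗ φ.lTensor _).lTensor _
        (TensorProduct.assoc ℂ _ _ _ ((freeComul ℓ β deg).rTensor _ t)) := by
    intro t
    induction t using TensorProduct.induction_on with
    | zero => simp
    | add x y hx hy => simp only [map_add, hx, hy]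
    | tmul x y =>
      simp only [LinearMap.lTensor_tmul, LinearMap.rTensor_tmul, TensorProduct.rid_tmul, map_smul]
      induction freeComul ℓ β deg x using TensorProduct.induction_on with
      | zero => simp
      | add x y hx hy => simp only [map_add, smul_add, add_tmul, hx, hy]
      | tmul a b => simp
  have h2 : ∀ t : FreeAlgebra ℂ n ⊗[ℂ] FreeAlgebra ℂ n,
      ((TensorProduct.rid ℂ _).toLinearMap ∘ₗ φ.lTensor _).lTensor _
        ((freeComul ℓ β deg).lTensor _ t) = (contractRight ℓ β deg φ).lTensor _ t := by
    intro t
    rw [← LinearMap.lTensor_comp_apply]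
    rfl
  rw [← h2, contractRight, LinearMap.comp_apply, LinearMap.comp_apply, LinearEquiv.coe_coe, h1]
  exact congr(((TensorProduct.rid ℂ _).toLinearMap ∘ₗ φ.lTensor _).lTensor (FreeAlgebra ℂ n)
    ($(freeComul_coassoc ℓ β deg) c)).symm

/-- Both sides evaluate `φ` on the middle leg of the threefold coproduct. -/
theorem contractRight_rTensor (φ : FreeAlgebra ℂ n →ₗ[ℂ] ℂ) (c : FreeAlgebra ℂ n) :
    (contractRight ℓ β deg φ).rTensor _ (freeComul ℓ β deg c) =
      (contractLeft ℓ β deg φ).lTensor _ (freeComul ℓ β deg c) := by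
  have h1 : ∀ t : FreeAlgebra ℂ n ⊗[ℂ] FreeAlgebra ℂ n,
      ((TensorProduct.lid ℂ _).toLinearMap ∘ₗ φ.rTensor _).lTensor _
        ((freeComul ℓ β deg).lTensor _ t) = (contractLeft ℓ β deg φ).lTensor _ t := by
    intro t
    rw [← LinearMap.lTensor_comp_apply]
    rfl
  have h2 : ∀ t : FreeAlgebra ℂ n ⊗[ℂ] FreeAlgebra ℂ n,
      ((TensorProduct.lid ℂ _).toLinearMap ∘ₗ φ.rTensor _).lTensor _
        (TensorProduct.assoc ℂ _ _ _ ((freeComul ℓ β deg).rTensor _ t)) =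
      (contractRight ℓ β deg φ).rTensor _ t := by
    intro t
    induction t using TensorProduct.induction_on with
    | zero => simp
    | add x y hx hy => simp only [map_add, hx, hy]
    | tmul x y =>
      simp only [LinearMap.rTensor_tmul, contractRight, LinearMap.comp_apply, LinearEquiv.coe_coe]
      induction freeComul ℓ β deg x using TensorProduct.induction_on with
      | zero => simp
      | add x y hx hy => simp only [map_add, add_tmul, hx, hy]
      | tmul a b => simp [smul_tmul]
  rw [← h1, ← h2]
  exact congr(((TensorProduct.lid ℂ _).toLinearMap ∘ₗ φ.rTensor _).lTensor (FreeAlgebra ℂ n)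
    ($(freeComul_coassoc ℓ β deg) c))

variable [DecidableEq n]

theorem contractLeft_ι_mul (q : ℂ) (i j : n) (c : FreeAlgebra ℂ n) :
    contractLeft ℓ β deg (q • freeCoeff i) (ι ℂ j * c) = (if i = j then q • c else 0) +
      charL ℓ β (deg j) (deg i) • (ι ℂ j * contractLeft ℓ β deg (q • freeCoeff i) c) := by
  have key : ∀ t, TensorProduct.lid ℂ _ ((q • freeCoeff i).rTensor _ (comulStep ℓ β deg j t)) =
      (if i = j then q • TensorProduct.lid ℂ _ (freeCounit.rTensor (FreeAlgebra ℂ n) t) else 0) +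
      charL ℓ β (deg j) (deg i) • (ι ℂ j *
        TensorProduct.lid ℂ _ ((q • freeCoeff i).rTensor _ t)) := by
    intro t
    induction t using TensorProduct.induction_on with
    | zero => simp
    | add x y hx hy =>
      simp only [map_add, hx, hy, mul_add, smul_add]
      split_ifs <;> abel
    | tmul x y =>
      simp only [comulStep_tmul, map_add, LinearMap.rTensor_tmul, TensorProduct.lid_tmul,
        LinearMap.smul_apply, freeCoeff_ι_mul, scaleL, freeCoeff_freeScale]
      split_ifs <;> simp [smul_smul, mul_comm, mul_assoc]
  simp only [contractLeft, LinearMap.comp_apply, LinearEquiv.coe_coe]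
  rw [freeComul_ι_mul, key, freeComul_counit_left]

theorem contractRight_ι_mul (q : ℂ) (i j : n) (c : FreeAlgebra ℂ n) :
    contractRight ℓ β deg (q • freeCoeff i) (ι ℂ j * c) =
      ι ℂ j * contractRight ℓ β deg (q • freeCoeff i) c +
      if i = j then q • scaleL ℓ β deg j c else 0 := by
  have key : ∀ t, TensorProduct.rid ℂ _ ((q • freeCoeff i).lTensor _ (comulStep ℓ β deg j t)) =
      ι ℂ j * TensorProduct.rid ℂ _ ((q • freeCoeff i).lTensor _ t) +
      if i = j then q • scaleL ℓ β deg j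
        (TensorProduct.rid ℂ _ (freeCounit.lTensor (FreeAlgebra ℂ n) t)) else 0 := by
    intro t
    induction t using TensorProduct.induction_on with
    | zero => simp
    | add x y hx hy =>
      simp only [map_add, hx, hy, mul_add, smul_add]
      split_ifs <;> abel
    | tmul x y =>
      simp only [comulStep_tmul, map_add, LinearMap.lTensor_tmul, TensorProduct.rid_tmul,
        LinearMap.smul_apply, freeCoeff_ι_mul]
      split_ifs <;> simp [smul_smul]
  simp only [contractRight, LinearMap.comp_apply, LinearEquiv.coe_coe]
  rw [freeComul_ι_mul, key, freeComul_counit_right]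

theorem contractRight_mem (q : ℂ) (i : n) {d : n → ℤ} {c : FreeAlgebra ℂ n}
    (hc : c ∈ freeGrading degF d) :
    contractRight ℓ β degF (q • freeCoeff i) c ∈ freeGrading degF (degE i + d) := by
  induction hc using mem_freeGrading_induction with
  | one => simp [contractRight, freeComul_one]
  | zero d => simp
  | add d x y _ _ hx hy => rw [map_add]; exact Submodule.add_mem _ hx hy
  | smul d c x _ hx => rw [map_smul]; exact Submodule.smul_mem _ _ hx
  | ι_mul d j x hx h =>
    rw [contractRight_ι_mul]
    refine Submodule.add_mem _ ?_ ?_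
    · rw [add_left_comm]
      exact ι_mul_mem_freeGrading degF j h
    · split_ifs with hij
      · subst hij
        rw [show degE i + (degF i + d) = d by simp [degE, degF]]
        exact Submodule.smul_mem _ _ (freeScale_mem degF _ hx)
      · exact Submodule.zero_mem _

/-- Since `e_i` is primitive, pairing with it is a derivation over the counit, and such a functional
is determined by its values on the generators. -/
theorem freeEv_ι_right (r : n → ℂ) (i : n) :
    (freeEv ℓ β r).flip (ι ℂ i) = (r i - (r i)⁻¹)⁻¹ • freeCoeff i := by
  refine free_linearMap_ext_left ?_ fun j x _ => ?_
  · simp [freeEv_one_left]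
  · rw [LinearMap.flip_apply, freeEv_mul_left, freeComul_ι]
    simp only [map_add, map_tmul, LinearMap.mul'_apply, freeEv_one_right, freeEv_ι_ι,
      LinearMap.smul_apply, freeCoeff_ι_mul, freeCounit_ι]
    by_cases h : i = j
    · subst h; simp [mul_comm]
    · simp [h, Ne.symm h]

/-- The braided derivation `c ↦ ev(c₁, e_i) c₂`. -/
noncomputable def dualLeft (r : n → ℂ) (i : n) : FreeAlgebra ℂ n →ₗ[ℂ] FreeAlgebra ℂ n :=
  contractLeft ℓ β degF ((r i - (r i)⁻¹)⁻¹ • freeCoeff i)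

/-- The braided derivation `c ↦ c₁ ev(c₂, e_i)`. -/
noncomputable def dualRight (r : n → ℂ) (i : n) : FreeAlgebra ℂ n →ₗ[ℂ] FreeAlgebra ℂ n :=
  contractRight ℓ β degF ((r i - (r i)⁻¹)⁻¹ • freeCoeff i)

/-- Multiplication by `e_i` is adjoint to `dualRight`; this is how a letter of `b` leaves the
pairing in the cross relation. -/
theorem freeEv_ι_mul (r : n → ℂ) (i : n) (c b : FreeAlgebra ℂ n) :
    freeEv ℓ β r c (ι ℂ i * b) = freeEv ℓ β r (dualRight ℓ β r i c) b := by
  rw [freeEv_mul_right, freeEv_ι_right]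
  simp only [dualRight, contractRight, LinearMap.comp_apply, LinearEquiv.coe_coe]
  induction freeComul ℓ β degF c using TensorProduct.induction_on with
  | zero => simp
  | add x y hx hy => simp only [map_add, LinearMap.add_apply, hx, hy]
  | tmul x y => simp [mul_comm, mul_assoc]

end DualDerivations

/-! ### Verification of the double-bosonisation axioms -/

section Cross

variable {n : Type u} [Fintype n] [DecidableEq n] (ℓ : ℂ) (β : Matrix n n ℂ) (r : n → ℂ)

open FreeAlgebra

namespace FreeDouble

/-- The inclusion of `ℂ⟨e⟩`. -/
noncomputable def inclB : FreeAlgebra ℂ n →ₐ[ℂ] FreeDouble ℓ β r := FreeAlgebra.lift ℂ (e ℓ β r)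

/-- The inclusion of `ℂ⟨f⟩`. -/
noncomputable def inclC : FreeAlgebra ℂ n →ₗ[ℂ] FreeDouble ℓ β r := antiLift (f ℓ β r)

@[simp] theorem inclB_ι (i : n) : inclB ℓ β r (ι ℂ i) = e ℓ β r i := by simp [inclB]

@[simp] theorem inclC_ι (i : n) : inclC ℓ β r (ι ℂ i) = f ℓ β r i := by simp [inclC]

@[simp] theorem inclC_one : inclC ℓ β r 1 = 1 := by simp [inclC]

@[simp] theorem inclC_mul (a b : FreeAlgebra ℂ n) :
    inclC ℓ β r (a * b) = inclC ℓ β r b * inclC ℓ β r a := by simp [inclC]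

theorem inclB_mul_of {d : n → ℤ} {b : FreeAlgebra ℂ n} (hb : b ∈ freeGrading degE d)
    (h : Uq ℓ β) : inclB ℓ β r b * of ℓ β r h = of ℓ β r (shift ℓ β d h) * inclB ℓ β r b := by
  induction hb using mem_freeGrading_induction generalizing h with
  | one => simp [shift_zero]
  | zero d => simp
  | add d x y _ _ hx hy => rw [map_add, add_mul, mul_add, hx, hy]
  | smul d c x _ hx => rw [map_smul, smul_mul_assoc, mul_smul_comm, hx]
  | ι_mul d i x _ hx =>
    rw [map_mul, inclB_ι, mul_assoc, hx, ← mul_assoc, (relations ℓ β r).e_map, shift_add,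
      mul_assoc]
    rfl

theorem f_mul_of (i : n) (h : Uq ℓ β) :
    f ℓ β r i * of ℓ β r h = of ℓ β r (shift ℓ β (degF i) h) * f ℓ β r i := by
  rw [(relations ℓ β r).map_f, shiftE, ← shift_add]
  simp [degE, degF, shift_zero]

theorem inclC_mul_of {d : n → ℤ} {c : FreeAlgebra ℂ n} (hc : c ∈ freeGrading degF d)
    (h : Uq ℓ β) : inclC ℓ β r c * of ℓ β r h = of ℓ β r (shift ℓ β d h) * inclC ℓ β r c := by
  induction hc using mem_freeGrading_induction generalizing h with
  | one => simp [shift_zero]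
  | zero d => simp
  | add d x y _ _ hx hy => rw [map_add, add_mul, mul_add, hx, hy]
  | smul d c x _ hx => rw [map_smul, smul_mul_assoc, mul_smul_comm, hx]
  | ι_mul d i x _ hx =>
    rw [inclC_mul, inclC_ι, mul_assoc, f_mul_of, ← mul_assoc, hx, ← shift_add, mul_assoc,
      add_comm d]

theorem inclC_mul_expDown (i : n) (c : FreeAlgebra ℂ n) :
    inclC ℓ β r c * of ℓ β r (expDown ℓ β i (-1)) =
      of ℓ β r (expDown ℓ β i (-1)) * inclC ℓ β r (scaleL ℓ β degF i c) := by
  suffices h : LinearMap.mulRight ℂ (of ℓ β r (expDown ℓ β i (-1))) ∘ₗ inclC ℓ β r =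
      LinearMap.mulLeft ℂ (of ℓ β r (expDown ℓ β i (-1))) ∘ₗ inclC ℓ β r ∘ₗ
        (scaleL ℓ β degF i).toLinearMap from congr($h c)
  refine linearMap_ext_homogeneous (freeGrading degF) fun d c hc => ?_
  simp only [LinearMap.comp_apply, LinearMap.mulRight_apply, LinearMap.mulLeft_apply,
    AlgHom.toLinearMap_apply, scaleL_of_mem ℓ β degF i hc, map_smul]
  rw [inclC_mul_of ℓ β r hc, shift_expDown, charL_degF_eq]
  simp

theorem e_mul_RFst (i : n) (d : n → ℤ) : e ℓ β r i * of ℓ β r (RFst ℓ β d) =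
    charL ℓ β (degE i) d • (of ℓ β r (RFst ℓ β d) * e ℓ β r i) := by
  rw [(relations ℓ β r).e_map, shiftE_RFst, map_smul, smul_mul_assoc]

theorem up_mul_f (i j : n) : of ℓ β r (expUp ℓ β i 1) * f ℓ β r j =
    qpow ℓ (β i j) • (f ℓ β r j * of ℓ β r (expUp ℓ β i 1)) := by
  rw [(relations ℓ β r).map_f, shiftE_expUp]
  simp

theorem of_kappa (i : n) : of ℓ β r (kappa ℓ β r i) =
    (r i - (r i)⁻¹)⁻¹ • (of ℓ β r (expUp ℓ β i 1) - of ℓ β r (expDown ℓ β i (-1))) := by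
  rw [kappa, map_smul, map_sub]

/-- The cross relation of `e_i` with all elements of `ℂ⟨f⟩`. -/
theorem e_mul_inclC (i : n) (c : FreeAlgebra ℂ n) :
    e ℓ β r i * inclC ℓ β r c +
      of ℓ β r (expDown ℓ β i (-1)) * inclC ℓ β r (dualRight ℓ β r i c) =
    inclC ℓ β r (dualLeft ℓ β r i c) * of ℓ β r (expUp ℓ β i 1) +
      inclC ℓ β r c * e ℓ β r i := by
  induction c using free_left_induction with
  | one => simp [dualRight, dualLeft, contractRight, contractLeft, freeComul_one]
  | add x y hx hy =>
    simp only [map_add, mul_add, add_mul]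
    rw [add_add_add_comm, hx, hy, add_add_add_comm]
  | smul c x hx => simp only [map_smul, mul_smul_comm, smul_mul_assoc, ← smul_add, hx]
  | ι_mul j x hx =>
    have hef := (relations ℓ β r).e_f i j
    -- Words in the `f`'s are read backwards, so prefixing `f_j` to `x` multiplies the induction
    -- hypothesis by `f_j` on the right.
    have h1 : e ℓ β r i * (inclC ℓ β r x * f ℓ β r j) +
        of ℓ β r (expDown ℓ β i (-1)) * (inclC ℓ β r (dualRight ℓ β r i x) * f ℓ β r j) =
        inclC ℓ β r (dualLeft ℓ β r i x) * (of ℓ β r (expUp ℓ β i 1) * f ℓ β r j) +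
        inclC ℓ β r x * (e ℓ β r i * f ℓ β r j) := by
      simpa only [add_mul, mul_assoc] using congr($hx * f ℓ β r j)
    rw [dualRight, contractRight_ι_mul, ← dualRight, dualLeft, contractLeft_ι_mul, ← dualLeft,
      map_add, map_add, map_smul, inclC_mul, inclC_mul, inclC_mul, inclC_ι, mul_add, ← add_assoc,
      h1, up_mul_f, hef, charL_degF_degF, mul_smul_comm, add_mul, smul_mul_assoc,
      mul_assoc _ (f ℓ β r j), mul_add]
    -- For `i = j` the two exponentials in `κ_i` supply the inhomogeneous terms of `dualLeft` and
    -- `dualRight`.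
    split_ifs with hij
    · subst hij
      rw [of_kappa, map_smul, map_smul, mul_smul_comm, mul_smul_comm, ← inclC_mul_expDown,
        mul_sub, smul_sub, smul_mul_assoc, mul_assoc (inclC ℓ β r x)]
      abel
    · simp [mul_assoc]

theorem crossLeft_tmul (b₁ b₂ c₁ c₂ : FreeAlgebra ℂ n) (P : FreeAlgebra ℂ n →ₗ[ℂ] FreeDouble ℓ β r) :
    crossLeft (freeGrading degF) (freeEv ℓ β r) P (of ℓ β r).toLinearMap
      (inclB ℓ β r).toLinearMap (b₁ ⊗ₜ b₂) (c₁ ⊗ₜ c₂) =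
    inclB ℓ β r b₁ * of ℓ β r (evRSnd ℓ β (freeGrading degF) (freeEv ℓ β r) c₂ b₂) * P c₁ := by
  simp [crossLeft]

theorem crossRight_tmul (b₁ b₂ c₁ c₂ : FreeAlgebra ℂ n) (P : FreeAlgebra ℂ n →ₗ[ℂ] FreeDouble ℓ β r) :
    crossRight (freeGrading degE) (freeEv ℓ β r) P (of ℓ β r).toLinearMap
      (inclB ℓ β r).toLinearMap (b₁ ⊗ₜ b₂) (c₁ ⊗ₜ c₂) =
    P c₂ * of ℓ β r (evRFst ℓ β (freeGrading degE) (freeEv ℓ β r) c₁ b₁) * inclB ℓ β r b₂ := by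
  simp [crossRight]

theorem evRSnd_of_mem {d : n → ℤ} {c : FreeAlgebra ℂ n} (hc : c ∈ freeGrading degF d)
    (b : FreeAlgebra ℂ n) : evRSnd ℓ β (freeGrading degF) (freeEv ℓ β r) c b =
      freeEv ℓ β r c b • RSnd ℓ β d := by
  simp [evRSnd, byDegree_of_mem _ _ hc]

theorem evRFst_of_mem {d : n → ℤ} {b : FreeAlgebra ℂ n} (hb : b ∈ freeGrading degE d)
    (c : FreeAlgebra ℂ n) : evRFst ℓ β (freeGrading degE) (freeEv ℓ β r) c b =
      freeEv ℓ β r c b • RFst ℓ β d := by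
  simp [evRFst, byDegree_of_mem _ _ hb]

/-- `b₁ R⁽¹⁾ c₁ ev(c₂ ◁ R⁽²⁾, b₂)` in the double-bosonisation. -/
noncomputable def crossL : FreeAlgebra ℂ n ⊗[ℂ] FreeAlgebra ℂ n →ₗ[ℂ]
    FreeAlgebra ℂ n ⊗[ℂ] FreeAlgebra ℂ n →ₗ[ℂ] FreeDouble ℓ β r :=
  crossLeft (freeGrading degF) (freeEv ℓ β r) (inclC ℓ β r) (of ℓ β r).toLinearMap
    (inclB ℓ β r).toLinearMap

/-- `ev(c₁, b₁ ◁ R⁽¹⁾) P(c₂) R⁽²⁾ b₂` in the double-bosonisation. -/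
noncomputable def crossR (P : FreeAlgebra ℂ n →ₗ[ℂ] FreeDouble ℓ β r) :
    FreeAlgebra ℂ n ⊗[ℂ] FreeAlgebra ℂ n →ₗ[ℂ]
      FreeAlgebra ℂ n ⊗[ℂ] FreeAlgebra ℂ n →ₗ[ℂ] FreeDouble ℓ β r :=
  crossRight (freeGrading degE) (freeEv ℓ β r) P (of ℓ β r).toLinearMap
    (inclB ℓ β r).toLinearMap

theorem crossL_tmul (b₁ b₂ c₁ c₂ : FreeAlgebra ℂ n) :
    crossL ℓ β r (b₁ ⊗ₜ b₂) (c₁ ⊗ₜ c₂) = inclB ℓ β r b₁ *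
      of ℓ β r (evRSnd ℓ β (freeGrading degF) (freeEv ℓ β r) c₂ b₂) * inclC ℓ β r c₁ :=
  crossLeft_tmul ..

theorem crossR_tmul (P : FreeAlgebra ℂ n →ₗ[ℂ] FreeDouble ℓ β r) (b₁ b₂ c₁ c₂ : FreeAlgebra ℂ n) :
    crossR ℓ β r P (b₁ ⊗ₜ b₂) (c₁ ⊗ₜ c₂) = P c₂ *
      of ℓ β r (evRFst ℓ β (freeGrading degE) (freeEv ℓ β r) c₁ b₁) * inclB ℓ β r b₂ :=
  crossRight_tmul ..

theorem crossR_add (P Q : FreeAlgebra ℂ n →ₗ[ℂ] FreeDouble ℓ β r) :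
    crossR ℓ β r (P + Q) = crossR ℓ β r P + crossR ℓ β r Q := by
  ext
  simp [crossR_tmul, add_mul]

theorem crossR_mulLeft (x : FreeDouble ℓ β r) (P : FreeAlgebra ℂ n →ₗ[ℂ] FreeDouble ℓ β r) (s t) :
    crossR ℓ β r (LinearMap.mulLeft ℂ x ∘ₗ P) s t = x * crossR ℓ β r P s t := by
  suffices h : crossR ℓ β r (LinearMap.mulLeft ℂ x ∘ₗ P) =
      (crossR ℓ β r P).compr₂ (LinearMap.mulLeft ℂ x) from congr($h s t)
  ext
  simp [crossR_tmul, mul_assoc]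

/-- Operators on the second leg of `c` are absorbed into `P`, as left factors are in
`crossR_mulLeft`. The cross relation thereby becomes an equality between maps `P`. -/
theorem crossR_comp (P : FreeAlgebra ℂ n →ₗ[ℂ] FreeDouble ℓ β r)
    (Q : FreeAlgebra ℂ n →ₗ[ℂ] FreeAlgebra ℂ n) (s t) :
    crossR ℓ β r P s (Q.lTensor _ t) = crossR ℓ β r (P ∘ₗ Q) s t := by
  suffices h : (crossR ℓ β r P).compl₂ (Q.lTensor _) = crossR ℓ β r (P ∘ₗ Q) from congr($h s t)
  ext
  simp [crossR_tmul]

/-- A new `e_i` in the first leg stays as a left factor. In the second leg it is paired with `c₂`,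
leaving `dualRight`; this raises the degree of `c₂`, and the resulting change of the leg of `R` is
compensated by `q^{-H_i}` in front. -/
theorem crossL_comulStep (i : n) (s t) : crossL ℓ β r (comulStep ℓ β degE i s) t =
    e ℓ β r i * crossL ℓ β r s t + of ℓ β r (expDown ℓ β i (-1)) *
      crossL ℓ β r s ((dualRight ℓ β r i).lTensor _ t) := by
  suffices h : crossL ℓ β r ∘ₗ comulStep ℓ β degE i =
      (crossL ℓ β r).compr₂ (LinearMap.mulLeft ℂ (e ℓ β r i)) +
      ((crossL ℓ β r).compr₂ (LinearMap.mulLeft ℂ (of ℓ β r (expDown ℓ β i (-1))))).compl₂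
        ((dualRight ℓ β r i).lTensor _) from congr($h s t)
  refine tensor_ext_homogeneous (freeGrading degE) (freeGrading degE) fun d₁ d₂ b₁ hb₁ b₂ hb₂ =>
    tensor_ext_homogeneous (freeGrading degF) (freeGrading degF) fun d₃ d₄ c₁ hc₁ c₂ hc₂ => ?_
  -- Conjugating `b₁` by `q^{H_i}` produces exactly the scalar that `comulStep` puts on its first
  -- leg.
  have h1 : of ℓ β r (expDown ℓ β i (-1)) * (inclB ℓ β r b₁ * of ℓ β r (expDown ℓ β i 1)) =
      charL ℓ β (degE i) d₁ • inclB ℓ β r b₁ := by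
    rw [inclB_mul_of ℓ β r hb₁, shift_expDown, map_smul, smul_mul_assoc, mul_smul_comm,
      ← mul_assoc, ← map_mul, ← expDown_add, charL_degE]
    simp [expDown_zero]
  have hc := contractRight_mem ℓ β (r i - (r i)⁻¹)⁻¹ i hc₂
  rw [← dualRight] at hc
  simp only [LinearMap.comp_apply, LinearMap.add_apply, LinearMap.compr₂_apply,
    LinearMap.compl₂_apply, LinearMap.mulLeft_apply, LinearMap.lTensor_tmul, comulStep_tmul,
    map_add, crossL_tmul, evRSnd_of_mem ℓ β r hc₂, evRSnd_of_mem ℓ β r hc, map_mul, inclB_ι,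
    freeEv_ι_mul, scaleL_of_mem ℓ β degE i hb₁, map_smul, RSnd_add, RSnd_degE]
  congr 1
  · simp only [mul_assoc]
  · simp only [mul_smul_comm, smul_mul_assoc]
    rw [← mul_assoc (inclB ℓ β r b₁), ← mul_assoc (of ℓ β r (expDown ℓ β i (-1))),
      ← mul_assoc (of ℓ β r (expDown ℓ β i (-1))), h1]
    simp only [smul_mul_assoc, mul_assoc]

/-- A new `e_i` in the first leg is absorbed by the pairing as `dualRight` on `c₁` and leaves
`q^{H^i}` in the leg of `R`. In the second leg it is moved left past the leg of `R`, which accounts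
for the scalar in `comulStep`. -/
theorem crossR_comulStep (i : n) (s t) :
    crossR ℓ β r (inclC ℓ β r) (comulStep ℓ β degE i s) t =
      crossR ℓ β r (LinearMap.mulRight ℂ (of ℓ β r (expUp ℓ β i 1)) ∘ₗ inclC ℓ β r) s
        ((dualRight ℓ β r i).rTensor _ t) +
      crossR ℓ β r (LinearMap.mulRight ℂ (e ℓ β r i) ∘ₗ inclC ℓ β r) s t := by
  suffices h : crossR ℓ β r (inclC ℓ β r) ∘ₗ comulStep ℓ β degE i =
      (crossR ℓ β r (LinearMap.mulRight ℂ (of ℓ β r (expUp ℓ β i 1)) ∘ₗ inclC ℓ β r)).compl₂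
        ((dualRight ℓ β r i).rTensor _) +
      crossR ℓ β r (LinearMap.mulRight ℂ (e ℓ β r i) ∘ₗ inclC ℓ β r) from congr($h s t)
  refine tensor_ext_homogeneous (freeGrading degE) (freeGrading degE) fun d₁ d₂ b₁ hb₁ b₂ hb₂ =>
    tensor_ext_homogeneous (freeGrading degF) (freeGrading degF) fun d₃ d₄ c₁ hc₁ c₂ hc₂ => ?_
  have hb := ι_mul_mem_freeGrading degE i hb₁
  simp only [LinearMap.comp_apply, LinearMap.add_apply, LinearMap.compl₂_apply,
    LinearMap.mulRight_apply, LinearMap.rTensor_tmul, comulStep_tmul, map_add, crossR_tmul,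
    evRFst_of_mem ℓ β r hb₁, evRFst_of_mem ℓ β r hb, map_mul, inclB_ι, freeEv_ι_mul,
    scaleL_of_mem ℓ β degE i hb₁, map_smul, RFst_add, RFst_degE]
  congr 1
  · simp only [mul_assoc, mul_smul_comm, smul_mul_assoc]
  · simp only [mul_smul_comm, smul_mul_assoc]
    rw [mul_assoc (inclC ℓ β r c₂) (e ℓ β r i), e_mul_RFst, smul_comm]
    simp only [mul_smul_comm, smul_mul_assoc, mul_assoc]

theorem evRSnd_one (c : FreeAlgebra ℂ n) :
    evRSnd ℓ β (freeGrading degF) (freeEv ℓ β r) c 1 = algebraMap ℂ _ (freeCounit c) := by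
  suffices h : (evRSnd ℓ β (freeGrading degF) (freeEv ℓ β r)).flip 1 =
      Algebra.linearMap ℂ _ ∘ₗ freeCounit from congr($h c)
  refine linearMap_ext_homogeneous (freeGrading degF) fun d c hc => ?_
  rw [LinearMap.flip_apply, evRSnd_of_mem ℓ β r hc, freeEv_one_right, LinearMap.comp_apply,
    Algebra.linearMap_apply]
  by_cases h : d = 0
  · rw [h, RSnd_zero, Algebra.algebraMap_eq_smul_one]
  · rw [freeCounit_of_mem degF hc h, zero_smul, map_zero]

theorem evRFst_one (c : FreeAlgebra ℂ n) :
    evRFst ℓ β (freeGrading degE) (freeEv ℓ β r) c 1 = algebraMap ℂ _ (freeCounit c) := by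
  rw [evRFst_of_mem ℓ β r (SetLike.GradedOne.one_mem : 1 ∈ freeGrading degE 0), freeEv_one_right,
    RFst_zero, Algebra.algebraMap_eq_smul_one]

/-- The element `c` stays arbitrary in the induction on `b`, because the hypothesis is also used for
`dualRight i c`. Coassociativity moves every derivation to the second leg of `c`, where
`e_mul_inclC` identifies the two sides. -/
theorem cross_BC (b c : FreeAlgebra ℂ n) :
    crossL ℓ β r (freeComul ℓ β degE b) (freeComul ℓ β degF c) =
      crossR ℓ β r (inclC ℓ β r) (freeComul ℓ β degE b) (freeComul ℓ β degF c) := by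
  induction b using free_left_induction generalizing c with
  | one =>
    have h1 : ∀ t, crossL ℓ β r (1 ⊗ₜ 1) t =
        inclC ℓ β r (TensorProduct.rid ℂ _ (freeCounit.lTensor _ t)) := by
      intro t
      induction t using TensorProduct.induction_on with
      | zero => simp
      | add x y hx hy => simp only [map_add, hx, hy]
      | tmul x y =>
        simp [crossL_tmul, evRSnd_one, Algebra.algebraMap_eq_smul_one]
    have h2 : ∀ t, crossR ℓ β r (inclC ℓ β r) (1 ⊗ₜ 1) t =
        inclC ℓ β r (TensorProduct.lid ℂ _ (freeCounit.rTensor _ t)) := by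
      intro t
      induction t using TensorProduct.induction_on with
      | zero => simp
      | add x y hx hy => simp only [map_add, hx, hy]
      | tmul x y =>
        simp [crossR_tmul, evRFst_one, Algebra.algebraMap_eq_smul_one]
    rw [freeComul_one, h1, h2, freeComul_counit_right, freeComul_counit_left]
  | add x y hx hy => simp only [map_add, LinearMap.add_apply, hx, hy]
  | smul k x hx => simp only [map_smul, LinearMap.smul_apply, hx]
  | ι_mul i x hx =>
    have hP : LinearMap.mulLeft ℂ (e ℓ β r i) ∘ₗ inclC ℓ β r +
        LinearMap.mulLeft ℂ (of ℓ β r (expDown ℓ β i (-1))) ∘ₗ inclC ℓ β r ∘ₗ dualRight ℓ β r i =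
        (LinearMap.mulRight ℂ (of ℓ β r (expUp ℓ β i 1)) ∘ₗ inclC ℓ β r) ∘ₗ dualLeft ℓ β r i +
        LinearMap.mulRight ℂ (e ℓ β r i) ∘ₗ inclC ℓ β r :=
      LinearMap.ext fun c => e_mul_inclC ℓ β r i c
    have h1 : (dualRight ℓ β r i).lTensor _ (freeComul ℓ β degF c) =
        freeComul ℓ β degF (dualRight ℓ β r i c) := freeComul_contractRight ℓ β degF _ c
    have h2 : (dualRight ℓ β r i).rTensor _ (freeComul ℓ β degF c) =
        (dualLeft ℓ β r i).lTensor _ (freeComul ℓ β degF c) := contractRight_rTensor ℓ β degF _ c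
    rw [freeComul_ι_mul, crossL_comulStep, crossR_comulStep, h1, hx, hx, ← h1, h2, crossR_comp,
      crossR_comp, ← crossR_mulLeft, ← crossR_mulLeft]
    simp only [← LinearMap.add_apply, ← crossR_add, hP]

/-- As a function of the braided coproduct, the right-hand side turns `comulStep` into left
multiplication by the coproduct of `e_i`. It thus obeys the recursion of an algebra map. -/
theorem comul_inclB (b : FreeAlgebra ℂ n) : comulHom ℓ β r (inclB ℓ β r b) =
    map (inclB ℓ β r).toLinearMap
      (LinearMap.mul' ℂ _ ∘ₗ map (of ℓ β r).toLinearMap (inclB ℓ β r).toLinearMap)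
      (TensorProduct.assoc ℂ _ _ _ ((actRFst ℓ β (freeGrading degE)).rTensor _
        (freeComul ℓ β degE b))) := by
  let Θ := map (inclB ℓ β r).toLinearMap
      (LinearMap.mul' ℂ _ ∘ₗ map (of ℓ β r).toLinearMap (inclB ℓ β r).toLinearMap) ∘ₗ
      (TensorProduct.assoc ℂ _ _ _).toLinearMap ∘ₗ
      (actRFst ℓ β (freeGrading degE)).rTensor (FreeAlgebra ℂ n)
  have hΘ : ∀ {d : n → ℤ} {a : FreeAlgebra ℂ n} (_ : a ∈ freeGrading degE d) (b),
      Θ (a ⊗ₜ b) = inclB ℓ β r a ⊗ₜ[ℂ] (of ℓ β r (RFst ℓ β d) * inclB ℓ β r b) := by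
    intro d a ha b
    simp [Θ, actRFst, byDegree_of_mem _ _ ha]
  have key : ∀ i t, Θ (comulStep ℓ β degE i t) = (e ℓ β r i ⊗ₜ[ℂ] of ℓ β r (expUp ℓ β i 1) +
      1 ⊗ₜ[ℂ] e ℓ β r i) * Θ t := by
    intro i t
    suffices h : Θ ∘ₗ comulStep ℓ β degE i = LinearMap.mulLeft ℂ
        (e ℓ β r i ⊗ₜ[ℂ] of ℓ β r (expUp ℓ β i 1) + 1 ⊗ₜ[ℂ] e ℓ β r i) ∘ₗ Θ from congr($h t)
    refine tensor_ext_homogeneous (freeGrading degE) (freeGrading degE) fun d d' a ha b hb => ?_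
    rw [LinearMap.comp_apply, comulStep_tmul, map_add, hΘ (ι_mul_mem_freeGrading degE i ha),
      show Θ (scaleL ℓ β degE i a ⊗ₜ (ι ℂ i * b)) = _ from hΘ (freeScale_mem degE _ ha) _, LinearMap.comp_apply, hΘ ha, LinearMap.mulLeft_apply, add_mul,
      Algebra.TensorProduct.tmul_mul_tmul, Algebra.TensorProduct.tmul_mul_tmul, map_mul, inclB_ι,
      RFst_add, RFst_degE, map_mul, mul_assoc, one_mul, freeScale_of_mem degE _ ha, map_smul,
      ← mul_assoc (e ℓ β r i) (of ℓ β r _), e_mul_RFst, map_mul, inclB_ι]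
    simp only [smul_mul_assoc, tmul_smul, smul_tmul', mul_assoc]
  change _ = Θ _
  induction b using free_left_induction with
  | one =>
    rw [map_one, map_one, freeComul_one,
      hΘ (SetLike.GradedOne.one_mem : 1 ∈ freeGrading degE 0), RFst_zero]
    simp [Algebra.TensorProduct.one_def]
  | add x y hx hy => simp only [map_add, hx, hy]
  | smul c x hx => simp only [map_smul, hx]
  | ι_mul i x hx => rw [map_mul, map_mul, hx, freeComul_ι_mul, key, inclB_ι, comulHom_e]

/-- Since `inclC` reverses products, here `comulStep` becomes right multiplication by the coproduct
of `f_i`. -/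
theorem comul_inclC (c : FreeAlgebra ℂ n) : comulHom ℓ β r (inclC ℓ β r c) =
    map (LinearMap.mul' ℂ _ ∘ₗ map (of ℓ β r).toLinearMap (inclC ℓ β r)) (inclC ℓ β r)
      ((TensorProduct.assoc ℂ _ _ _).symm (TensorProduct.leftComm ℂ _ _ _
        ((actRSnd ℓ β (freeGrading degF)).lTensor _ (freeComul ℓ β degF c)))) := by
  let Θ := map (LinearMap.mul' ℂ _ ∘ₗ map (of ℓ β r).toLinearMap (inclC ℓ β r)) (inclC ℓ β r) ∘ₗ
      (TensorProduct.assoc ℂ _ _ _).symm.toLinearMap ∘ₗ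
      (TensorProduct.leftComm ℂ _ _ _).toLinearMap ∘ₗ
      (actRSnd ℓ β (freeGrading degF)).lTensor (FreeAlgebra ℂ n)
  have hΘ : ∀ {d : n → ℤ} {b : FreeAlgebra ℂ n} (_ : b ∈ freeGrading degF d) (a),
      Θ (a ⊗ₜ b) = (of ℓ β r (RSnd ℓ β d) * inclC ℓ β r a) ⊗ₜ[ℂ] inclC ℓ β r b := by
    intro d b hb a
    simp [Θ, actRSnd, byDegree_of_mem _ _ hb]
  have key : ∀ i t, Θ (comulStep ℓ β degF i t) = Θ t * (f ℓ β r i ⊗ₜ[ℂ] 1 +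
      of ℓ β r (expDown ℓ β i (-1)) ⊗ₜ[ℂ] f ℓ β r i) := by
    intro i t
    suffices h : Θ ∘ₗ comulStep ℓ β degF i = LinearMap.mulRight ℂ (f ℓ β r i ⊗ₜ[ℂ] 1 +
        of ℓ β r (expDown ℓ β i (-1)) ⊗ₜ[ℂ] f ℓ β r i) ∘ₗ Θ from congr($h t)
    refine tensor_ext_homogeneous (freeGrading degF) (freeGrading degF) fun d d' a ha b hb => ?_
    rw [LinearMap.comp_apply, comulStep_tmul, map_add, hΘ hb,
      hΘ (ι_mul_mem_freeGrading degF i hb), LinearMap.comp_apply, hΘ hb, LinearMap.mulRight_apply,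
      mul_add, Algebra.TensorProduct.tmul_mul_tmul, Algebra.TensorProduct.tmul_mul_tmul,
      mul_assoc _ (inclC ℓ β r a) (of ℓ β r _), inclC_mul_expDown, inclC_mul, inclC_mul, inclC_ι,
      RSnd_add, RSnd_degF, mul_comm (expDown ℓ β i (-1)), map_mul, mul_one]
    simp only [mul_assoc]
  change _ = Θ _
  induction c using free_left_induction with
  | one =>
    rw [inclC_one, map_one, freeComul_one,
      hΘ (SetLike.GradedOne.one_mem : 1 ∈ freeGrading degF 0), RSnd_zero]
    simp [Algebra.TensorProduct.one_def]
  | add x y hx hy => simp only [map_add, hx, hy]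
  | smul c x hx => simp only [map_smul, hx]
  | ι_mul i x hx => rw [inclC_mul, map_mul, hx, freeComul_ι_mul, key, inclC_ι, comulHom_f]

/-- The inclusion of `U_q(β)` as a Hopf algebra. -/
noncomputable def inclH : Uq ℓ β →ₐc[ℂ] FreeDouble ℓ β r :=
  BialgHom.ofAlgHom (of ℓ β r)
    (AlgHom.ext fun h => counitHom_of ℓ β r h) (AlgHom.ext fun h => (comulHom_of ℓ β r h).symm)

/-- The double-bosonisation of the free braided groups. -/
noncomputable def doubleBosonisation :
    DoubleBosonisation ℓ β (freeGrading degE) (freeGrading degF) (freeComul ℓ β degF)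
      (freeComul ℓ β degE) (freeEv ℓ β r) (FreeDouble ℓ β r) where
  inclOp := AlgHom.opComm (FreeAlgebra.lift ℂ fun i => MulOpposite.op (f ℓ β r i))
  inclH := inclH ℓ β r
  inclB := inclB ℓ β r
  inclC := inclC ℓ β r
  inclC_eq c := rfl
  triangular := Presented.triangularMap_bijective _ _ (shiftE_comm ℓ β)
  cross_BH b h := cross_right_of_homogeneous (freeGrading degE) (of ℓ β r).toLinearMap
    (inclB ℓ β r).toLinearMap h (fun _ _ hb => inclB_mul_of ℓ β r hb h) b
  cross_CH c h := cross_left_of_homogeneous (freeGrading degF) (of ℓ β r).toLinearMap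
    (inclC ℓ β r) h (fun _ _ hc => inclC_mul_of ℓ β r hc h) c
  cross_BC b c := cross_BC ℓ β r b c
  comul_B b := comul_inclB ℓ β r b
  comul_C c := comul_inclC ℓ β r c

end FreeDouble

end Cross

end CStat

namespace CStat

open TensorProduct

/-! ### The structure of a double-bosonisation -/

/-! ### Consequences of a triangular decomposition -/

section Triangular

variable {n : Type u} [DecidableEq n] {K : Type v} [CommRing K] [Algebra ℂ K]
  {σ : n → K ≃ₐ[ℂ] K} {κ : n → K} {A : Type w} [Semiring A] [Algebra ℂ A]

/-- Triangular words span the presented algebra and go to triangular words, so independence in the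
target forces injectivity. -/
theorem Presented.lift_injective (hσ : ∀ i j h, σ i (σ j h) = σ j (σ i h)) {φ : K →ₐ[ℂ] A}
    {E F : n → A} (h : TriangularRelations σ κ φ E F)
    (hinj : Function.Injective (triangularMap φ E F)) : Function.Injective (Presented.lift h) := by
  intro a b hab
  obtain ⟨s, rfl⟩ := (Presented.triangularMap_bijective σ κ hσ).2 a
  obtain ⟨t, rfl⟩ := (Presented.triangularMap_bijective σ κ hσ).2 b
  rw [Presented.lift_triangularMap, Presented.lift_triangularMap] at hab
  rw [hinj hab]

theorem Presented.lift_surjective {φ : K →ₐ[ℂ] A} {E F : n → A} (h : TriangularRelations σ κ φ E F)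
    (hsurj : Function.Surjective (triangularMap φ E F)) :
    Function.Surjective (Presented.lift h) := by
  intro a
  obtain ⟨t, rfl⟩ := hsurj a
  exact ⟨_, Presented.lift_triangularMap h t⟩

theorem triangularMap_comp {L : Type*} [CommRing L] [Algebra ℂ L] (φ : K →ₐ[ℂ] A) (ψ : L →ₐ[ℂ] K)
    (E F : n → A) (t) : triangularMap (φ.comp ψ) E F t =
      triangularMap φ E F ((ψ.toLinearMap.rTensor (FreeAlgebra ℂ n)).lTensor _ t) := by
  suffices h : triangularMap (φ.comp ψ) E F =
      triangularMap φ E F ∘ₗ (ψ.toLinearMap.rTensor (FreeAlgebra ℂ n)).lTensor _ from congr($h t)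
  ext
  simp [triangularMap_tmul]

/-- Tensoring over a field preserves injections, so coefficients may be restricted along an
injective map. -/
theorem triangularMap_comp_injective {L : Type*} [CommRing L] [Algebra ℂ L] {φ : K →ₐ[ℂ] A}
    {ψ : L →ₐ[ℂ] K} {E F : n → A} (h : Function.Injective (triangularMap φ E F))
    (hψ : Function.Injective ψ) : Function.Injective (triangularMap (φ.comp ψ) E F) := by
  have h1 : Function.Injective ((ψ.toLinearMap.rTensor (FreeAlgebra ℂ n)).lTensor
      (FreeAlgebra ℂ n)) :=
    Module.Flat.lTensor_preserves_injective_linearMap _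
      (Module.Flat.rTensor_preserves_injective_linearMap _ hψ)
  intro s t hst
  rw [triangularMap_comp, triangularMap_comp] at hst
  exact h1 (h hst)

theorem one_tmul_injective (V W : Type*) [Ring V] [Ring W] [Algebra ℂ V] [Algebra ℂ W]
    [Nontrivial V] : Function.Injective fun w : W => (1 : V) ⊗ₜ[ℂ] w :=
  Algebra.TensorProduct.includeRight_injective (FaithfulSMul.algebraMap_injective ℂ V)

theorem tmul_one_injective (V W : Type*) [Ring V] [Ring W] [Algebra ℂ V] [Algebra ℂ W]
    [Nontrivial W] : Function.Injective fun v : V => v ⊗ₜ[ℂ] (1 : W) :=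
  Algebra.TensorProduct.includeLeft_injective (S := ℂ) (FaithfulSMul.algebraMap_injective ℂ W)

/-- Each factor is recovered by putting `1` in the other two places of the tensor product. -/
theorem injective_of_triangularMap {φ : K →ₐ[ℂ] A} {E F : n → A} [Nontrivial K]
    (h : Function.Injective (triangularMap φ E F)) :
    Function.Injective (FreeAlgebra.lift ℂ E) ∧ Function.Injective (FreeAlgebra.lift ℂ F) ∧
      Function.Injective φ := by
  refine ⟨fun a b hab => ?_, fun a b hab => ?_, fun a b hab => ?_⟩
  · refine one_tmul_injective K _ (one_tmul_injective (FreeAlgebra ℂ n) _ (h ?_))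
    simp [triangularMap_tmul, hab]
  -- The triangular map reads words in the `f`'s backwards, so the star is used to pass from
  -- `FreeAlgebra.lift` to `antiLift`.
  · rw [← antiLift_star, ← antiLift_star] at hab
    refine star_injective (tmul_one_injective _ (K ⊗[ℂ] FreeAlgebra ℂ n) (h ?_))
    simp [triangularMap_tmul, hab, Algebra.TensorProduct.one_def]
  · refine tmul_one_injective _ (FreeAlgebra ℂ n) (one_tmul_injective (FreeAlgebra ℂ n) _ (h ?_))
    simp [triangularMap_tmul, hab]

end Triangular

/-! ### Presentation and coproduct of an arbitrary double-bosonisation -/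

section Structure

variable {n : Type u} [Fintype n] [DecidableEq n] {ℓ : ℂ} {β : Matrix n n ℂ} {r : n → ℂ}
  {D : Type v} [Ring D] [HopfAlgebra ℂ D]
  (dB : DoubleBosonisation ℓ β (freeGrading degE) (freeGrading degF) (freeComul ℓ β degF)
    (freeComul ℓ β degE) (freeEv ℓ β r) D)

open FreeAlgebra

namespace DoubleBosonisation

/-- The generator `e_i`. -/
noncomputable def e (i : n) : D := dB.inclB (ι ℂ i)

/-- The generator `f_i`. -/
noncomputable def f (i : n) : D := dB.inclC (ι ℂ i)

/-- The inclusion of `U_q(β)` as an algebra. -/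
noncomputable def homH : Uq ℓ β →ₐ[ℂ] D := (dB.inclH : Uq ℓ β →ₐ[ℂ] D)

theorem homH_apply (h : Uq ℓ β) : dB.homH h = dB.inclH h := rfl

theorem inclC_one : dB.inclC 1 = 1 := by
  rw [dB.inclC_eq, MulOpposite.op_one, map_one]

theorem inclC_mul (a b : FreeAlgebra ℂ n) : dB.inclC (a * b) = dB.inclC b * dB.inclC a := by
  rw [dB.inclC_eq, MulOpposite.op_mul, map_mul, ← dB.inclC_eq, ← dB.inclC_eq]

theorem inclC_eq_antiLift : dB.inclC = antiLift dB.f := by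
  refine free_linearMap_ext_left ?_ fun i x hx => ?_
  · rw [dB.inclC_one, antiLift_one]
  · rw [dB.inclC_mul, antiLift_mul, hx, antiLift_ι, f]

theorem inclB_eq_lift : dB.inclB = FreeAlgebra.lift ℂ dB.e := by
  ext i
  simp [e]

theorem triangularMap_bijective :
    Function.Bijective (triangularMap dB.homH dB.e dB.f) := by
  have h := dB.triangular
  rw [dB.inclB_eq_lift, dB.inclC_eq_antiLift] at h
  exact h

/-- The degree of `f_i` is opposite to that of `e_i`, so the rule for `f_i` is obtained by starting
from the translated `h`. For `e_i` and `f_j`, both primitive, the cross relation reduces on each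
side to one ordinary product and one pairing term, with `q^{-H_j}` on the left and `q^{H^i}` on the
right. -/
theorem relations :
    TriangularRelations (shiftE ℓ β) (kappa ℓ β r) dB.homH dB.e dB.f where
  e_map i h := by
    refine (dB.cross_BH (ι ℂ i) h).trans ?_
    refine (mul_map_act_right (freeGrading degE) _ _ (ι_mem_freeGrading degE i) _).trans ?_
    rw [evalRight_comul]
    rfl
  map_f i h := by
    refine ((dB.cross_CH (ι ℂ i) (shiftE ℓ β i h)).trans ?_).symm
    refine (mul_map_act_left (freeGrading degF) _ _ (ι_mem_freeGrading degF i) _).trans ?_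
    rw [evalLeft_comul, ← shift_apply, shiftE, ← shift_add,
      show degF i + degE i = 0 by simp [degE, degF], shift_zero]
    rfl
  e_f i j := by
    have h := dB.cross_BC (ι ℂ i) (ι ℂ j)
    have h0 : (1 : FreeAlgebra ℂ n) ∈ freeGrading degE 0 := SetLike.GradedOne.one_mem
    have h0' : (1 : FreeAlgebra ℂ n) ∈ freeGrading degF 0 := SetLike.GradedOne.one_mem
    have hS : ∀ b, evRSnd ℓ β (freeGrading degF) (freeEv ℓ β r) (ι ℂ j) b =
        freeEv ℓ β r (ι ℂ j) b • expDown ℓ β j (-1) := fun b => by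
      rw [FreeDouble.evRSnd_of_mem ℓ β r (ι_mem_freeGrading degF j), RSnd_degF]
    have hS' : ∀ b, evRSnd ℓ β (freeGrading degF) (freeEv ℓ β r) 1 b =
        freeCounit b • 1 := fun b => by
      rw [FreeDouble.evRSnd_of_mem ℓ β r h0', RSnd_zero, freeEv_one_left]
    have hF : ∀ c, evRFst ℓ β (freeGrading degE) (freeEv ℓ β r) c (ι ℂ i) =
        freeEv ℓ β r c (ι ℂ i) • expUp ℓ β i 1 := fun c => by
      rw [FreeDouble.evRFst_of_mem ℓ β r (ι_mem_freeGrading degE i), RFst_degE]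
    have hF' : ∀ c, evRFst ℓ β (freeGrading degE) (freeEv ℓ β r) c 1 =
        freeCounit c • 1 := fun c => by
      rw [FreeDouble.evRFst_of_mem ℓ β r h0, RFst_zero, freeEv_one_right]
    rw [freeComul_ι, freeComul_ι] at h
    simp [crossLeft, crossRight, hS, hS', hF, hF', freeEv_ι_ι, freeEv_one_left, freeEv_one_right,
      dB.inclC_one] at h
    rw [kappa, map_smul, map_sub, homH_apply, homH_apply, e, f]
    by_cases hij : i = j
    · subst hij
      simp only [if_true] at h ⊢
      rw [smul_sub, add_sub, eq_sub_iff_add_eq, add_comm (dB.inclC _ * _)]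
      rwa [show dB.inclH ((r i - (r i)⁻¹)⁻¹ • expDown ℓ β i (-1)) = _ from
        map_smul dB.homH _ _] at h
    · simpa [hij, Ne.symm hij] using h

/-- A double-bosonisation is presented by the cross relations. -/
noncomputable def presentation : FreeDouble ℓ β r ≃ₐ[ℂ] D :=
  AlgEquiv.ofBijective (Presented.lift dB.relations)
    ⟨Presented.lift_injective (shiftE_comm ℓ β) _ dB.triangularMap_bijective.1,
      Presented.lift_surjective _ dB.triangularMap_bijective.2⟩

theorem presentation_e (i : n) : dB.presentation (FreeDouble.e ℓ β r i) = dB.e i :=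
  Presented.lift_e _ _

theorem presentation_f (i : n) : dB.presentation (FreeDouble.f ℓ β r i) = dB.f i :=
  Presented.lift_f _ _

theorem presentation_of (h : Uq ℓ β) :
    dB.presentation (FreeDouble.of ℓ β r h) = dB.inclH h := Presented.lift_of _ _

theorem existsUnique_lift {A : Type w} [Ring A] [Algebra ℂ A] {φ : Uq ℓ β →ₐ[ℂ] A} {E F : n → A}
    (h : TriangularRelations (shiftE ℓ β) (kappa ℓ β r) φ E F) :
    ∃! Φ : D →ₐ[ℂ] A, (∀ h, Φ (dB.inclH h) = φ h) ∧ (∀ i, Φ (dB.e i) = E i) ∧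
      ∀ i, Φ (dB.f i) = F i := by
  refine ⟨(Presented.lift h).comp dB.presentation.symm.toAlgHom, ⟨fun k => ?_, fun i => ?_,
    fun i => ?_⟩, fun Φ hΦ => ?_⟩
  · rw [← dB.presentation_of]
    exact (congrArg _ (dB.presentation.symm_apply_apply _)).trans (Presented.lift_of h k)
  · rw [← dB.presentation_e]
    exact (congrArg _ (dB.presentation.symm_apply_apply _)).trans (Presented.lift_e h i)
  · rw [← dB.presentation_f]
    exact (congrArg _ (dB.presentation.symm_apply_apply _)).trans (Presented.lift_f h i)
  · have key : Φ.comp dB.presentation.toAlgHom = Presented.lift h := by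
      refine Presented.algHom_ext (fun k => ?_) (fun i => ?_) fun i => ?_
      · exact (congrArg Φ (dB.presentation_of k)).trans
          ((hΦ.1 k).trans (Presented.lift_of h k).symm)
      · exact (congrArg Φ (dB.presentation_e i)).trans
          ((hΦ.2.1 i).trans (Presented.lift_e h i).symm)
      · exact (congrArg Φ (dB.presentation_f i)).trans
          ((hΦ.2.2 i).trans (Presented.lift_f h i).symm)
    rw [← key]
    ext a
    exact congrArg Φ (dB.presentation.apply_symm_apply a).symm

theorem comul_e (i : n) : Coalgebra.comul (R := ℂ) (dB.e i) =
    dB.e i ⊗ₜ[ℂ] dB.inclH (expUp ℓ β i 1) + 1 ⊗ₜ[ℂ] dB.e i := by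
  have h0 : (1 : FreeAlgebra ℂ n) ∈ freeGrading degE 0 := SetLike.GradedOne.one_mem
  rw [e, dB.comul_B, freeComul_ι]
  simp [actRFst, byDegree_of_mem _ _ (ι_mem_freeGrading degE i), byDegree_of_mem _ _ h0,
    RFst_degE, RFst_zero]

theorem comul_f (i : n) : Coalgebra.comul (R := ℂ) (dB.f i) =
    dB.f i ⊗ₜ[ℂ] 1 + dB.inclH (expDown ℓ β i (-1)) ⊗ₜ[ℂ] dB.f i := by
  have h0 : (1 : FreeAlgebra ℂ n) ∈ freeGrading degF 0 := SetLike.GradedOne.one_mem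
  rw [f, dB.comul_C, freeComul_ι]
  simp [actRSnd, byDegree_of_mem _ _ (ι_mem_freeGrading degF i), byDegree_of_mem _ _ h0,
    RSnd_degF, RSnd_zero, dB.inclC_one]

theorem comul_xi (i : n) : Coalgebra.comul (R := ℂ) (dB.inclH (xi ℓ β i)) =
    dB.inclH (xi ℓ β i) ⊗ₜ[ℂ] 1 + 1 ⊗ₜ[ℂ] dB.inclH (xi ℓ β i) := by
  rw [← CoalgHomClass.map_comp_comul_apply,
    show Coalgebra.comul (R := ℂ) (xi ℓ β i) = _ from comulUq_xi i]
  simp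

/-- The map to a double-bosonisation from the algebra presented by the relations without `ξ`. -/
noncomputable def expHom : Presented (shiftExp ℓ β) (kappaExp ℓ β r) →ₐ[ℂ] D :=
  Presented.lift dB.relations.restrict

theorem expHom_e (i : n) : dB.expHom (Presented.e _ _ i) = dB.e i := Presented.lift_e _ _

theorem expHom_f (i : n) : dB.expHom (Presented.f _ _ i) = dB.f i := Presented.lift_f _ _

theorem expHom_of (h : UqExp ℓ β) : dB.expHom (Presented.of _ _ h) = dB.inclH h :=
  Presented.lift_of _ _

/-- The algebra presented over `UqExp` has its own triangular decomposition, and triangular words in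
`D` remain independent when their coefficients are restricted to `UqExp`. -/
theorem expHom_injective : Function.Injective dB.expHom :=
  Presented.lift_injective (shiftExp_comm ℓ β) _
    (triangularMap_comp_injective dB.triangularMap_bijective.1 Subtype.val_injective)

theorem expHom_range : dB.expHom.range = Algebra.adjoin ℂ (Set.range dB.e ∪ Set.range dB.f ∪
    {a | ∃ i t, a = dB.inclH (expUp ℓ β i t)} ∪ {a | ∃ i t, a = dB.inclH (expDown ℓ β i t)}) := by
  apply le_antisymm
  · rintro _ ⟨a, rfl⟩
    change dB.expHom a ∈ _
    induction a using Presented.induction with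
    | of h =>
      rw [expHom_of]
      have : UqExp ℓ β ≤ (Algebra.adjoin ℂ (Set.range dB.e ∪ Set.range dB.f ∪
          {a | ∃ i t, a = dB.inclH (expUp ℓ β i t)} ∪
          {a | ∃ i t, a = dB.inclH (expDown ℓ β i t)})).comap dB.homH := by
        refine Algebra.adjoin_le ?_
        rintro _ (⟨i, t, rfl⟩ | ⟨i, t, rfl⟩)
        · exact Algebra.subset_adjoin (Or.inl (Or.inr ⟨i, t, rfl⟩))
        · exact Algebra.subset_adjoin (Or.inr ⟨i, t, rfl⟩)
      exact this h.2
    | e i => rw [expHom_e]; exact Algebra.subset_adjoin (Or.inl (Or.inl (Or.inl ⟨i, rfl⟩)))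
    | f i => rw [expHom_f]; exact Algebra.subset_adjoin (Or.inl (Or.inl (Or.inr ⟨i, rfl⟩)))
    | add a b ha hb => rw [map_add]; exact add_mem ha hb
    | mul a b ha hb => rw [map_mul]; exact mul_mem ha hb
  · refine Algebra.adjoin_le ?_
    rintro _ (((⟨i, rfl⟩ | ⟨i, rfl⟩) | ⟨i, t, rfl⟩) | ⟨i, t, rfl⟩)
    · exact ⟨_, dB.expHom_e i⟩
    · exact ⟨_, dB.expHom_f i⟩
    · exact ⟨_, dB.expHom_of (UqExp.up ℓ β i t)⟩
    · exact ⟨_, dB.expHom_of (UqExp.down ℓ β i t)⟩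

/-- The generators are elements of `D` rather than of `S`, so the values of the map are prescribed
for those members of `S` that equal a generator in `D`. -/
theorem existsUnique_lift_exp {S : Subalgebra ℂ D} (hS : S = dB.expHom.range) {A : Type w} [Ring A]
    [Algebra ℂ A] {φ : UqExp ℓ β →ₐ[ℂ] A} {E F : n → A}
    (h : TriangularRelations (shiftExp ℓ β) (kappaExp ℓ β r) φ E F) :
    ∃! Φ : S →ₐ[ℂ] A,
      (∀ (a : S) (h : UqExp ℓ β), (a : D) = dB.inclH (h : Uq ℓ β) → Φ a = φ h) ∧
      (∀ (a : S) (i : n), (a : D) = dB.e i → Φ a = E i) ∧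
      ∀ (a : S) (i : n), (a : D) = dB.f i → Φ a = F i := by
  subst hS
  let Ψ := AlgEquiv.ofInjective dB.expHom dB.expHom_injective
  have hΨ : ∀ (a : dB.expHom.range) x, (a : D) = dB.expHom x → Ψ x = a :=
    fun a x hax => Subtype.ext hax.symm
  refine ⟨(Presented.lift h).comp Ψ.symm.toAlgHom, ⟨fun a k hk => ?_, fun a i hi => ?_,
    fun a i hi => ?_⟩, fun Φ hΦ => ?_⟩
  · rw [← dB.expHom_of] at hk
    rw [← hΨ a _ hk]
    exact (congrArg _ (Ψ.symm_apply_apply _)).trans (Presented.lift_of h k)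
  · rw [← dB.expHom_e] at hi
    rw [← hΨ a _ hi]
    exact (congrArg _ (Ψ.symm_apply_apply _)).trans (Presented.lift_e h i)
  · rw [← dB.expHom_f] at hi
    rw [← hΨ a _ hi]
    exact (congrArg _ (Ψ.symm_apply_apply _)).trans (Presented.lift_f h i)
  · have key : Φ.comp Ψ.toAlgHom = Presented.lift h := by
      refine Presented.algHom_ext (fun k => ?_) (fun i => ?_) fun i => ?_
      · exact (hΦ.1 (Ψ _) k (dB.expHom_of k)).trans (Presented.lift_of h k).symm
      · exact (hΦ.2.1 (Ψ _) i (dB.expHom_e i)).trans (Presented.lift_e h i).symm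
      · exact (hΦ.2.2 (Ψ _) i (dB.expHom_f i)).trans (Presented.lift_f h i).symm
    rw [← key]
    ext a
    exact congrArg Φ (Ψ.apply_symm_apply a).symm

end DoubleBosonisation

end Structure

end CStat

/-! ### Assembly of the proposition -/

theorem proposition4p3 {n : Type u} [Fintype n] [DecidableEq n] (β : Matrix n n ℂ)
    (ℓ : ℂ) (r : n → ℂ) (hr : ∀ i, r i - (r i)⁻¹ ≠ 0) :
    -- the free algebras `ℂ⟨e⟩` and `ℂ⟨f⟩` are braided groups, dual by the pairing `ev`
    CStat.IsBraidedGroup ℓ β (CStat.freeGrading CStat.degE) (CStat.freeComul ℓ β CStat.degE)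
      CStat.freeCounit ∧
    CStat.IsBraidedGroup ℓ β (CStat.freeGrading CStat.degF) (CStat.freeComul ℓ β CStat.degF)
      CStat.freeCounit ∧
    CStat.IsDualPairing (CStat.freeGrading CStat.degE) (CStat.freeGrading CStat.degF)
      (CStat.freeComul ℓ β CStat.degF) CStat.freeCounit
      (CStat.freeComul ℓ β CStat.degE) CStat.freeCounit (CStat.freeEv ℓ β r) ∧
    (∀ i j : n, CStat.freeEv ℓ β r (FreeAlgebra.ι ℂ i) (FreeAlgebra.ι ℂ j) =
      if i = j then (r i - (r i)⁻¹)⁻¹ else 0) ∧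
    -- their double-bosonisation exists
    (∃ (D : Type u) (_ : Ring D) (_ : HopfAlgebra ℂ D), Nonempty
      (CStat.DoubleBosonisation ℓ β (CStat.freeGrading CStat.degE) (CStat.freeGrading CStat.degF)
        (CStat.freeComul ℓ β CStat.degF) (CStat.freeComul ℓ β CStat.degE)
        (CStat.freeEv ℓ β r) D)) ∧
    -- and has the following structure
    ∀ (D : Type v) [Ring D] [HopfAlgebra ℂ D]
      (dB : CStat.DoubleBosonisation ℓ β (CStat.freeGrading CStat.degE)
        (CStat.freeGrading CStat.degF) (CStat.freeComul ℓ β CStat.degF)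
        (CStat.freeComul ℓ β CStat.degE) (CStat.freeEv ℓ β r) D)
      (e f x : n → D) (up down : n → ℤ → D),
      (∀ i, e i = dB.inclB (FreeAlgebra.ι ℂ i)) →
      (∀ i, f i = dB.inclC (FreeAlgebra.ι ℂ i)) →
      (∀ i, x i = dB.inclH (CStat.xi ℓ β i)) →
      (∀ i t, up i t = dB.inclH (CStat.expUp ℓ β i t)) →
      (∀ i t, down i t = dB.inclH (CStat.expDown ℓ β i t)) →
      -- the `e i` are free, the `f i` are free, `U_q(β)` embeds and the `ξ_i` commute
      Function.Injective (FreeAlgebra.lift ℂ e) ∧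
      Function.Injective (FreeAlgebra.lift ℂ f) ∧
      Function.Injective dB.inclH ∧
      (∀ i j, Commute (x i) (x j)) ∧
      -- the cross relations
      CStat.CrossRelations ℓ β r x up down e f ∧
      -- the coproduct
      (∀ i, Coalgebra.comul (R := ℂ) (e i) = e i ⊗ₜ[ℂ] up i 1 + 1 ⊗ₜ[ℂ] e i) ∧
      (∀ i, Coalgebra.comul (R := ℂ) (f i) = f i ⊗ₜ[ℂ] 1 + down i (-1) ⊗ₜ[ℂ] f i) ∧
      (∀ i, Coalgebra.comul (R := ℂ) (x i) = x i ⊗ₜ[ℂ] 1 + 1 ⊗ₜ[ℂ] x i) ∧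
      -- the algebra is generated over `U_q(β)` by the `e i` and `f i` with the above relations
      (∀ (A : Type w) [Ring A] [Algebra ℂ A] (φ : CStat.Uq ℓ β →ₐ[ℂ] A) (E F : n → A),
        CStat.CrossRelations ℓ β r (fun i => φ (CStat.xi ℓ β i))
          (fun i t => φ (CStat.expUp ℓ β i t)) (fun i t => φ (CStat.expDown ℓ β i t)) E F →
        ∃! Φ : D →ₐ[ℂ] A, (∀ h, Φ (dB.inclH h) = φ h) ∧ (∀ i, Φ (e i) = E i) ∧
          ∀ i, Φ (f i) = F i) ∧
      -- the relations without `ξ` define the subalgebra generated by the `e i`, the `f i` and the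
      -- exponentials
      (∀ S : Subalgebra ℂ D, S = Algebra.adjoin ℂ (Set.range e ∪ Set.range f ∪
          {a | ∃ i t, a = up i t} ∪ {a | ∃ i t, a = down i t}) →
        ∀ (A : Type w) [Ring A] [Algebra ℂ A] (φ : CStat.UqExp ℓ β →ₐ[ℂ] A) (E F : n → A),
        CStat.ExpRelations ℓ β r (fun i t => φ (CStat.UqExp.up ℓ β i t))
          (fun i t => φ (CStat.UqExp.down ℓ β i t)) E F →
        ∃! Φ : S →ₐ[ℂ] A,
          (∀ (a : S) (h : CStat.UqExp ℓ β), (a : D) = dB.inclH (h : CStat.Uq ℓ β) → Φ a = φ h) ∧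
          (∀ (a : S) (i : n), (a : D) = e i → Φ a = E i) ∧
          ∀ (a : S) (i : n), (a : D) = f i → Φ a = F i) := by
  refine ⟨CStat.isBraidedGroup_free ℓ β _, CStat.isBraidedGroup_free ℓ β _,
    CStat.isDualPairing_free ℓ β r, CStat.freeEv_ι_ι ℓ β r,
    ⟨CStat.FreeDouble ℓ β r, inferInstance, inferInstance,
      ⟨CStat.FreeDouble.doubleBosonisation ℓ β r⟩⟩, ?_⟩
  intro D _ _ dB e f x up down he hf hx hup hdown
  obtain rfl : e = dB.e := funext he
  obtain rfl : f = dB.f := funext hf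
  obtain rfl : x = fun i => dB.inclH (CStat.xi ℓ β i) := funext hx
  obtain rfl : up = fun i t => dB.inclH (CStat.expUp ℓ β i t) := funext₂ hup
  obtain rfl : down = fun i t => dB.inclH (CStat.expDown ℓ β i t) := funext₂ hdown
  obtain ⟨h1, h2, h3⟩ := CStat.injective_of_triangularMap dB.triangularMap_bijective.1
  refine ⟨h1, h2, h3, fun i j => ?_, dB.relations.cross, dB.comul_e, dB.comul_f, dB.comul_xi,
    fun A _ _ φ E F h => dB.existsUnique_lift h.triangular, fun S hS A _ _ φ E F h =>
      dB.existsUnique_lift_exp (hS.trans dB.expHom_range.symm) h.triangular⟩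
  exact (Commute.all (CStat.xi ℓ β i) (CStat.xi ℓ β j)).map dB.homH
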